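/- Setting. Let $\mathcal S$ be a Polish space, $P$ a Markov kernel on $\mathcal S$, $x_0\in\mathcal S$, and $\tilde X=(\tilde X_t)_{t\in\mathbb N}$ a Markov chain with transition $P$ and $\tilde X_0=x_0$ a.s. Let $A,B\subset\mathcal S$ be disjoint Borel sets, $\tau_A,\tau_B$ the first entrance times of $\tilde X$ in $A,B$, $X_t=\tilde X_{t\wedge\tau_A}$, and $\pi=\mathrm{Law}(X)$ on $\mathcal P=\mathcal S^{\mathbb N}$. Let $\xi:\mathcal S\to\mathbb R$ be measurable and $z_{\max}\in\mathbb R$ with $B\subset\{\xi>z_{\max}\}$; let $1\le k\le n_{\rm rep}-1$. For $x\in\mathcal P$ let $T_A(x),T_B(x)$ be the first entrance times, $\Xi(x)=\sup_t\xi(x_{t\wedge T_A(x)})\in\mathbb R\cup\{+\infty\}$, and $T_z(x)=\inf\{t\le T_A(x):\xi(x_t)>z\}$ (strict inequality, $\inf\emptyset=+\infty$). The resampling law $\pi_z(x,\cdot)$ is the law of the path $Y$ with $Y_t=x_t$ for $t\le T_z(x)$, continued after $T_z(x)$ with the kernel $P$, and stopped when it enters $A$. Let $\mathrm{filt}_z=\sigma(x\mapsto(x_{t\wedge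 T_z(x)})_{t\ge0})$. AMS algorithm. Start with i.i.d. replicas $X^{(n,0)}$, $1\le n\le n_{\rm rep}$, of law $\pi$, with weights $G^{(n,0)}=1/n_{\rm rep}$, $I^{(0)}_{\rm on}=\{1,\dots,n_{\rm rep}\}$, $I^{(0)}_{\rm off}=\emptyset$; write $I^{(q)}=I^{(q)}_{\rm on}\sqcup I^{(q)}_{\rm off}$. At iteration $q$, $Z^{(q)}$ is the $k$-th order statistic of $(\Xi(X^{(n,q)}))_{n\in I_{\rm on}^{(q)}}$, replaced by $+\infty$ if all these values are $\le$ that order statistic. If $Z^{(q)}>z_{\max}$ the algorithm stops and $Q_{\rm iter}=q$. Otherwise all $K^{(q+1)}$ working replicas with $\Xi\le Z^{(q)}$ (ties included) are retired: their labels move to $I_{\rm off}^{(q+1)}$ and their weights are kept. The weights of the other working replicas are multiplied by $(n_{\rm rep}-K^{(q+1)})/n_{\rm rep}$. Finally $K^{(q+1)}$ new working replicas, with labels $\mathrm{card}\,I^{(q)}+1,\dots,\mathrm{card}\,I^{(q)}+K^{(q+1)}$, are created: given the past, their parents are independent and uniform among the working replicas with $\Xi>Z^{(q)}$; given the past and the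 parents, the new paths are independent with laws $\pi_{Z^{(q)}}(\text{parent},\cdot)$; each has the updated weight of its parent. Old replicas are not modified. After stopping, everything is frozen. Theorem. (1) The algorithm fits the GAMS framework, that is: (a) $(\mathrm{filt}_z)_{z\in\mathbb R}$ is a filtration of Borel $\sigma$-fields; $(z,x)\mapsto\pi_z(x,\cdot)$ is a Markov kernel; for every continuous bounded $\varphi$, $z\mapsto\pi_z(\varphi)(x)$ is right-continuous for every $x\in\mathcal P$ and tends to $\pi(\varphi)$ as $z\to-\infty$ for every path $x$ starting at $x_0$, and $\pi$ and all $\pi_z(x,\cdot)$ with $x$ starting at $x_0$ are carried by paths starting at $x_0$; and for all $z\le z'$, all $x$ and all bounded measurable $\varphi$, if $Y\sim\pi_z(x,\cdot)$ then $\mathbb E(\varphi(Y)\mid Y^{-1}(\mathrm{filt}_{z'}))=\pi_{z'}(\varphi)(Y)$ a.s. (b) For a random system $\mathcal X=(X^{(n)})_{n\in I}$ let $\mathrm{filt}_z^{\mathcal X}$ be the $\sigma$-field generated by $I$ and by the events $\{n\in I,\ X^{(n)}\in s\}$, $s\in\mathrm{filt}_z$. Let $P^{(q+1)}$ be the map sending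 each new label to its parent and each older label to itself, $\mathcal F^{(0)}_z=\mathrm{filt}^{\mathcal X^{(0)}}_z$, $\mathcal F^{(q)}=\mathcal F^{(q)}_{Z^{(q)}}$ (stopped $\sigma$-field) and $\mathcal F^{(q+1)}_z=\mathcal F^{(q)}\vee\sigma(P^{(q+1)})\vee\mathrm{filt}^{\mathcal X^{(q+1)}}_z$. Then $Z^{(q)}$ is a stopping level for $(\mathcal F_z^{(q)})_z$ and $Z^{(q)}\le Z^{(q+1)}$ a.s.; $\{Z^{(q)}\le z_{\max}\}\in\mathcal F^{(q)}$; $P^{(q+1)}$ is sampled conditionally on $\mathcal F^{(q)}$; the branching numbers $B^{(n,q+1)}=1+\mathrm{card}\{\text{children of }n\}$ satisfy $\mathbb E(B^{(n,q+1)}\mid\mathcal F^{(q)})>0$ and the weights satisfy $G^{(n',q+1)}=G^{(n,q)}/\mathbb E(B^{(n,q+1)}\mid\mathcal F^{(q)})$ a.s. for $n=P^{(q+1)}(n')$; the labels evolve, and the new replicas are sampled conditionally on the past from $\pi_{Z^{(q)}}(X^{(P^{(q+1)}(n'),q)},\cdot)$, as the framework prescribes. (2) For every $q$, $\sum_{n\in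 I^{(q)}}G^{(n,q)}=1$ a.s. (3) If $Q_{\rm iter}<+\infty$ a.s., then for every bounded measurable $\varphi:\mathcal P\to\mathbb R$ the estimator $\hat\varphi=\sum_{n\in I^{(Q_{\rm iter})}}G^{(n,Q_{\rm iter})}\varphi(X^{(n,Q_{\rm iter})})$ is integrable and $\mathbb E(\hat\varphi)=\mathbb E(\varphi(X))$; moreover $\hat p=\sum_{n\in I_{\rm on}^{(Q_{\rm iter})}}G^{(n,Q_{\rm iter})}\mathbf 1_{T_B(X^{(n,Q_{\rm iter})})<T_A(X^{(n,Q_{\rm iter})})}$ is integrable and $\mathbb E(\hat p)=\mathbb P(\tau_B<\tau_A)$. -/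

import Mathlib

open MeasureTheory ProbabilityTheory Filter Topology
open scoped ENNReal BoundedContinuousFunction

noncomputable section

namespace GAMS

/-- The convention extending a resampling kernel to infinite levels: resampling from level `-∞`
is sampling from `π`, resampling from level `+∞` does nothing. -/
def extKernel {E : Type*} [MeasurableSpace E] (π : Measure E) (R : ℝ → E → Measure E)
    (z : EReal) (x : E) : Measure E :=
  if z = ⊥ then π else if z = ⊤ then Measure.dirac x else R z.toReal x

/-- The modelling assumptions of the GAMS framework for a state space `E`, a law `π` on it,
a filtration `filt` on `E` indexed by levels and a family `R z x` of resampling laws.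
The set `E₀` is the part of `E` in which all replicas live (it carries `π` and is stable under
resampling); the limit at level `-∞` is required for the states in `E₀`. -/
structure Setting {E : Type*} [TopologicalSpace E] [MeasurableSpace E] (π : Measure E)
    (E₀ : Set E) (filt : ℝ → MeasurableSpace E) (R : ℝ → E → Measure E) : Prop where
  isProbabilityMeasure : IsProbabilityMeasure π
  measurableSet_support : MeasurableSet E₀
  law_support : π E₀ᶜ = 0
  kernel_support : ∀ z, ∀ x ∈ E₀, R z x E₀ᶜ = 0
  filt_le : ∀ z, filt z ≤ ‹MeasurableSpace E›
  filt_mono : Monotone filt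
  kernel_prob : ∀ z x, IsProbabilityMeasure (R z x)
  kernel_measurable : Measurable (fun p : ℝ × E => R p.1 p.2)
  right_continuous : ∀ (x : E) (φ : E →ᵇ ℝ) (z : ℝ),
    ContinuousWithinAt (fun z' => ∫ y, φ y ∂(R z' x)) (Set.Ici z) z
  tendsto_atBot : ∀ x ∈ E₀, ∀ φ : E →ᵇ ℝ,
    Tendsto (fun z => ∫ y, φ y ∂(R z x)) atBot (𝓝 (∫ y, φ y ∂π))
  consistent : ∀ (z : ℝ) (x : E) (z' : ℝ), z ≤ z' → ∀ φ : E → ℝ, Measurable φ →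
    (∃ C, ∀ y, |φ y| ≤ C) →
    (R z x)[φ | filt z'] =ᵐ[R z x] fun y => ∫ y', φ y' ∂(R z' y)

/-- The pull-back to `Ω` of the level filtration on systems of replicas, by the random system
`(X n)` with `n` in the random finite label set `I`. -/
def systemField {Ω E : Type*} (filt : ℝ → MeasurableSpace E) (I : Ω → Finset ℕ)
    (X : ℕ → Ω → E) (z : ℝ) : MeasurableSpace Ω :=
  MeasurableSpace.comap I ⊤ ⊔
    MeasurableSpace.generateFrom
      {F | ∃ (n : ℕ) (s : Set E), MeasurableSet[filt z] s ∧ F = {ω | n ∈ I ω ∧ X n ω ∈ s}}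

/-- `Z` is a stopping level for the filtration `F`. -/
def IsStoppingLevel {Ω : Type*} (F : ℝ → MeasurableSpace Ω) (Z : Ω → EReal) : Prop :=
  ∀ z : ℝ, MeasurableSet[F z] {ω | Z ω ≤ (z : EReal)}

/-- The σ-field stopped at `Z` (the events below form a σ-field when `Z` is a stopping level;
`m` plays the role of the σ-field at level `+∞`). -/
def stoppedField {Ω : Type*} (m : MeasurableSpace Ω) (F : ℝ → MeasurableSpace Ω)
    (Z : Ω → EReal) : MeasurableSpace Ω :=
  MeasurableSpace.generateFrom
    {G | MeasurableSet[m] G ∧ ∀ z : ℝ, MeasurableSet[F z] (G ∩ {ω | Z ω ≤ (z : EReal)})}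

/-- The random variables of a splitting algorithm. Labels are positive integers. For the first
four fields and `run`, the index `q` is the iteration index; `branch q n` and `par q n` are the
branching number of the label `n` and the parent of the new label `n`, as drawn in the splitting
step of iteration `q` (so they are `B^(n,q+1)` and `P^(q+1)(n)`). The algorithm goes on
at iteration `q` when `run q` holds and stops when it fails. -/
structure Scheme (Ω E : Type*) where
  labels : ℕ → Ω → Finset ℕ
  X : ℕ → ℕ → Ω → E
  weight : ℕ → ℕ → Ω → ℝ
  level : ℕ → Ω → EReal
  run : ℕ → Ω → Prop
  branch : ℕ → ℕ → Ω → ℕ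
  par : ℕ → ℕ → Ω → ℕ

namespace Scheme

variable {Ω E : Type*}

/-- Labels removed in the splitting step of iteration `q`. -/
def killed (D : Scheme Ω E) (q : ℕ) (ω : Ω) : Finset ℕ :=
  (D.labels q ω).filter fun n => D.branch q n ω = 0

/-- Number of new replicas created in iteration `q`. -/
def newCard (D : Scheme Ω E) (q : ℕ) (ω : Ω) : ℕ :=
  ∑ n ∈ D.labels q ω, (D.branch q n ω - 1)

/-- Labels of the new replicas created in iteration `q`. -/
def newLabels (D : Scheme Ω E) (q : ℕ) (ω : Ω) : Finset ℕ :=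
  Finset.Icc ((D.labels q ω).sup id + 1) ((D.labels q ω).sup id + D.newCard q ω)

/-- The children-parent map, extended by the identity to the surviving old labels
and by `0` (not a label) to all other integers. -/
def parentMap (D : Scheme Ω E) (q n : ℕ) (ω : Ω) : ℕ :=
  if n ∈ D.newLabels q ω then D.par q n ω
  else if n ∈ D.labels q ω \ D.killed q ω then n else 0

/-- The σ-field generated by the children-parent map of iteration `q`. -/
def parentField (D : Scheme Ω E) (q : ℕ) : MeasurableSpace Ω :=
  ⨆ n, MeasurableSpace.comap (D.parentMap q n) ⊤

/-- The σ-fields `F^(q)_z` of the framework. -/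
def levelField (m : MeasurableSpace Ω) (filt : ℝ → MeasurableSpace E) (D : Scheme Ω E) :
    ℕ → ℝ → MeasurableSpace Ω
  | 0 => fun z => systemField filt (D.labels 0) (D.X 0) z
  | q + 1 => fun z => stoppedField m (levelField m filt D q) (D.level q) ⊔ D.parentField q ⊔
      systemField filt (D.labels (q + 1)) (D.X (q + 1)) z

/-- The σ-field `F^(q)`, that is `F^(q)_z` stopped at the level `Z^(q)`. -/
def field (m : MeasurableSpace Ω) (filt : ℝ → MeasurableSpace E) (D : Scheme Ω E) (q : ℕ) :
    MeasurableSpace Ω :=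
  stoppedField m (D.levelField m filt q) (D.level q)

/-- The weighted empirical average of `φ` over the replicas at iteration `q`. -/
def estimate (D : Scheme Ω E) (φ : E → ℝ) (q : ℕ) (ω : Ω) : ℝ :=
  ∑ n ∈ D.labels q ω, D.weight q n ω * φ (D.X q n ω)

/-- The number of iterations, `⊤` if the algorithm never stops. -/
def iterations (D : Scheme Ω E) (ω : Ω) : ℕ∞ :=
  ⨅ (q : ℕ) (_ : ¬ D.run q ω), (q : ℕ∞)

/-- The estimator given by the algorithm when it stops. -/
def finalEstimate (D : Scheme Ω E) (φ : E → ℝ) (ω : Ω) : ℝ :=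
  D.estimate φ (D.iterations ω).toNat ω

end Scheme

/-- The scheme `D` is a run, started with `N` replicas, of an algorithm of the GAMS framework.
The filtration `H` records all the random variables that have been drawn before the
splitting step of each iteration. After the algorithm has stopped everything stays frozen. -/
structure IsGAMS {Ω E : Type*} [mΩ : MeasurableSpace Ω] [MeasurableSpace E] (μ : Measure Ω)
    (H : Filtration ℕ mΩ) (π : Measure E) (filt : ℝ → MeasurableSpace E)
    (R : ℝ → E → Measure E) (N : ℕ) (D : Scheme Ω E) : Prop where
  -- everything known at iteration `q` belongs to the history
  labels_adapted : ∀ q, @Measurable Ω (Finset ℕ) (H q) ⊤ (D.labels q)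
  X_adapted : ∀ q n, Measurable[H q] (D.X q n)
  weight_adapted : ∀ q n, Measurable[H q] (D.weight q n)
  level_adapted : ∀ q, Measurable[H q] (D.level q)
  branch_adapted : ∀ q n, Measurable[H (q + 1)] (D.branch q n)
  par_adapted : ∀ q n, Measurable[H (q + 1)] (D.par q n)
  -- initialization
  pos : 0 < N
  labels_zero : ∀ ω, D.labels 0 ω = Finset.Icc 1 N
  law_zero : ∀ n ∈ Finset.Icc 1 N, μ.map (D.X 0 n) = π
  indep_zero : iIndepFun (fun (n : Finset.Icc 1 N) => D.X 0 n) μ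
  weight_zero : ∀ ω, ∀ n ∈ Finset.Icc 1 N, D.weight 0 n ω = 1 / N
  -- stopping criterion
  run_measurable : ∀ q, MeasurableSet[D.field mΩ filt q] {ω | D.run q ω}
  halted : ∀ q ω, ¬ D.run q ω → ¬ D.run (q + 1) ω ∧ D.level (q + 1) ω = D.level q ω ∧
    ∀ n ∈ D.labels q ω, D.branch q n ω = 1
  -- splitting step: drawn conditionally on `F^(q)`, independently of the rest of the past
  parent_sampled : ∀ (q : ℕ) (a : ℕ → ℕ),
    μ⟦{ω | ∀ n, D.parentMap q n ω = a n} | H q⟧ =ᵐ[μ]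
      μ⟦{ω | ∀ n, D.parentMap q n ω = a n} | D.field mΩ filt q⟧
  branch_pos : ∀ q n, ∀ᵐ ω ∂μ, n ∈ D.labels q ω →
    0 < (μ[fun ω' => (D.branch q n ω' : ℝ) | D.field mΩ filt q]) ω
  labels_succ : ∀ q ω,
    D.labels (q + 1) ω = (D.labels q ω \ D.killed q ω) ∪ D.newLabels q ω
  par_mem : ∀ q ω, ∀ n ∈ D.newLabels q ω, D.par q n ω ∈ D.labels q ω \ D.killed q ω
  card_children : ∀ q ω, ∀ n ∈ D.labels q ω \ D.killed q ω,
    ((D.newLabels q ω).filter fun n' => D.par q n' ω = n).card + 1 = D.branch q n ω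
  weight_succ : ∀ q, ∀ᵐ ω ∂μ, ∀ n ∈ D.labels (q + 1) ω,
    D.weight (q + 1) n ω = D.weight q (D.parentMap q n ω) ω /
      (μ[fun ω' => (D.branch q (D.parentMap q n ω) ω' : ℝ) | D.field mΩ filt q]) ω
  -- resampling step: the new replicas are drawn independently, from their parents
  keep : ∀ q ω, ∀ n ∈ D.labels q ω \ D.killed q ω, D.X (q + 1) n ω = D.X q n ω
  resampled : ∀ (q : ℕ) (s : ℕ → Set E), (∀ n, MeasurableSet (s n)) →
    μ⟦{ω | ∀ n ∈ D.newLabels q ω, D.X (q + 1) n ω ∈ s n} | H q ⊔ D.parentField q⟧ =ᵐ[μ]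
      fun ω => ∏ n ∈ D.newLabels q ω,
        (extKernel π R (D.level q ω) (D.X q (D.par q n ω) ω)).real (s n)
  -- level computation step
  level_le : ∀ q, ∀ᵐ ω ∂μ, D.level q ω ≤ D.level (q + 1) ω
  level_stopping : ∀ q, IsStoppingLevel (D.levelField mΩ filt q) (D.level q)

end GAMS

namespace AMS

/-- The process `Y` on `(Ω, μ)` is a Markov chain with transition kernel `P` started at `x₀`. -/
structure IsMarkovChain {S Ω : Type*} [mS : MeasurableSpace S] [MeasurableSpace Ω]
    (P : Kernel S S) (x₀ : S) (μ : Measure Ω) (Y : ℕ → Ω → S) : Prop where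
  measurable : ∀ t, Measurable (Y t)
  start : ∀ᵐ ω ∂μ, Y 0 ω = x₀
  transition : ∀ (t : ℕ) (s : Set S), MeasurableSet s →
    μ⟦Y (t + 1) ⁻¹' s | ⨆ r ∈ Set.Iic t, MeasurableSpace.comap (Y r) mS⟧ =ᵐ[μ]
      fun ω => (P (Y t ω)).real s

section Paths

variable {S : Type*}

/-- First entrance time of a path in `A`. -/
def hit (A : Set S) (x : ℕ → S) : ℕ∞ := ⨅ (t : ℕ) (_ : x t ∈ A), (t : ℕ∞)

/-- The path `x` stopped at time `τ`. -/
def stopAt (τ : ℕ∞) (x : ℕ → S) : ℕ → S := fun t => x (min (t : ℕ∞) τ).toNat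

/-- The path `x` stopped when it enters `A`. -/
def stopIn (A : Set S) (x : ℕ → S) : ℕ → S := stopAt (hit A x) x

/-- Maximum level of a path stopped when it enters `A`. -/
def maxLevel (A : Set S) (ξ : S → ℝ) (x : ℕ → S) : EReal := ⨆ t : ℕ, (ξ (stopIn A x t) : EReal)

/-- First time, not after the entrance in `A`, at which the level is strictly above `z`. -/
def levelTime (A : Set S) (ξ : S → ℝ) (z : ℝ) (x : ℕ → S) : ℕ∞ :=
  ⨅ (t : ℕ) (_ : (t : ℕ∞) ≤ hit A x ∧ z < ξ (x t)), (t : ℕ∞)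

variable [MeasurableSpace S]

/-- The transition kernel `P`, as a kernel from histories up to time `t`. -/
def historyKernel (P : Kernel S S) (t : ℕ) : Kernel ((i : Finset.Iic t) → S) S :=
  P.comap (fun h => h ⟨t, Finset.mem_Iic.2 le_rfl⟩) (measurable_pi_apply _)

instance (P : Kernel S S) [IsMarkovKernel P] (t : ℕ) : IsMarkovKernel (historyKernel P t) := by
  unfold historyKernel; infer_instance

/-- The resampling law from level `z`: the path `x` is kept up to its entrance time `T` above
level `z`, is then continued with the transition kernel `P`, and is stopped when it
enters `A`. Here `Kernel.traj _ T` is the law of the whole trajectory given its values up to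
time `T`. -/
def resample (P : Kernel S S) [IsMarkovKernel P] (A : Set S) (ξ : S → ℝ) (z : ℝ)
    (x : ℕ → S) : Measure (ℕ → S) :=
  if levelTime A ξ z x = ⊤ then Measure.dirac (stopIn A x)
  else (Kernel.traj (historyKernel P) (levelTime A ξ z x).toNat (fun i => x i)).map (stopIn A)

/-- The level filtration: the σ-field generated by the path stopped at its entrance time
above level `z`. -/
def levelFilt (A : Set S) (ξ : S → ℝ) (z : ℝ) : MeasurableSpace (ℕ → S) :=
  MeasurableSpace.comap (fun x => stopAt (levelTime A ξ z x) x) MeasurableSpace.pi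

end Paths

/-- The `k`-th smallest value, with multiplicity, of `f` on `s`. -/
def orderStat (k : ℕ) (s : Finset ℕ) (f : ℕ → EReal) : EReal :=
  ((s.val.map f).sort (· ≤ ·)).getD (k - 1) ⊤

/-- The parameters of the algorithm: the stopping set `A`, the reaction coordinate `ξ`, the
maximal level, the number of replicas and the minimal number of replicas resampled at
each iteration. -/
structure Params (S : Type*) where
  A : Set S
  ξ : S → ℝ
  zmax : ℝ
  nrep : ℕ
  k : ℕ

/-- Labels of the working and of the retired replicas, and weights. -/
structure State where
  on : Finset ℕ
  off : Finset ℕ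
  weight : ℕ → ℝ

namespace Params

variable {S : Type*} (p : Params S)

/-- The level computed from the working replicas `x n`, `n ∈ on`: the `k`-th order statistic of
the maximum levels, or `+∞` if no maximum level is strictly larger. -/
def level (on : Finset ℕ) (x : ℕ → ℕ → S) : EReal :=
  let L := orderStat p.k on (fun n => maxLevel p.A p.ξ (x n))
  if (on.filter fun n => maxLevel p.A p.ξ (x n) ≤ L).card = p.nrep then ⊤ else L

/-- Working replicas with maximum level at most the current level. -/
def onLe (s : State) (x : ℕ → ℕ → S) : Finset ℕ :=
  s.on.filter fun n => maxLevel p.A p.ξ (x n) ≤ p.level s.on x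

/-- Working replicas with maximum level strictly above the current level. -/
def onGt (s : State) (x : ℕ → ℕ → S) : Finset ℕ :=
  s.on.filter fun n => p.level s.on x < maxLevel p.A p.ξ (x n)

/-- Labels of the replicas created in the current iteration: as many as there are replicas to
retire; none if the algorithm has stopped. -/
def newLabels (s : State) (x : ℕ → ℕ → S) : Finset ℕ :=
  if (p.zmax : EReal) < p.level s.on x then ∅
  else Finset.Icc ((s.on ∪ s.off).card + 1) ((s.on ∪ s.off).card + (p.onLe s x).card)

/-- Update of the labels and weights in one iteration, given the replicas `x` and the parents
`par n` of the new labels `n`. Nothing changes once the level has exceeded `zmax`. -/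
def step (s : State) (x : ℕ → ℕ → S) (par : ℕ → ℕ) : State :=
  if (p.zmax : EReal) < p.level s.on x then s
  else
    let c : ℝ := ((p.nrep : ℝ) - (p.onLe s x).card) / p.nrep
    { on := p.onGt s x ∪ p.newLabels s x
      off := s.off ∪ p.onLe s x
      weight := fun n =>
        if n ∈ p.onGt s x then c * s.weight n
        else if n ∈ p.newLabels s x then c * s.weight (par n)
        else s.weight n }

/-- Labels and weights at iteration `q`; `x r` are the replicas at iteration `r`, and `par r` are
the parents drawn in iteration `r`. -/
def state (x : ℕ → ℕ → ℕ → S) (par : ℕ → ℕ → ℕ) : ℕ → State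
  | 0 => { on := Finset.Icc 1 p.nrep, off := ∅, weight := fun _ => 1 / p.nrep }
  | q + 1 => p.step (state x par q) (x q) (par q)

end Params

section Run

variable {S Ω : Type*} (p : Params S) (X : ℕ → ℕ → Ω → ℕ → S) (par : ℕ → ℕ → Ω → ℕ)

/-- Random state of the algorithm at iteration `q`; `X q n` is the replica with label `n` at
iteration `q`, and `par q n` is the parent of the new label `n` drawn in iteration `q`. -/
def stateAt (q : ℕ) (ω : Ω) : State :=
  p.state (fun r n => X r n ω) (fun r n => par r n ω) q

/-- The level `Z^(q)`. -/
def levelAt (q : ℕ) (ω : Ω) : EReal :=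
  p.level (stateAt p X par q ω).on (fun n => X q n ω)

/-- Labels of the replicas from which the parents are drawn in iteration `q`. -/
def onGtAt (q : ℕ) (ω : Ω) : Finset ℕ :=
  p.onGt (stateAt p X par q ω) (fun n => X q n ω)

/-- Labels of the replicas created in iteration `q`. -/
def newAt (q : ℕ) (ω : Ω) : Finset ℕ :=
  p.newLabels (stateAt p X par q ω) (fun n => X q n ω)

/-- The AMS algorithm as a splitting scheme. The branching number of a label is one plus its
number of children. -/
def toScheme : GAMS.Scheme Ω (ℕ → S) where
  labels q ω := (stateAt p X par q ω).on ∪ (stateAt p X par q ω).off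
  X := X
  weight q n ω := (stateAt p X par q ω).weight n
  level := levelAt p X par
  run q ω := levelAt p X par q ω ≤ (p.zmax : EReal)
  branch q n ω := 1 + ((newAt p X par q ω).filter fun n' => par q n' ω = n).card
  par := par

/-- The estimator of the probability of entering `B` before `A`, computed from the replicas which
are still working when the algorithm stops. -/
def pHat (B : Set S) (ω : Ω) : ℝ :=
  let Q := ((toScheme p X par).iterations ω).toNat
  ∑ n ∈ (stateAt p X par Q ω).on,
    (stateAt p X par Q ω).weight n *
      Set.indicator {x : ℕ → S | hit B x < hit p.A x} (fun _ => 1) (X Q n ω)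

/-- The random variables `X q n` and `par q n` on `(Ω, μ)` are those of a run of the AMS algorithm
with parameters `p`, for initial replicas of law `π` and the transition kernel `P`. The filtration
`H` records all the random variables that have been drawn before the splitting step of each
iteration. Only the values `X q n` for labels `n` present at iteration `q`, and `par q n` for
labels `n` created in iteration `q`, matter. -/
structure IsAMS [mΩ : MeasurableSpace Ω] [MeasurableSpace S] (P : Kernel S S) [IsMarkovKernel P]
    (π : Measure (ℕ → S)) (μ : Measure Ω) (H : Filtration ℕ mΩ) : Prop where
  X_adapted : ∀ q n, Measurable[H q] (X q n)
  par_adapted : ∀ q n, Measurable[H (q + 1)] (par q n)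
  -- the initial replicas are i.i.d. of law `π`
  law_zero : ∀ n ∈ Finset.Icc 1 p.nrep, μ.map (X 0 n) = π
  indep_zero : iIndepFun (fun (n : Finset.Icc 1 p.nrep) => X 0 n) μ
  -- given the past, the parents are independent and uniform on the replicas above the level
  par_mem : ∀ q ω, ∀ n ∈ newAt p X par q ω, par q n ω ∈ onGtAt p X par q ω
  par_law : ∀ (q : ℕ) (a : ℕ → ℕ),
    μ⟦{ω | ∀ n ∈ newAt p X par q ω, par q n ω = a n} | H q⟧ =ᵐ[μ]
      fun ω => ∏ n ∈ newAt p X par q ω,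
        if a n ∈ onGtAt p X par q ω then ((onGtAt p X par q ω).card : ℝ)⁻¹ else 0
  -- the replicas already present are not resampled
  keep : ∀ q ω, ∀ n ∈ (stateAt p X par q ω).on ∪ (stateAt p X par q ω).off,
    X (q + 1) n ω = X q n ω
  -- given the past and the parents, the new replicas are independent, resampled from their
  -- parents at the current level (a real number as long as the algorithm runs)
  new_law : ∀ (q : ℕ) (s : ℕ → Set (ℕ → S)), (∀ n, MeasurableSet (s n)) →
    μ⟦{ω | ∀ n ∈ newAt p X par q ω, X (q + 1) n ω ∈ s n} |
        H q ⊔ ⨆ n, MeasurableSpace.comap (par q n) ⊤⟧ =ᵐ[μ]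
      fun ω => ∏ n ∈ newAt p X par q ω,
        (resample P p.A p.ξ (levelAt p X par q ω).toReal (X q (par q n ω) ω)).real (s n)

end Run

end AMS

end

set_option linter.unusedSectionVars false

noncomputable section

namespace AMS

/-! ### Paths, entrance times and level times -/

section FirstTime

variable {q : ℕ → Prop}

/-! Consistency of the resampling laws is a strong Markov property. The entrance time `levelTime`
above `z` is decided by the path up to that time, `resample` at `z` redraws the path after it, and
it comes no later than the entrance time above any `z' ≥ z`. Hence a path redrawn from `z` may be
redrawn again from `z'` without changing its law, even jointly with a quantity in `levelFilt` at
`z'` (`lintegral_resample_mul`). Strict inequality in the entrance time gives right-continuity in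
`z`, and it places the event that the maximum level exceeds `z` in `levelFilt` at `z`.

For unbiasedness, let `N` be the number of working replicas, `K` the number retired in an iteration
and `w` the common weight of the working replicas. Each of the `N - K` survivors gives up the weight
`(K/N) w`, and `K` new replicas of weight `(1 - K/N) w` appear. Given the past, the law of a new
replica is the average of the resampling laws from the survivors, so the expected gain is `(K/N) w`
times the sum over the survivors `j` of the mean of `φ` under resampling from `X_j`
(`lintegral_sum_new`). The iteration preserves the expectation provided that, after integration,
this mean can be replaced by `φ (X_j)`.

This is not obvious, since the level depends on all the replicas. It follows from an invariance of
Gibbs type (`gibbsOn_above`): redrawing one survivor from the current level, the other replicas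
being fixed, does not change the joint law of the working configuration. The invariance is proved by
induction on the iteration. Initially it is the independence of the replicas. It passes from the
previous level to the current one (`GibbsOn.current`) by the Markov property, because the level and
the set of survivors do not change when a survivor is modified after its entrance above the level
(`level_update`, `Stable`). It passes to the next iteration because the law of the new replicas
reads a survivor only up to that entrance time (`gibbsOn_succ_parents`), and because resampling
twice from one level amounts to resampling once (`gibbsOn_succ_new`).

After stopping everything is frozen, and the estimates of a bounded function are bounded since the
weights are nonnegative with sum one. Dominated convergence then transfers the identity from fixed
iterations to the final one. Retired replicas stay at or below `zmax`, so they never reach `B`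
before `A`, and the sum over the working replicas alone is unbiased for the probability.

For the framework, the levels are stopping levels by a countable union over rational thresholds
(`level_le_iff`). The stopped σ-field contains every event on the part where the level is infinite,
so it is not contained in the history; only the traces on the part where the level is finite are
compared, and no label is created on the complement. The conditional law of the parents is an
explicit function of label sets that are measurable for both σ-fields. The mean branching number of
a survivor is `1 + K/(N - K) = N/(N - K)`, the inverse of the factor applied to the weights. -/

lemma firstTime_le_iff {n : ℕ} : (⨅ (t : ℕ) (_ : q t), (t : ℕ∞)) ≤ n ↔ ∃ t ≤ n, q t := by
  constructor
  · intro h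
    by_contra! hc
    have h1 : ((n + 1 : ℕ) : ℕ∞) ≤ ⨅ (t : ℕ) (_ : q t), (t : ℕ∞) := by
      refine le_iInf₂ fun t ht => ?_
      rw [Nat.cast_le]
      by_contra hlt
      exact hc t (by omega) ht
    have h2 := h1.trans h
    rw [Nat.cast_le] at h2
    omega
  · rintro ⟨t, ht, hq⟩
    exact (iInf₂_le t hq).trans (by exact_mod_cast ht)

lemma coe_le_firstTime_iff {n : ℕ} :
    (n : ℕ∞) ≤ (⨅ (t : ℕ) (_ : q t), (t : ℕ∞)) ↔ ∀ t < n, ¬ q t := by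
  rw [le_iInf₂_iff]
  constructor
  · intro h t ht hq
    have := h t hq
    rw [Nat.cast_le] at this
    omega
  · intro h t hq
    rw [Nat.cast_le]
    by_contra hlt
    exact h t (by omega) hq

lemma firstTime_eq_top_iff : (⨅ (t : ℕ) (_ : q t), (t : ℕ∞)) = ⊤ ↔ ∀ t, ¬ q t := by
  simp [iInf_eq_top]

lemma firstTime_eq_coe_iff {n : ℕ} :
    (⨅ (t : ℕ) (_ : q t), (t : ℕ∞)) = n ↔ q n ∧ ∀ t < n, ¬ q t := by
  rw [le_antisymm_iff, firstTime_le_iff, coe_le_firstTime_iff]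
  constructor
  · rintro ⟨⟨t, ht, hq⟩, h⟩
    rcases ht.lt_or_eq with h1 | rfl
    · exact absurd hq (h t h1)
    · exact ⟨hq, h⟩
  · rintro ⟨hq, h⟩
    exact ⟨⟨n, le_rfl, hq⟩, h⟩

end FirstTime

/-! ### Paths that agree up to a time, stopped paths, levels -/

section Deterministic

variable {S : Type*} {A : Set S} {ξ : S → ℝ} {z z' : ℝ} {x y : ℕ → S} {n t : ℕ}

/-- The paths `x` and `y` coincide up to time `n`. -/
def AgreeUpTo (n : ℕ) (x y : ℕ → S) : Prop := ∀ t ≤ n, x t = y t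

lemma AgreeUpTo.symm (h : AgreeUpTo n x y) : AgreeUpTo n y x := fun t ht => (h t ht).symm

lemma AgreeUpTo.trans {w : ℕ → S} (h : AgreeUpTo n x y) (h' : AgreeUpTo n y w) :
    AgreeUpTo n x w := fun t ht => (h t ht).trans (h' t ht)

lemma AgreeUpTo.le_hit (h : AgreeUpTo n x y) (hx : (n : ℕ∞) ≤ hit A x) :
    (n : ℕ∞) ≤ hit A y := by
  unfold hit at *
  rw [coe_le_firstTime_iff] at *
  intro t ht hy
  exact hx t ht (by rwa [h t ht.le])

/-- For `t < n` the constraint `t ≤ hit A x` follows from `n ≤ hit A x` and can be dropped. -/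
lemma levelTime_eq_coe_iff : levelTime A ξ z x = n ↔
    ((n : ℕ∞) ≤ hit A x ∧ z < ξ (x n)) ∧ ∀ t < n, ¬ z < ξ (x t) := by
  unfold levelTime
  rw [firstTime_eq_coe_iff]
  refine and_congr_right fun h => forall₂_congr fun t ht => ?_
  have : (t : ℕ∞) ≤ hit A x := le_trans (by exact_mod_cast ht.le) h.1
  simp [this]

lemma le_hit_of_levelTime_eq (h : levelTime A ξ z x = n) : (n : ℕ∞) ≤ hit A x :=
  (levelTime_eq_coe_iff.1 h).1.1

/-- The stopping time property in pathwise form: whether the level time equals `n` is read from the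
path up to time `n`. -/
lemma AgreeUpTo.levelTime_eq (h : AgreeUpTo n x y) (hx : levelTime A ξ z x = n) :
    levelTime A ξ z y = n := by
  rw [levelTime_eq_coe_iff] at *
  refine ⟨⟨h.le_hit hx.1.1, ?_⟩, fun t ht => ?_⟩
  · rw [← h n le_rfl]; exact hx.1.2
  · rw [← h t ht.le]; exact hx.2 t ht

lemma levelTime_eq_top_iff :
    levelTime A ξ z x = ⊤ ↔ ∀ t : ℕ, (t : ℕ∞) ≤ hit A x → ξ (x t) ≤ z := by
  unfold levelTime
  rw [firstTime_eq_top_iff]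
  simp

lemma levelTime_mono (hz : z ≤ z') : levelTime A ξ z x ≤ levelTime A ξ z' x := by
  unfold levelTime
  exact le_iInf₂ fun t ht => iInf₂_le t ⟨ht.1, hz.trans_lt ht.2⟩

lemma exists_nat_of_ne_top {a : ℕ∞} (h : a ≠ ⊤) : ∃ n : ℕ, a = n :=
  ⟨a.toNat, (ENat.natCast_toNat h).symm⟩

lemma stopAt_of_le {τ : ℕ∞} (h : (t : ℕ∞) ≤ τ) : stopAt τ x t = x t := by
  simp [stopAt, min_eq_left h]

lemma stopAt_coe_of_ge (h : n ≤ t) : stopAt (n : ℕ∞) x t = x n := by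
  have : ((n : ℕ∞)) ≤ t := by exact_mod_cast h
  simp [stopAt, min_eq_right this]

@[simp] lemma stopAt_top : stopAt ⊤ x = x := by
  ext t; exact stopAt_of_le le_top

lemma agreeUpTo_stopAt {τ : ℕ∞} (h : (n : ℕ∞) ≤ τ) : AgreeUpTo n x (stopAt τ x) :=
  fun _ ht => (stopAt_of_le (le_trans (by exact_mod_cast ht) h)).symm

lemma stopAt_coe_congr (h : AgreeUpTo n x y) : stopAt (n : ℕ∞) x = stopAt (n : ℕ∞) y := by
  ext t
  rcases le_total t n with ht | ht
  · rw [stopAt_of_le (by exact_mod_cast ht), stopAt_of_le (by exact_mod_cast ht), h t ht]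
  · rw [stopAt_coe_of_ge ht, stopAt_coe_of_ge ht, h n le_rfl]

lemma stopIn_of_le_hit (h : (t : ℕ∞) ≤ hit A x) : stopIn A x t = x t := stopAt_of_le h

lemma agreeUpTo_stopIn (h : (n : ℕ∞) ≤ hit A x) : AgreeUpTo n x (stopIn A x) :=
  agreeUpTo_stopAt h

@[simp] lemma stopIn_zero : stopIn A x 0 = x 0 := stopIn_of_le_hit zero_le

lemma hit_stopIn : hit A (stopIn A x) = hit A x := by
  by_cases htop : hit A x = ⊤
  · rw [stopIn, htop, stopAt_top, htop]
  obtain ⟨n, hn⟩ := exists_nat_of_ne_top htop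
  have hag : AgreeUpTo n x (stopIn A x) := agreeUpTo_stopIn hn.ge
  rw [hn]
  unfold hit at *
  rw [firstTime_eq_coe_iff] at *
  refine ⟨by rw [← hag n le_rfl]; exact hn.1, fun t ht => ?_⟩
  rw [← hag t ht.le]; exact hn.2 t ht

lemma stopIn_stopIn : stopIn A (stopIn A x) = stopIn A x := by
  ext t
  by_cases h : (t : ℕ∞) ≤ hit A x
  · rw [stopIn_of_le_hit (by rwa [hit_stopIn])]
  · push Not at h
    obtain ⟨n, hn⟩ := exists_nat_of_ne_top (ne_top_of_lt h)
    have hnt : n ≤ t := by rw [hn] at h; exact_mod_cast h.le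
    have h1 : ∀ w : ℕ → S, hit A w = n → stopIn A w t = w n := fun w hw => by
      rw [stopIn, hw, stopAt_coe_of_ge hnt]
    rw [h1 _ (by rw [hit_stopIn, hn]), h1 _ hn, stopIn_of_le_hit hn.ge]

/-- The level time looks only at times up to the entrance in `A`, where stopping has not yet acted.
-/
lemma levelTime_stopIn : levelTime A ξ z (stopIn A x) = levelTime A ξ z x := by
  unfold levelTime
  rw [hit_stopIn]
  congr 1; ext t
  refine iInf_congr_Prop ?_ fun _ => rfl
  refine ⟨fun h => ⟨h.1, ?_⟩, fun h => ⟨h.1, ?_⟩⟩ <;>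
    first
      | (rw [stopIn_of_le_hit h.1] at h; exact h.2)
      | (rw [stopIn_of_le_hit h.1]; exact h.2)

lemma lt_maxLevel_iff {a : EReal} :
    a < maxLevel A ξ x ↔ ∃ t : ℕ, (t : ℕ∞) ≤ hit A x ∧ a < (ξ (x t) : EReal) := by
  unfold maxLevel
  rw [lt_iSup_iff]
  constructor
  · rintro ⟨t, ht⟩
    by_cases h : (t : ℕ∞) ≤ hit A x
    · exact ⟨t, h, by rwa [stopIn_of_le_hit h] at ht⟩
    · push Not at h
      obtain ⟨n, hn⟩ := exists_nat_of_ne_top (ne_top_of_lt h)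
      have hnt : n ≤ t := by rw [hn] at h; exact_mod_cast h.le
      refine ⟨n, hn.ge, ?_⟩
      rwa [stopIn, hn, stopAt_coe_of_ge hnt] at ht
  · rintro ⟨t, h, ht⟩
    exact ⟨t, by rwa [stopIn_of_le_hit h]⟩

/-- A supremum is strictly above `z` exactly when one of its terms is. This links the selection of
replicas to the finiteness of the time from which they are resampled. -/
lemma lt_maxLevel_iff_levelTime_ne_top :
    (z : EReal) < maxLevel A ξ x ↔ levelTime A ξ z x ≠ ⊤ := by
  rw [lt_maxLevel_iff, Ne, levelTime_eq_top_iff]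
  push Not
  simp only [EReal.coe_lt_coe_iff]

lemma bot_lt_maxLevel : ⊥ < maxLevel A ξ x :=
  lt_maxLevel_iff.2 ⟨0, zero_le, EReal.bot_lt_coe _⟩

/-- Stopping at the later level time leaves enough of the path to read the earlier one; this is what
makes `levelFilt` a filtration. -/
lemma levelTime_stopAt_levelTime (hz : z ≤ z') :
    levelTime A ξ z (stopAt (levelTime A ξ z' x) x) = levelTime A ξ z x := by
  by_cases htop : levelTime A ξ z' x = ⊤
  · rw [htop, stopAt_top]
  obtain ⟨n, hn⟩ := exists_nat_of_ne_top htop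
  obtain ⟨m, hm⟩ := exists_nat_of_ne_top
    (ne_top_of_le_ne_top htop (levelTime_mono (A := A) (ξ := ξ) (x := x) hz))
  have hmn : m ≤ n := by
    have := levelTime_mono (A := A) (ξ := ξ) (x := x) hz
    rw [hn, hm] at this; exact_mod_cast this
  rw [hm, hn]
  exact (agreeUpTo_stopAt (by exact_mod_cast hmn)).levelTime_eq hm

lemma stopAt_levelTime_stopAt_levelTime (hz : z ≤ z') :
    stopAt (levelTime A ξ z (stopAt (levelTime A ξ z' x) x)) (stopAt (levelTime A ξ z' x) x) =
      stopAt (levelTime A ξ z x) x := by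
  rw [levelTime_stopAt_levelTime hz]
  by_cases htop : levelTime A ξ z' x = ⊤
  · rw [htop, stopAt_top]
  have hle := levelTime_mono (A := A) (ξ := ξ) (x := x) hz
  obtain ⟨m, hm⟩ := exists_nat_of_ne_top (ne_top_of_le_ne_top htop hle)
  rw [hm] at hle ⊢
  exact (stopAt_coe_congr (agreeUpTo_stopAt hle)).symm

end Deterministic

/-! ### Measurability of entrance times and the level filtration -/

section Measurability

variable {S : Type*} [MeasurableSpace S] {A : Set S} {ξ : S → ℝ}

lemma measurableSet_le_hit (hA : MeasurableSet A) (n : ℕ) :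
    MeasurableSet {x : ℕ → S | (n : ℕ∞) ≤ hit A x} := by
  simp only [hit, coe_le_firstTime_iff, Set.ofPred_forall]
  exact .iInter fun t => .iInter fun _ => ((measurable_pi_apply t) hA).compl

lemma measurable_hit (hA : MeasurableSet A) : Measurable (hit A : (ℕ → S) → ℕ∞) := by
  have h : ∀ n : ℕ, MeasurableSet {x : ℕ → S | hit A x = n} := by
    intro n
    simp only [hit, firstTime_eq_coe_iff, Set.ofPred_and, Set.ofPred_forall]
    exact ((measurable_pi_apply n) hA).inter
      (.iInter fun t => .iInter fun _ => ((measurable_pi_apply t) hA).compl)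
  refine measurable_to_countable' fun a => ?_
  induction a with
  | top =>
    have : hit A ⁻¹' {(⊤ : ℕ∞)} = ⋂ n : ℕ, {x : ℕ → S | hit A x = n}ᶜ := by
      ext x
      simp only [Set.mem_preimage, Set.mem_singleton_iff, Set.mem_iInter, Set.mem_compl_iff,
        Set.mem_ofPred_eq]
      exact ⟨fun h n => by simp [h], fun h => by
        by_contra hne
        obtain ⟨n, hn⟩ := exists_nat_of_ne_top hne
        exact h n hn⟩
    rw [this]
    exact .iInter fun n => (h n).compl
  | coe n => exact h n

lemma measurable_stopAt {τ : (ℕ → S) → ℕ∞} (hτ : Measurable τ) :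
    Measurable fun x : ℕ → S => stopAt (τ x) x := by
  refine measurable_pi_lambda _ fun t => ?_
  have h : Measurable fun p : ℕ × (ℕ → S) => p.2 p.1 :=
    measurable_from_prod_countable_right fun n => measurable_pi_apply n
  have h2 : Measurable fun x : ℕ → S => (min (t : ℕ∞) (τ x)).toNat :=
    (measurable_from_top (f := fun a : ℕ∞ => (min (t : ℕ∞) a).toNat)).comp hτ
  exact h.comp (h2.prodMk measurable_id)

lemma measurable_stopIn (hA : MeasurableSet A) : Measurable (stopIn A : (ℕ → S) → ℕ → S) :=
  measurable_stopAt (measurable_hit hA)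

/-- Joint measurability in the level and the path is needed because replicas are resampled from a
random level. -/
lemma measurable_levelTime_prod (hA : MeasurableSet A) (hξ : Measurable ξ) :
    Measurable fun p : ℝ × (ℕ → S) => levelTime A ξ p.1 p.2 := by
  have hlt : ∀ t : ℕ, MeasurableSet {p : ℝ × (ℕ → S) | p.1 < ξ (p.2 t)} := fun t =>
    measurableSet_lt measurable_fst (hξ.comp ((measurable_pi_apply t).comp measurable_snd))
  have h : ∀ n : ℕ, MeasurableSet {p : ℝ × (ℕ → S) | levelTime A ξ p.1 p.2 = n} := by
    intro n
    simp only [levelTime_eq_coe_iff, Set.ofPred_and, Set.ofPred_forall]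
    exact ((measurable_snd (measurableSet_le_hit hA n)).inter (hlt n)).inter
      (.iInter fun t => .iInter fun _ => (hlt t).compl)
  refine measurable_to_countable' fun a => ?_
  induction a with
  | top =>
    have : (fun p : ℝ × (ℕ → S) => levelTime A ξ p.1 p.2) ⁻¹' {(⊤ : ℕ∞)} =
        ⋂ n : ℕ, {p : ℝ × (ℕ → S) | levelTime A ξ p.1 p.2 = n}ᶜ := by
      ext x
      simp only [Set.mem_preimage, Set.mem_singleton_iff, Set.mem_iInter, Set.mem_compl_iff,
        Set.mem_ofPred_eq]
      exact ⟨fun h n => by simp [h], fun h => by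
        by_contra hne
        obtain ⟨n, hn⟩ := exists_nat_of_ne_top hne
        exact h n hn⟩
    rw [this]
    exact .iInter fun n => (h n).compl
  | coe n => exact h n

lemma measurable_levelTime (hA : MeasurableSet A) (hξ : Measurable ξ) (z : ℝ) :
    Measurable (levelTime A ξ z : (ℕ → S) → ℕ∞) := by
  have h1 := measurable_levelTime_prod hA hξ
  generalize levelTime A ξ = f at h1 ⊢
  exact h1.comp measurable_prodMk_left

lemma measurable_maxLevel (hA : MeasurableSet A) (hξ : Measurable ξ) :
    Measurable (maxLevel A ξ : (ℕ → S) → EReal) :=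
  .iSup fun t => measurable_coe_real_ereal.comp
    (hξ.comp ((measurable_pi_apply t).comp (measurable_stopIn hA)))

lemma levelFilt_le (hA : MeasurableSet A) (hξ : Measurable ξ) (z : ℝ) :
    levelFilt A ξ z ≤ (MeasurableSpace.pi : MeasurableSpace (ℕ → S)) :=
  (measurable_stopAt (measurable_levelTime hA hξ z)).comap_le

lemma measurable_stopAt_levelTime (z : ℝ) :
    Measurable[levelFilt A ξ z] fun x : ℕ → S => stopAt (levelTime A ξ z x) x :=
  comap_measurable _

/-- The path stopped above `z` is the image, under the same stopping map, of the path stopped above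
`z'`. -/
lemma levelFilt_mono (hA : MeasurableSet A) (hξ : Measurable ξ) :
    Monotone (levelFilt A ξ : ℝ → MeasurableSpace (ℕ → S)) := by
  intro z z' hz
  rw [levelFilt, ← measurable_iff_comap_le]
  have h1 : Measurable[levelFilt A ξ z'] fun x : ℕ → S => stopAt (levelTime A ξ z' x) x :=
    comap_measurable _
  have h2 := (measurable_stopAt (measurable_levelTime hA hξ z)).comp h1
  convert h2 using 1
  ext1 x
  exact (stopAt_levelTime_stopAt_levelTime hz).symm

lemma measurable_levelTime_levelFilt (hA : MeasurableSet A) (hξ : Measurable ξ) {z z' : ℝ}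
    (hz : z ≤ z') : Measurable[levelFilt A ξ z'] (levelTime A ξ z : (ℕ → S) → ℕ∞) := by
  have h := (measurable_levelTime hA hξ z).comp
    (measurable_stopAt_levelTime (A := A) (ξ := ξ) z')
  convert h using 1
  ext1 x
  exact (levelTime_stopAt_levelTime hz).symm

end Measurability

end AMS

namespace AMS

/-! ### Integrals over countable partitions -/

/-- Allows an identity of integrals to be checked on each value of a discrete variable: below, a
level time or a pair of label sets. -/
lemma lintegral_eq_of_fibers {α β : Type*} [MeasurableSpace α] [MeasurableSpace β] [Countable β]
    [MeasurableSingletonClass β] {m : Measure α} {V : α → β} (hV : Measurable V)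
    {F G : α → ℝ≥0∞}
    (h : ∀ v, ∫⁻ a in V ⁻¹' {v}, F a ∂m = ∫⁻ a in V ⁻¹' {v}, G a ∂m) :
    ∫⁻ a, F a ∂m = ∫⁻ a, G a ∂m := by
  have hU : (⋃ v, V ⁻¹' {v}) = Set.univ := by ext; simp
  have hd : Pairwise (Function.onFun Disjoint fun v => V ⁻¹' {v}) := fun v w hvw => by
    refine Disjoint.preimage _ ?_
    simpa using hvw
  have hm : ∀ v, MeasurableSet (V ⁻¹' {v}) := fun v => hV (measurableSet_singleton v)
  rw [← setLIntegral_univ, ← setLIntegral_univ (f := G), ← hU, lintegral_iUnion hm hd,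
    lintegral_iUnion hm hd]
  exact tsum_congr h

/-! ### Continuing a path with the chain -/

section Kernels

variable {S : Type*} [MeasurableSpace S] (P : Kernel S S) [IsMarkovKernel P] {A : Set S}
  {ξ : S → ℝ}

lemma measurable_prefix (t : ℕ) :
    Measurable fun (x : ℕ → S) (i : Finset.Iic t) => x i :=
  measurable_pi_lambda _ fun _ => measurable_pi_apply _

/-- The law of the path which is kept up to time `t` and continued with `P`. -/
def extend (t : ℕ) : Kernel (ℕ → S) (ℕ → S) :=
  (Kernel.traj (historyKernel P) t).comap (fun x i => x i) (measurable_prefix t)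

instance (t : ℕ) : IsMarkovKernel (extend P t) := by unfold extend; infer_instance

lemma extend_apply (t : ℕ) (x : ℕ → S) :
    extend P t x = Kernel.traj (historyKernel P) t (fun i => x i) := rfl

lemma extend_congr {t : ℕ} {x y : ℕ → S} (h : AgreeUpTo t x y) : extend P t x = extend P t y := by
  rw [extend_apply, extend_apply]
  congr 1
  ext i
  exact h i (Finset.mem_Iic.1 i.2)

lemma measurableSet_agreeUpTo [MeasurableSingletonClass S] (t : ℕ) (x : ℕ → S) :
    MeasurableSet {y | AgreeUpTo t x y} := by
  simp only [AgreeUpTo, Set.ofPred_forall]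
  refine .iInter fun s => .iInter fun _ => ?_
  have : {y : ℕ → S | x s = y s} = (fun y => y s) ⁻¹' {x s} := by ext y; simp [eq_comm]
  rw [this]
  exact measurable_pi_apply s (measurableSet_singleton _)

/-- The trajectory law is unchanged when the prefix of the sample is overwritten by that of `x`. -/
lemma ae_agreeUpTo_extend [MeasurableSingletonClass S] (t : ℕ) (x : ℕ → S) :
    ∀ᵐ y ∂extend P t x, AgreeUpTo t x y := by
  rw [extend_apply, ← Kernel.traj_map_updateFinset]
  rw [ae_map_iff (by fun_prop) (measurableSet_agreeUpTo t x)]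
  refine ae_of_all _ fun y s hs => ?_
  simp [Function.updateFinset, hs]

/-- Tower property of trajectories: drawing the path and then drawing its future after `t` again
gives the same law. -/
lemma lintegral_extend_extend {s t : ℕ} (hst : s ≤ t) (x : ℕ → S) {F : (ℕ → S) → ℝ≥0∞}
    (hF : Measurable F) :
    ∫⁻ y, ∫⁻ w, F w ∂extend P t y ∂extend P s x = ∫⁻ y, F y ∂extend P s x := by
  conv_rhs => rw [extend_apply, ← Kernel.traj_comp_partialTraj hst,
    ← Kernel.traj_map_frestrictLe, Kernel.lintegral_comp _ _ _ hF,
    Kernel.lintegral_map _ (by fun_prop) _ (by fun_prop)]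
  rfl

/-- The law of the path which is kept up to time `t`, continued with `P` and
stopped in `A`. -/
def cont (A : Set S) (t : ℕ) : Kernel (ℕ → S) (ℕ → S) := (extend P t).map (stopIn A)

lemma isMarkovKernel_cont (hA : MeasurableSet A) (t : ℕ) : IsMarkovKernel (cont P A t) :=
  Kernel.IsMarkovKernel.map _ (measurable_stopIn hA)

lemma cont_apply (hA : MeasurableSet A) (t : ℕ) (x : ℕ → S) :
    cont P A t x = (extend P t x).map (stopIn A) := Kernel.map_apply _ (measurable_stopIn hA) _

lemma lintegral_cont (hA : MeasurableSet A) (t : ℕ) (x : ℕ → S) {F : (ℕ → S) → ℝ≥0∞}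
    (hF : Measurable F) :
    ∫⁻ y, F y ∂cont P A t x = ∫⁻ y, F (stopIn A y) ∂extend P t x := by
  rw [cont_apply P hA, lintegral_map hF (measurable_stopIn hA)]

lemma cont_congr (hA : MeasurableSet A) {t : ℕ} {x y : ℕ → S} (h : AgreeUpTo t x y) :
    cont P A t x = cont P A t y := by
  rw [cont_apply P hA, cont_apply P hA, extend_congr P h]

/-- The condition `t ≤ hit A x` is needed: otherwise stopping in `A` would alter the prefix that has
to be kept. -/
lemma ae_agreeUpTo_cont [MeasurableSingletonClass S] (hA : MeasurableSet A) {t : ℕ} {x : ℕ → S}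
    (h : (t : ℕ∞) ≤ hit A x) : ∀ᵐ y ∂cont P A t x, AgreeUpTo t x y := by
  rw [cont_apply P hA, ae_map_iff (measurable_stopIn hA).aemeasurable
    (measurableSet_agreeUpTo t x)]
  filter_upwards [ae_agreeUpTo_extend P t x] with y hy
  exact hy.trans (agreeUpTo_stopIn (hy.le_hit h))

lemma measurableSet_start [MeasurableSingletonClass S] (a : S) :
    MeasurableSet {y : ℕ → S | y 0 = a} :=
  (measurableSet_singleton a).preimage (measurable_pi_apply 0)

lemma ae_start_cont [MeasurableSingletonClass S] (hA : MeasurableSet A) (t : ℕ) (x : ℕ → S) :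
    ∀ᵐ y ∂cont P A t x, y 0 = x 0 := by
  rw [cont_apply P hA, ae_map_iff (measurable_stopIn hA).aemeasurable
    (measurableSet_start (x 0))]
  filter_upwards [ae_agreeUpTo_extend P t x] with y hy
  rw [stopIn_zero, hy 0 zero_le]

/-- The Markov property at time `t` for the continued and stopped path. -/
lemma lintegral_cont_mul [MeasurableSingletonClass S] (hA : MeasurableSet A) {s t : ℕ}
    (hst : s ≤ t) (x : ℕ → S) {h F : (ℕ → S) → ℝ≥0∞} (hh : Measurable h) (hF : Measurable F)
    (hdep : ∀ y y', AgreeUpTo t y y' → h y = h y') (hhit : ∀ y, h y ≠ 0 → (t : ℕ∞) ≤ hit A y) :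
    ∫⁻ y, h y * F y ∂cont P A s x =
      ∫⁻ y, h y * ∫⁻ w, F w ∂cont P A t y ∂cont P A s x := by
  have hm := measurable_stopIn (S := S) hA
  have := isMarkovKernel_cont P hA t
  have hK : Measurable fun y => ∫⁻ w, F w ∂cont P A t y := hF.lintegral_kernel
  -- Where `h` does not vanish, `A` is not entered before `t`, so stopping in `A` leaves the values
  -- up to `t` unchanged.
  have hagree : ∀ y, h (stopIn A y) ≠ 0 → AgreeUpTo t y (stopIn A y) := fun y hy =>
    agreeUpTo_stopIn (by rw [← hit_stopIn]; exact hhit _ hy)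
  have hdep' : ∀ y y', AgreeUpTo t y y' → h (stopIn A y') ≠ 0 →
      h (stopIn A y) = h (stopIn A y') := by
    intro y y' hyy' h0
    have h1 := hagree _ h0
    have h2 : (t : ℕ∞) ≤ hit A y := hyy'.symm.le_hit (by rw [← hit_stopIn]; exact hhit _ h0)
    exact hdep _ _ ((agreeUpTo_stopIn h2).symm.trans (hyy'.trans h1))
  -- The factor composed with stopping still depends only on the path up to `t`, so it comes out of
  -- the integral over the future.
  have hdep2 : ∀ y y', AgreeUpTo t y y' → h (stopIn A y) = h (stopIn A y') := by
    intro y y' hyy'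
    by_cases h0 : h (stopIn A y') = 0
    · by_cases h1 : h (stopIn A y) = 0
      · rw [h0, h1]
      · exact (hdep' _ _ hyy'.symm h1).symm
    · exact hdep' _ _ hyy' h0
  have hhF : Measurable fun y => h y * F y := hh.mul hF
  have hhK : Measurable fun y => h y * ∫⁻ w, F w ∂cont P A t y := hh.mul hK
  -- Pass to trajectories that are not stopped; on the left, draw the future after `t` again.
  rw [lintegral_cont P hA s x hhF, lintegral_cont P hA s x hhK,
    ← lintegral_extend_extend P hst x (F := fun y => h (stopIn A y) * F (stopIn A y))
      (hhF.comp hm)]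
  refine lintegral_congr fun y => ?_
  have h1 : ∫⁻ w, h (stopIn A w) * F (stopIn A w) ∂extend P t y =
      ∫⁻ w, h (stopIn A y) * F (stopIn A w) ∂extend P t y := by
    refine lintegral_congr_ae ?_
    filter_upwards [ae_agreeUpTo_extend P t y] with w hw
    rw [hdep2 y w hw]
  rw [h1, lintegral_const_mul (f := fun w => F (stopIn A w)) _ (hF.comp hm)]
  by_cases h0 : h (stopIn A y) = 0
  · simp [h0]
  · rw [← lintegral_cont P hA t y hF, cont_congr P hA (hagree y h0)]

/-! ### The resampling kernel -/

lemma resample_of_eq_top {z : ℝ} {x : ℕ → S} (h : levelTime A ξ z x = ⊤) :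
    resample P A ξ z x = Measure.dirac (stopIn A x) := if_pos h

lemma resample_of_eq_coe (hA : MeasurableSet A) {z : ℝ} {x : ℕ → S} {n : ℕ}
    (h : levelTime A ξ z x = n) : resample P A ξ z x = cont P A n x := by
  rw [resample, if_neg (by rw [h]; exact ENat.natCast_ne_top n), h, cont_apply P hA]
  rfl

lemma isProbabilityMeasure_resample (hA : MeasurableSet A) (z : ℝ) (x : ℕ → S) :
    IsProbabilityMeasure (resample P A ξ z x) := by
  by_cases h : levelTime A ξ z x = ⊤
  · rw [resample_of_eq_top P h]; infer_instance
  · obtain ⟨n, hn⟩ := exists_nat_of_ne_top h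
    rw [resample_of_eq_coe P hA hn]
    have := isMarkovKernel_cont P hA n
    infer_instance

lemma measurable_resample (hA : MeasurableSet A) (hξ : Measurable ξ) :
    Measurable fun p : ℝ × (ℕ → S) => resample P A ξ p.1 p.2 := by
  have hT := measurable_levelTime_prod hA hξ
  have hset : MeasurableSet {p : ℝ × (ℕ → S) | levelTime A ξ p.1 p.2 = ⊤} :=
    hT (measurableSet_singleton ⊤)
  have h1 : ∀ p : ℝ × (ℕ → S), resample P A ξ p.1 p.2 =
      if levelTime A ξ p.1 p.2 = ⊤ then Measure.dirac (stopIn A p.2)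
      else cont P A (levelTime A ξ p.1 p.2).toNat p.2 := by
    intro p
    split_ifs with h
    · exact resample_of_eq_top P h
    · exact resample_of_eq_coe P hA (ENat.natCast_toNat h).symm
  simp_rw [h1]
  refine Measurable.ite hset ?_ ?_
  · exact Measure.measurable_dirac.comp ((measurable_stopIn hA).comp measurable_snd)
  · have h2 : Measurable fun p : ℕ × (ℕ → S) => cont P A p.1 p.2 :=
      measurable_from_prod_countable_right fun n => (cont P A n).measurable
    have h3 : Measurable fun p : ℝ × (ℕ → S) => (levelTime A ξ p.1 p.2).toNat :=
      (measurable_from_top (f := ENat.toNat)).comp hT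
    exact Measurable.comp (g := fun p : ℕ × (ℕ → S) => cont P A p.1 p.2)
      (f := fun p : ℝ × (ℕ → S) => ((levelTime A ξ p.1 p.2).toNat, p.2)) h2
      (h3.prodMk measurable_snd)

/-- The resampling laws as a kernel. -/
def resampleKernel (hA : MeasurableSet A) (hξ : Measurable ξ) :
    Kernel (ℝ × (ℕ → S)) (ℕ → S) where
  toFun p := resample P A ξ p.1 p.2
  measurable' := measurable_resample P hA hξ

instance (hA : MeasurableSet A) (hξ : Measurable ξ) :
    IsMarkovKernel (resampleKernel P hA hξ) :=
  ⟨fun p => isProbabilityMeasure_resample P hA p.1 p.2⟩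

/-- Resampling reads the path only up to its entrance time above the level. -/
lemma resample_congr (hA : MeasurableSet A) {z : ℝ} {x y : ℕ → S} {n : ℕ}
    (hx : levelTime A ξ z x = n) (h : AgreeUpTo n x y) :
    resample P A ξ z x = resample P A ξ z y := by
  rw [resample_of_eq_coe P hA hx, resample_of_eq_coe P hA (h.levelTime_eq hx), cont_congr P hA h]

lemma ae_agreeUpTo_resample [MeasurableSingletonClass S] (hA : MeasurableSet A) {z : ℝ}
    {x : ℕ → S} {n : ℕ} (hx : levelTime A ξ z x = n) :
    ∀ᵐ y ∂resample P A ξ z x, AgreeUpTo n x y := by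
  rw [resample_of_eq_coe P hA hx]
  exact ae_agreeUpTo_cont P hA (le_hit_of_levelTime_eq hx)

lemma ae_start_resample [MeasurableSingletonClass S] (hA : MeasurableSet A) (z : ℝ)
    (x : ℕ → S) : ∀ᵐ y ∂resample P A ξ z x, y 0 = x 0 := by
  by_cases h : levelTime A ξ z x = ⊤
  · rw [resample_of_eq_top P h]
    rw [ae_dirac_iff (measurableSet_start (x 0))]
    exact stopIn_zero
  · obtain ⟨n, hn⟩ := exists_nat_of_ne_top h
    rw [resample_of_eq_coe P hA hn]
    exact ae_start_cont P hA n x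

lemma resample_stopAt_levelTime (hA : MeasurableSet A) (z : ℝ) (x : ℕ → S) :
    resample P A ξ z (stopAt (levelTime A ξ z x) x) = resample P A ξ z x := by
  by_cases h : levelTime A ξ z x = ⊤
  · rw [h, stopAt_top]
  · obtain ⟨n, hn⟩ := exists_nat_of_ne_top h
    rw [hn]
    exact (resample_congr P hA hn (agreeUpTo_stopAt le_rfl)).symm

/-- The resampling law is a function of the path stopped at its level time, and that stopped path
generates `levelFilt`. -/
lemma measurable_resample_levelFilt (hA : MeasurableSet A) (hξ : Measurable ξ) (z : ℝ) :
    Measurable[levelFilt A ξ z] (resample P A ξ z) := by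
  have h1 := measurable_resample P hA hξ
  have h2 : Measurable (resample P A ξ z) := by
    generalize resample P A ξ = f at h1 ⊢
    exact h1.comp measurable_prodMk_left
  have h3 := h2.comp (measurable_stopAt_levelTime (A := A) (ξ := ξ) z)
  convert h3 using 1
  ext1 x
  exact (resample_stopAt_levelTime P hA z x).symm

/-- By the Doob–Dynkin factorization, `h` is a function of the stopped path. -/
lemma eq_of_levelFilt_measurable {h : (ℕ → S) → ℝ≥0∞} {z : ℝ} {n : ℕ} {x y : ℕ → S}
    (hh : Measurable[levelFilt A ξ z] h) (hx : levelTime A ξ z x = n) (hxy : AgreeUpTo n x y) :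
    h x = h y := by
  obtain ⟨g, -, rfl⟩ := Measurable.exists_eq_measurable_comp hh
  simp only [Function.comp]
  rw [hx, hxy.levelTime_eq hx, stopAt_coe_congr hxy]

/-- Consistency of the resampling kernels. -/
lemma lintegral_resample_mul [MeasurableSingletonClass S] (hA : MeasurableSet A)
    (hξ : Measurable ξ) {z z' : ℝ} (hz : z ≤ z') (x : ℕ → S) {h F : (ℕ → S) → ℝ≥0∞}
    (hh : Measurable[levelFilt A ξ z'] h) (hF : Measurable F) :
    ∫⁻ y, h y * F y ∂resample P A ξ z x =
      ∫⁻ y, h y * ∫⁻ w, F w ∂resample P A ξ z' y ∂resample P A ξ z x := by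
  have hh' : Measurable h := hh.mono (levelFilt_le hA hξ z') le_rfl
  have hR : Measurable (resample P A ξ z') :=
    (measurable_resample_levelFilt P hA hξ z').mono (levelFilt_le hA hξ z') le_rfl
  have hRF : Measurable fun y => ∫⁻ w, F w ∂resample P A ξ z' y :=
    (Measure.measurable_lintegral hF).comp hR
  -- If `x` never exceeds `z`, it never exceeds `z'`, and both resampling laws are Dirac masses at
  -- the stopped path.
  by_cases htop : levelTime A ξ z x = ⊤
  · have hhF : Measurable fun y => h y * F y := hh'.mul hF
    have hhR : Measurable fun y => h y * ∫⁻ w, F w ∂resample P A ξ z' y := hh'.mul hRF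
    rw [resample_of_eq_top P htop, lintegral_dirac' _ hhF, lintegral_dirac' _ hhR]
    have h1 : levelTime A ξ z' (stopIn A x) = ⊤ := by
      rw [levelTime_stopIn]
      exact top_le_iff.1 (htop ▸ levelTime_mono hz)
    rw [resample_of_eq_top P h1, lintegral_dirac' _ hF, stopIn_stopIn]
  obtain ⟨s, hs⟩ := exists_nat_of_ne_top htop
  rw [resample_of_eq_coe P hA hs]
  have hT := measurable_levelTime hA hξ z'
  -- The strong Markov property at the entrance time above `z'` reduces to the Markov property at
  -- each fixed value of this time.
  refine lintegral_eq_of_fibers hT fun v => ?_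
  have hTv : MeasurableSet ((levelTime A ξ z' : (ℕ → S) → ℕ∞) ⁻¹' {v}) :=
    hT (measurableSet_singleton v)
  induction v with
  | top =>
    refine setLIntegral_congr_fun_ae hTv ?_
    have hset : MeasurableSet {y : ℕ → S | F (stopIn A y) = F y} :=
      measurableSet_eq_fun (hF.comp (measurable_stopIn hA)) hF
    -- When `z'` is never exceeded, resampling from `z'` only stops the path in `A`, and samples of
    -- `cont` are already stopped.
    have h1 : ∀ᵐ y ∂cont P A s x, F (stopIn A y) = F y := by
      rw [cont_apply P hA, ae_map_iff (measurable_stopIn hA).aemeasurable hset]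
      exact ae_of_all _ fun y => by rw [stopIn_stopIn]
    filter_upwards [h1] with y hy hyT
    rw [resample_of_eq_top P hyT, lintegral_dirac' _ hF, hy]
  | coe t =>
    by_cases hst : s ≤ t
    -- Cut off to the paths entering above `z'` at time `t`, the factor `h` is read from the path up
    -- to `t` and vanishes unless `t ≤ hit A`.
    · set g : (ℕ → S) → ℝ≥0∞ := (levelTime A ξ z' ⁻¹' {(t : ℕ∞)}).indicator h with hg
      have key := lintegral_cont_mul P hA hst x (h := g) (F := F)
        (hh'.indicator hTv) hF ?_ ?_
      · have e1 : ∀ y, g y * F y =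
            (levelTime A ξ z' ⁻¹' {(t : ℕ∞)}).indicator (fun y => h y * F y) y := fun y => by
          by_cases hy : y ∈ levelTime A ξ z' ⁻¹' {(t : ℕ∞)} <;> simp [hg, hy]
        have e2 : ∀ y, g y * ∫⁻ w, F w ∂cont P A t y =
            (levelTime A ξ z' ⁻¹' {(t : ℕ∞)}).indicator
              (fun y => h y * ∫⁻ w, F w ∂resample P A ξ z' y) y := fun y => by
          by_cases hy : y ∈ levelTime A ξ z' ⁻¹' {(t : ℕ∞)}
          · simp only [hg, hy, Set.indicator_of_mem]
            rw [resample_of_eq_coe P hA hy]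
          · simp [hg, hy]
        simp_rw [e1, e2] at key
        rwa [lintegral_indicator hTv, lintegral_indicator hTv] at key
      · intro y y' hyy'
        by_cases hy : levelTime A ξ z' y = t
        · have hy' := hyy'.levelTime_eq hy
          simp only [hg, Set.indicator, Set.mem_preimage, Set.mem_singleton_iff, hy, hy', if_true]
          exact eq_of_levelFilt_measurable hh hy hyy'
        · have hy' : levelTime A ξ z' y' ≠ t := fun h' => hy (hyy'.symm.levelTime_eq h')
          simp [hg, hy, hy']
      · intro y hy
        rw [hg] at hy
        have hy' : y ∈ levelTime A ξ z' ⁻¹' {(t : ℕ∞)} := Set.mem_of_indicator_ne_zero hy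
        exact le_hit_of_levelTime_eq hy'
    -- The prefix up to `s` is kept, so the entrance above `z` still occurs at `s`; an entrance
    -- above `z'` at `t < s` is impossible.
    · have h0 : ∀ᵐ y ∂cont P A s x, y ∉ levelTime A ξ z' ⁻¹' {(t : ℕ∞)} := by
        filter_upwards [ae_agreeUpTo_cont P hA (le_hit_of_levelTime_eq hs)] with y hy hyT
        have h1 := levelTime_mono (A := A) (ξ := ξ) (x := y) hz
        rw [hy.levelTime_eq hs, hyT] at h1
        exact hst (by exact_mod_cast h1)
      have h2 : (cont P A s x) (levelTime A ξ z' ⁻¹' {(t : ℕ∞)}) = 0 :=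
        measure_eq_zero_iff_ae_notMem.2 h0
      rw [Measure.restrict_eq_zero.2 h2, lintegral_zero_measure, lintegral_zero_measure]

end Kernels

end AMS

namespace AMS

/-! ### Conditional expectations and integrals of nonnegative functions -/

section CondExp

variable {Ω : Type*} {m : MeasurableSpace Ω} [mΩ : MeasurableSpace Ω] {μ : Measure Ω}
  [IsProbabilityMeasure μ]

/-- The restriction of `μ` to `E` and the measure of density `g` coincide on `m`, hence integrate
the functions measurable for `m` alike. -/
lemma lintegral_mul_of_measure_inter_eq (hm : m ≤ mΩ) {E : Set Ω}
    {g : Ω → ℝ≥0∞} (hg : Measurable[m] g)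
    (h : ∀ B, MeasurableSet[m] B → μ (B ∩ E) = ∫⁻ ω in B, g ω ∂μ)
    {U : Ω → ℝ≥0∞} (hU : Measurable[m] U) :
    ∫⁻ ω in E, U ω ∂μ = ∫⁻ ω, U ω * g ω ∂μ := by
  have hg' : Measurable g := hg.mono hm le_rfl
  have h1 : (μ.restrict E).trim hm = (μ.withDensity g).trim hm := by
    refine @Measure.ext _ m _ _ fun B hB => ?_
    rw [trim_measurableSet_eq hm hB, trim_measurableSet_eq hm hB,
      Measure.restrict_apply (hm _ hB), withDensity_apply _ (hm _ hB), h B hB]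
  rw [← lintegral_trim hm hU, h1, lintegral_trim hm hU,
    lintegral_withDensity_eq_lintegral_mul _ hg' (hU.mono hm le_rfl)]
  exact lintegral_congr fun ω => mul_comm _ _

lemma measure_inter_of_condExp (hm : m ≤ mΩ) {E : Set Ω} (hE : MeasurableSet E)
    {g : Ω → ℝ} (hg0 : ∀ ω, 0 ≤ g ω) (h : μ⟦E | m⟧ =ᵐ[μ] g) {B : Set Ω}
    (hB : MeasurableSet[m] B) :
    μ (B ∩ E) = ∫⁻ ω in B, ENNReal.ofReal (g ω) ∂μ := by
  have hint : Integrable (E.indicator fun _ => (1 : ℝ)) μ :=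
    (integrable_const 1).indicator hE
  have hgi : Integrable g μ := (integrable_congr h).1 integrable_condExp
  rw [← ofReal_integral_eq_lintegral_ofReal hgi.integrableOn (ae_of_all _ hg0),
    ← setIntegral_congr_ae (hm _ hB) (h.mono fun ω hω _ => hω), setIntegral_condExp hm hint hB,
    integral_indicator hE, Measure.restrict_restrict hE]
  simp [Set.inter_comm]

/-- The form in which the sampling rules of `IsAMS`, stated with real conditional probabilities,
enter integrals of nonnegative functions. -/
lemma lintegral_mul_of_condExp (hm : m ≤ mΩ) {E : Set Ω} (hE : MeasurableSet E)
    {g : Ω → ℝ≥0∞} (hg : Measurable[m] g) (hgt : ∀ ω, g ω ≠ ∞)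
    (h : μ⟦E | m⟧ =ᵐ[μ] fun ω => (g ω).toReal)
    {U : Ω → ℝ≥0∞} (hU : Measurable[m] U) :
    ∫⁻ ω in E, U ω ∂μ = ∫⁻ ω, U ω * g ω ∂μ := by
  refine lintegral_mul_of_measure_inter_eq hm hg (fun B hB => ?_) hU
  rw [measure_inter_of_condExp hm hE (fun ω => ENNReal.toReal_nonneg) h hB]
  exact lintegral_congr fun ω => ENNReal.ofReal_toReal (hgt ω)

end CondExp

/-! ### The law of the chain -/

section Chain

variable {S : Type*} [MeasurableSpace S]

/-- Every finite set of times lies in an initial segment, so these marginals determine all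
finite-dimensional ones. -/
lemma Measure.ext_of_frestrictLe {ρ ν : Measure (ℕ → S)} [IsFiniteMeasure ρ] [IsFiniteMeasure ν]
    (h : ∀ n, ρ.map (Preorder.frestrictLe (π := fun _ : ℕ => S) n) =
      ν.map (Preorder.frestrictLe (π := fun _ : ℕ => S) n)) : ρ = ν := by
  have hproj : ∀ {κ : Measure (ℕ → S)} (I : Finset ℕ),
      κ.map (I.restrict (π := fun _ : ℕ => S)) =
        (κ.map (Preorder.frestrictLe (π := fun _ : ℕ => S) (I.sup id))).map
          (Finset.restrict₂ (π := fun _ : ℕ => S) I.subset_Iic_sup_id) := by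
    intro κ I
    exact (Measure.map_map (Finset.measurable_restrict₂ (X := fun _ : ℕ => S)
      I.subset_Iic_sup_id) (Preorder.measurable_frestrictLe (X := fun _ : ℕ => S) _)).symm
  refine IsProjectiveLimit.unique (P := fun I => ν.map I.restrict) (fun I => ?_) fun I => rfl
  rw [hproj, h, ← hproj]

lemma measurable_frestrictLe_of_forall {Ω : Type*} {m : MeasurableSpace Ω} {Y : ℕ → Ω → S}
    {n : ℕ} (hY : ∀ r ≤ n, Measurable (Y r)) :
    Measurable fun ω => Preorder.frestrictLe (π := fun _ : ℕ => S) n fun t => Y t ω :=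
  measurable_pi_lambda _ fun i => hY i (Finset.mem_Iic.1 i.2)

/-- Induction on `n`: the marginal up to `n + 1` is obtained from the one up to `n` and the
transition `κ n`. -/
lemma Measure.eq_of_step (κ : (n : ℕ) → Kernel ((i : Finset.Iic n) → S) S)
    [∀ n, IsMarkovKernel (κ n)] {x₀ : S} {ρ ν : Measure (ℕ → S)} [IsProbabilityMeasure ρ]
    [IsProbabilityMeasure ν] (hρ : ∀ᵐ y ∂ρ, y 0 = x₀) (hν : ∀ᵐ y ∂ν, y 0 = x₀)
    (hρs : ∀ n, ρ.map (fun x => (Preorder.frestrictLe (π := fun _ : ℕ => S) n x, x (n + 1))) =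
      (ρ.map (Preorder.frestrictLe (π := fun _ : ℕ => S) n)) ⊗ₘ κ n)
    (hνs : ∀ n, ν.map (fun x => (Preorder.frestrictLe (π := fun _ : ℕ => S) n x, x (n + 1))) =
      (ν.map (Preorder.frestrictLe (π := fun _ : ℕ => S) n)) ⊗ₘ κ n) : ρ = ν := by
  refine Measure.ext_of_frestrictLe fun n => ?_
  induction n with
  | zero =>
    have h0 : ∀ {η : Measure (ℕ → S)} [IsProbabilityMeasure η], (∀ᵐ y ∂η, y 0 = x₀) →
        η.map (Preorder.frestrictLe (π := fun _ : ℕ => S) 0) = Measure.dirac fun _ => x₀ := by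
      intro η _ hη
      have : Preorder.frestrictLe (π := fun _ : ℕ => S) 0 =ᵐ[η] fun _ _ => x₀ := by
        filter_upwards [hη] with y hy
        ext i
        have : (i : ℕ) = 0 := by simpa using Finset.mem_Iic.1 i.2
        simp [Preorder.frestrictLe, this, hy]
      rw [Measure.map_congr this, Measure.map_const]
      simp
    rw [h0 hρ, h0 hν]
  | succ n ih =>
    -- Glues a history up to time `n` and the next value into a history up to time `n + 1`.
    set g : ((i : Finset.Iic n) → S) × S → ((i : Finset.Iic (n + 1)) → S) :=
      fun p i => if h : (i : ℕ) ≤ n then p.1 ⟨i, Finset.mem_Iic.2 h⟩ else p.2 with hg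
    have hgm : Measurable g := by
      refine measurable_pi_lambda _ fun i => ?_
      by_cases h : (i : ℕ) ≤ n
      · simp only [hg, h, dite_true]
        exact (measurable_pi_apply _).comp measurable_fst
      · simp only [hg, h, dite_false]
        exact measurable_snd
    have hfac : ∀ {η : Measure (ℕ → S)},
        η.map (Preorder.frestrictLe (π := fun _ : ℕ => S) (n + 1)) =
        (η.map (fun x => (Preorder.frestrictLe (π := fun _ : ℕ => S) n x, x (n + 1)))).map g := by
      intro η
      rw [Measure.map_map hgm (by fun_prop)]
      congr 1
      ext x i
      by_cases h : (i : ℕ) ≤ n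
      · simp [hg, h]
      · have : (i : ℕ) = n + 1 := by
          have := Finset.mem_Iic.1 i.2
          omega
        simp [hg, this]
    rw [hfac, hfac, hρs, hνs, ih]

variable {P : Kernel S S} [IsMarkovKernel P] {x₀ : S} {Ω' : Type*} [MeasurableSpace Ω']
  {μ' : Measure Ω'} [IsProbabilityMeasure μ'] {Y : ℕ → Ω' → S}

lemma IsMarkovChain.measurable_path (hY : IsMarkovChain P x₀ μ' Y) :
    Measurable fun ω t => Y t ω := measurable_pi_lambda _ hY.measurable

lemma IsMarkovChain.step (hY : IsMarkovChain P x₀ μ' Y) (n : ℕ) :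
    (μ'.map fun ω t => Y t ω).map
        (fun x => (Preorder.frestrictLe (π := fun _ : ℕ => S) n x, x (n + 1))) =
      ((μ'.map fun ω t => Y t ω).map (Preorder.frestrictLe (π := fun _ : ℕ => S) n)) ⊗ₘ
        historyKernel P n := by
  have hYm := hY.measurable_path
  have hp : IsProbabilityMeasure (μ'.map fun ω t => Y t ω) :=
    Measure.isProbabilityMeasure_map hYm.aemeasurable
  refine Measure.ext_prod fun {s t} hs ht => ?_
  have hm : (⨆ r ∈ Set.Iic n, MeasurableSpace.comap (Y r) ‹MeasurableSpace S›) ≤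
      ‹MeasurableSpace Ω'› := iSup₂_le fun r _ => (hY.measurable r).comap_le
  have hfr : Measurable[⨆ r ∈ Set.Iic n, MeasurableSpace.comap (Y r) ‹MeasurableSpace S›]
      fun ω => Preorder.frestrictLe (π := fun _ : ℕ => S) n fun t => Y t ω := by
    refine measurable_frestrictLe_of_forall fun r hr => ?_
    exact (comap_measurable (Y r)).mono (le_iSup₂_of_le r hr le_rfl) le_rfl
  have hB := hfr hs
  rw [Measure.map_map (by fun_prop) hYm, Measure.map_map (by fun_prop) hYm,
    Measure.compProd_apply_prod hs ht, setLIntegral_map hs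
    ((historyKernel P n).measurable_coe ht) ((Preorder.measurable_frestrictLe n).comp hYm),
    Measure.map_apply (Measurable.comp (by fun_prop) hYm) (hs.prod ht)]
  have hE : MeasurableSet (Y (n + 1) ⁻¹' t) := hY.measurable _ ht
  have key := measure_inter_of_condExp hm hE
    (fun ω => measureReal_nonneg) (hY.transition n t ht) hB
  exact key.trans (lintegral_congr fun ω => ofReal_measureReal)

/-- Both laws start at `x₀` and have the same one-step transitions. -/
lemma IsMarkovChain.law [MeasurableSingletonClass S] (hY : IsMarkovChain P x₀ μ' Y) :
    μ'.map (fun ω t => Y t ω) = extend P 0 fun _ => x₀ := by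
  have hYm := hY.measurable_path
  have hp : IsProbabilityMeasure (μ'.map fun ω t => Y t ω) :=
    Measure.isProbabilityMeasure_map hYm.aemeasurable
  refine Measure.eq_of_step (historyKernel P) (x₀ := x₀) ?_ ?_ hY.step fun n => ?_
  · rw [ae_map_iff hYm.aemeasurable (measurableSet_start x₀)]
    exact hY.start
  · filter_upwards [ae_agreeUpTo_extend P 0 fun _ => x₀] with y hy
    exact (hy 0 le_rfl).symm
  · rw [extend_apply, ← Kernel.partialTraj_compProd_eq_map_traj zero_le,
      Kernel.traj_map_frestrictLe_apply]

/-- Presents the law of the initial replicas as a continuation from time `0`, hence as a resampling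
law from any level below `ξ x₀`. -/
lemma IsMarkovChain.law_stopped [MeasurableSingletonClass S] {A : Set S} (hA : MeasurableSet A)
    (hY : IsMarkovChain P x₀ μ' Y) :
    μ'.map (fun ω => stopIn A fun t => Y t ω) = cont P A 0 fun _ => x₀ := by
  rw [cont_apply P hA, ← hY.law, Measure.map_map (measurable_stopIn hA) hY.measurable_path]
  rfl

end Chain

/-! ### The setting -/

section Setting

variable {S : Type*} [MeasurableSpace S] [MeasurableSingletonClass S]
  (P : Kernel S S) [IsMarkovKernel P] {A : Set S} {ξ : S → ℝ}

lemma cont_zero (hA : MeasurableSet A) {x₀ : S} {x : ℕ → S} (hx : x 0 = x₀) :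
    cont P A 0 x = cont P A 0 fun _ => x₀ :=
  cont_congr P hA fun t ht => by rw [Nat.le_zero.1 ht, hx]

lemma levelTime_eq_zero {z : ℝ} {x : ℕ → S} (h : z < ξ (x 0)) : levelTime A ξ z x = (0 : ℕ) :=
  levelTime_eq_coe_iff.2 ⟨⟨by simp, h⟩, fun t ht => absurd ht (Nat.not_lt_zero t)⟩

/-- If `z` is first exceeded at time `n`, the earlier values are at most `z`, hence at most any `z'
≥ z`, while the value at `n` still exceeds `z'` for `z'` close to `z`. So the entrance time is
constant to the right of `z`. -/
lemma eventually_resample_eq (hA : MeasurableSet A) (z : ℝ) (x : ℕ → S) :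
    ∀ᶠ z' in 𝓝[Set.Ici z] z, resample P A ξ z' x = resample P A ξ z x := by
  by_cases htop : levelTime A ξ z x = ⊤
  · filter_upwards [self_mem_nhdsWithin] with z' hz'
    have h' : levelTime A ξ z' x = ⊤ := top_le_iff.1 (htop ▸ levelTime_mono hz')
    rw [resample_of_eq_top P htop, resample_of_eq_top P h']
  · obtain ⟨n, hn⟩ := exists_nat_of_ne_top htop
    have h1 := levelTime_eq_coe_iff.1 hn
    have h2 : Set.Iio (ξ (x n)) ∈ 𝓝[Set.Ici z] z :=
      mem_nhdsWithin_of_mem_nhds (Iio_mem_nhds h1.1.2)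
    filter_upwards [self_mem_nhdsWithin, h2] with z' hz' hz2
    have hz'' : z ≤ z' := hz'
    have h' : levelTime A ξ z' x = n := levelTime_eq_coe_iff.2
      ⟨⟨h1.1.1, hz2⟩, fun t ht h3 => h1.2 t ht (hz''.trans_lt h3)⟩
    rw [resample_of_eq_coe P hA hn, resample_of_eq_coe P hA h']

lemma stronglyMeasurable_integral_resample (hA : MeasurableSet A) (hξ : Measurable ξ) (z : ℝ)
    {φ : (ℕ → S) → ℝ} (hφ : Measurable φ) :
    StronglyMeasurable[levelFilt A ξ z] fun y => ∫ y', φ y' ∂resample P A ξ z y := by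
  have hR := (measurable_resample_levelFilt P (A := A) (ξ := ξ) hA hξ z).mono
    (levelFilt_le hA hξ z) le_rfl
  let κ : Kernel (ℕ → S) (ℕ → S) := ⟨resample P A ξ z, hR⟩
  have hκ : IsMarkovKernel κ := ⟨isProbabilityMeasure_resample P hA z⟩
  have h1 : StronglyMeasurable fun y => ∫ y', φ y' ∂κ y :=
    hφ.stronglyMeasurable.integral_kernel
  have h2 : Measurable[levelFilt A ξ z] fun y => ∫ y', φ y' ∂resample P A ξ z y := by
    have h3 := h1.measurable.comp (measurable_stopAt_levelTime (A := A) (ξ := ξ) z)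
    have h4 : (fun y => ∫ y', φ y' ∂resample P A ξ z y) =
        (fun y => ∫ y', φ y' ∂κ y) ∘ fun y => stopAt (levelTime A ξ z y) y := by
      ext1 y
      exact congrArg (fun ν => ∫ y', φ y' ∂ν) (resample_stopAt_levelTime P hA z y).symm
    rw [h4]
    exact h3
  exact Measurable.stronglyMeasurable h2

lemma measurable_indicator_one {α : Type*} {m : MeasurableSpace α} {s : Set α}
    (hs : MeasurableSet s) : Measurable (s.indicator (1 : α → ℝ≥0∞)) :=
  measurable_one.indicator hs

/-- Consistency applied to indicators: for `s` in the level field at `z'`, the resampling law from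
`z` restricted to `s` is invariant under resampling from `z'`. Integrating `φ` gives the identity
that characterizes the conditional expectation. -/
lemma condExp_resample (hA : MeasurableSet A) (hξ : Measurable ξ) {z z' : ℝ} (hz : z ≤ z')
    (x : ℕ → S) {φ : (ℕ → S) → ℝ} (hφ : Measurable φ) (hb : ∃ C, ∀ y, |φ y| ≤ C) :
    (resample P A ξ z x)[φ | levelFilt A ξ z'] =ᵐ[resample P A ξ z x]
      fun y => ∫ y', φ y' ∂resample P A ξ z' y := by
  obtain ⟨C, hC⟩ := hb
  have hprob := fun z => isProbabilityMeasure_resample P (ξ := ξ) hA z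
  have := hprob z x
  have hm := levelFilt_le (A := A) (ξ := ξ) hA hξ z'
  have hR := measurable_resample_levelFilt P (A := A) (ξ := ξ) hA hξ z'
  let κ : Kernel (ℕ → S) (ℕ → S) := ⟨resample P A ξ z', hR.mono hm le_rfl⟩
  have hκ : IsMarkovKernel κ := ⟨hprob z'⟩
  have hint : ∀ (ν : Measure (ℕ → S)) [IsFiniteMeasure ν], Integrable φ ν := fun ν _ =>
    Integrable.of_bound hφ.aestronglyMeasurable C (ae_of_all _ hC)
  have hgC : ∀ y, ‖∫ y', φ y' ∂resample P A ξ z' y‖ ≤ C := fun y => by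
    have := hprob z' y
    have h1 := norm_integral_le_of_norm_le_const (μ := resample P A ξ z' y) (f := φ)
      (ae_of_all _ hC)
    simpa using h1
  have hgm := stronglyMeasurable_integral_resample P hA hξ z' hφ
  refine (ae_eq_condExp_of_forall_setIntegral_eq hm (hint _) (fun s _ _ => ?_) (fun s hs _ => ?_)
    hgm.aestronglyMeasurable).symm
  · exact (Integrable.of_bound (hgm.mono hm).aestronglyMeasurable C
      (ae_of_all _ hgC)).integrableOn
  · have hs' := hm _ hs
    have hbind : (resample P A ξ z x).restrict s =
        κ ∘ₘ ((resample P A ξ z x).restrict s) := by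
      ext t ht
      rw [Measure.bind_apply ht κ.aemeasurable]
      have h1 := lintegral_resample_mul P hA hξ hz x (h := s.indicator 1) (F := t.indicator 1)
        (measurable_indicator_one hs) (measurable_indicator_one ht)
      have e1 : ∀ y : ℕ → S, s.indicator (1 : (ℕ → S) → ℝ≥0∞) y * t.indicator 1 y =
          s.indicator (t.indicator 1) y := fun y => by
        by_cases hy : y ∈ s <;> simp [hy]
      have e2 : ∀ (y : ℕ → S) (b : ℝ≥0∞), s.indicator (1 : (ℕ → S) → ℝ≥0∞) y * b =
          s.indicator (fun _ => b) y := fun y b => by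
        by_cases hy : y ∈ s <;> simp [hy]
      simp_rw [e1, lintegral_indicator_one ht] at h1
      rw [lintegral_indicator hs', lintegral_indicator_one ht] at h1
      rw [h1, ← lintegral_indicator hs']
      refine lintegral_congr fun y => ?_
      by_cases hy : y ∈ s <;> simp [hy, κ]
    have hcomp : (κ ∘ₖ Kernel.const Unit ((resample P A ξ z x).restrict s)) () =
        (resample P A ξ z x).restrict s := by
      rw [Kernel.comp_apply, Kernel.const_apply, ← hbind]
    have key := Kernel.integral_comp (κ := Kernel.const Unit ((resample P A ξ z x).restrict s))
      (η := κ) (a := ()) (f := φ) (by rw [hcomp]; exact hint _)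
    rw [hcomp, Kernel.const_apply] at key
    exact key.symm

theorem setting [TopologicalSpace S] (x₀ : S)
    (hA : MeasurableSet A) (hξ : Measurable ξ) :
    GAMS.Setting (cont P A 0 fun _ => x₀) {x | x 0 = x₀} (levelFilt A ξ) (resample P A ξ) where
  isProbabilityMeasure := by
    have := isMarkovKernel_cont P hA 0
    infer_instance
  measurableSet_support := measurableSet_start x₀
  law_support := by
    have := ae_start_cont P hA 0 fun _ => x₀
    exact ae_iff.1 this
  kernel_support z x hx := by
    have := ae_start_resample P (ξ := ξ) hA z x
    rw [show x 0 = x₀ from hx] at this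
    exact ae_iff.1 this
  filt_le := levelFilt_le hA hξ
  filt_mono := levelFilt_mono hA hξ
  kernel_prob := isProbabilityMeasure_resample P hA
  kernel_measurable := measurable_resample P hA hξ
  right_continuous x φ z := by
    refine continuousWithinAt_const.congr_of_eventuallyEq
      (f := fun _ => ∫ y, φ y ∂(resample P A ξ z x)) ?_ rfl
    filter_upwards [eventually_resample_eq P (ξ := ξ) hA z x] with z' hz'
    rw [hz']
  tendsto_atBot x hx φ := by
    refine tendsto_const_nhds.congr' ?_
    -- Below `ξ x₀` the entrance occurs at time `0`, the whole path is redrawn, and the function of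
    -- `z` is constant.
    filter_upwards [eventually_lt_atBot (ξ x₀)] with z hz
    have h0 : levelTime A ξ z x = (0 : ℕ) := levelTime_eq_zero (by rwa [show x 0 = x₀ from hx])
    rw [resample_of_eq_coe P hA h0, cont_zero P hA hx]
  consistent z x z' hz φ hφ hb := condExp_resample P hA hξ hz x hφ hb

end Setting

end AMS

namespace AMS

/-! ### Order statistics -/

section OrderStat

/-- In a sorted list the entries at most `a` come first. The default `⊤` stands for a missing entry,
whence the condition `a ≠ ⊤`. -/
lemma getD_le_iff {l : List EReal} (hl : l.Pairwise (· ≤ ·)) (i : ℕ) {a : EReal} (ha : a ≠ ⊤) :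
    l.getD i ⊤ ≤ a ↔ i < l.countP fun b => decide (b ≤ a) := by
  induction l generalizing i with
  | nil => simp [ha]
  | cons b t ih =>
    rw [List.pairwise_cons] at hl
    by_cases hb : b ≤ a
    · rw [List.countP_cons_of_pos (by simpa using hb)]
      cases i with
      | zero => simp [hb]
      | succ i => rw [List.getD_cons_succ, ih hl.2]; omega
    · have h0 : (b :: t).countP (fun b => decide (b ≤ a)) = 0 := by
        rw [List.countP_eq_zero]
        intro c hc
        rcases List.mem_cons.1 hc with rfl | hc
        · simpa using hb
        · simpa using fun h => hb ((hl.1 c hc).trans h)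
      rw [h0]
      simp only [Nat.not_lt_zero, iff_false, not_le]
      by_cases hi : i < (b :: t).length
      · rw [List.getD_eq_getElem _ _ hi]
        have hm := List.getElem_mem hi
        rcases List.mem_cons.1 hm with h | h
        · rw [h]; exact not_le.1 hb
        · exact (not_le.1 hb).trans_le (hl.1 _ h)
      · rw [List.getD_eq_default _ _ (not_lt.1 hi)]
        exact lt_top_iff_ne_top.2 ha

/-- Comparison with an order statistic becomes a count; both its measurability and its stability
under modification of a replica come from this. -/
lemma orderStat_le_iff {k : ℕ} (hk : 1 ≤ k) (s : Finset ℕ) (f : ℕ → EReal) {a : EReal}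
    (ha : a ≠ ⊤) : orderStat k s f ≤ a ↔ k ≤ (s.filter fun n => f n ≤ a).card := by
  rw [orderStat, getD_le_iff (Multiset.pairwise_sort _ _) _ ha]
  have h : ((s.val.map f).sort (· ≤ ·)).countP (fun b => decide (b ≤ a)) =
      (s.filter fun n => f n ≤ a).card := by
    rw [← Multiset.coe_countP, Multiset.sort_eq, Multiset.countP_map]
    rfl
  rw [h]
  omega

lemma orderStat_ne_bot {k : ℕ} (hk : 1 ≤ k) (s : Finset ℕ) {f : ℕ → EReal}
    (hf : ∀ n, ⊥ < f n) : orderStat k s f ≠ ⊥ := by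
  intro h
  have h1 := (orderStat_le_iff hk s f (a := ⊥) bot_ne_top).1 h.le
  have h2 : (s.filter fun n => f n ≤ ⊥) = ∅ :=
    Finset.filter_eq_empty_iff.2 fun n _ => not_le.2 (hf n)
  rw [h2, Finset.card_empty] at h1
  omega

lemma lt_orderStat {k : ℕ} (hk : 1 ≤ k) (s : Finset ℕ) {f : ℕ → EReal} {a : EReal}
    (ha : a ≠ ⊤) (hf : ∀ n ∈ s, a < f n) : a < orderStat k s f := by
  rw [← not_le, orderStat_le_iff hk s f ha, Finset.filter_eq_empty_iff.2
    fun n hn => not_le.2 (hf n hn), Finset.card_empty]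
  omega

lemma measurableSet_le_card_filter {Ω : Type*} {m : MeasurableSpace Ω} {E : Ω → ℕ → Prop}
    [∀ ω, DecidablePred (E ω)] {s : Finset ℕ} (hE : ∀ n ∈ s, MeasurableSet {ω | E ω n}) (k : ℕ) :
    MeasurableSet {ω | k ≤ (s.filter (E ω)).card} := by
  simp_rw [Finset.card_filter]
  have : Measurable fun ω => ∑ n ∈ s, if E ω n then 1 else 0 :=
    Finset.measurable_fun_sum _ fun n hn => Measurable.ite (hE n hn) measurable_const
      measurable_const
  exact this measurableSet_Ici

lemma measurable_orderStat {Ω : Type*} {m : MeasurableSpace Ω} {k : ℕ} (hk : 1 ≤ k)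
    (s : Finset ℕ) {f : Ω → ℕ → EReal} (hf : ∀ n, Measurable fun ω => f ω n) :
    Measurable fun ω => orderStat k s (f ω) := by
  refine measurable_of_Iic fun a => ?_
  by_cases ha : a = ⊤
  · simp [ha]
  · have : (fun ω => orderStat k s (f ω)) ⁻¹' Set.Iic a =
        {ω | k ≤ (s.filter fun n => f ω n ≤ a).card} := by
      ext ω
      simp only [Set.mem_preimage, Set.mem_Iic, orderStat_le_iff hk s _ ha, Set.mem_ofPred_eq]
    rw [this]
    exact measurableSet_le_card_filter (fun n _ => hf n measurableSet_Iic) k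

end OrderStat

/-! ### One step of the algorithm -/

/-- The discrete σ-field, in agreement with the one used for labels in `IsGAMS`. -/
instance finsetMeasurableSpace : MeasurableSpace (Finset ℕ) := ⊤

instance : DiscreteMeasurableSpace (Finset ℕ) := ⟨fun _ => trivial⟩

namespace Params

variable {S : Type*} (p : Params S) {s : State} {x x' : ℕ → ℕ → S} {par : ℕ → ℕ}
  {on : Finset ℕ}

lemma level_eq_orderStat (h : p.level on x ≠ ⊤) :
    p.level on x = orderStat p.k on fun n => maxLevel p.A p.ξ (x n) := by
  rw [level] at h ⊢
  split_ifs with h1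
  · simp [h1] at h
  · rfl

lemma card_filter_ne (h : p.level on x ≠ ⊤) :
    (on.filter fun n => maxLevel p.A p.ξ (x n) ≤ p.level on x).card ≠ p.nrep := by
  rw [p.level_eq_orderStat h]
  intro h1
  rw [level] at h
  simp [h1] at h

lemma orderStat_le_level :
    orderStat p.k on (fun n => maxLevel p.A p.ξ (x n)) ≤ p.level on x := by
  by_cases h : p.level on x = ⊤
  · simp [h]
  · rw [p.level_eq_orderStat h]

lemma level_ne_bot (hk : 1 ≤ p.k) : p.level on x ≠ ⊥ := fun h =>
  orderStat_ne_bot hk on (f := fun n => maxLevel p.A p.ξ (x n)) (fun _ => bot_lt_maxLevel)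
    (le_bot_iff.1 (h ▸ p.orderStat_le_level))

/-- Maximum levels exceed `⊥` because `ξ` is real at time `0`, so the level is never `⊥` and
`toReal` is faithful while the algorithm runs. -/
lemma coe_toReal_level (hk : 1 ≤ p.k) (h : p.level on x ≠ ⊤) :
    ((p.level on x).toReal : EReal) = p.level on x :=
  EReal.coe_toReal h (p.level_ne_bot hk)

/-- An order statistic of values above `a` is above `a`; this is the source of the monotonicity of
the levels. -/
lemma lt_level (hk : 1 ≤ p.k) {a : ℝ} (h : ∀ n ∈ on, (a : EReal) < maxLevel p.A p.ξ (x n)) :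
    (a : EReal) < p.level on x :=
  (lt_orderStat hk on (EReal.coe_ne_top a) h).trans_le p.orderStat_le_level

lemma level_congr (h : ∀ n ∈ on, x n = x' n) : p.level on x = p.level on x' := by
  have h1 : orderStat p.k on (fun n => maxLevel p.A p.ξ (x n)) =
      orderStat p.k on fun n => maxLevel p.A p.ξ (x' n) := by
    unfold orderStat
    congr 2
    exact Multiset.map_congr rfl fun n hn => by rw [h n hn]
  unfold level
  simp only [h1]
  congr 2
  exact congrArg Finset.card (Finset.filter_congr fun n hn => by rw [h n hn])

lemma measurable_level [MeasurableSpace S] (hA : MeasurableSet p.A) (hξ : Measurable p.ξ)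
    (hk : 1 ≤ p.k) : Measurable fun y : Finset ℕ × (ℕ → ℕ → S) => p.level y.1 y.2 := by
  refine measurable_from_prod_countable_right fun on => ?_
  have hX : ∀ n, Measurable fun x : ℕ → ℕ → S => maxLevel p.A p.ξ (x n) := fun n =>
    (measurable_maxLevel hA hξ).comp (measurable_pi_apply n)
  have hL := measurable_orderStat hk on hX
  have hc : Measurable fun x : ℕ → ℕ → S => (on.filter fun n => maxLevel p.A p.ξ (x n) ≤
      orderStat p.k on fun n => maxLevel p.A p.ξ (x n)).card := by
    simp_rw [Finset.card_filter]
    exact Finset.measurable_fun_sum _ fun n _ => Measurable.ite (measurableSet_le (hX n) hL)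
      measurable_const measurable_const
  exact Measurable.ite (hc (measurableSet_singleton p.nrep)) measurable_const hL

lemma onLe_union_onGt : p.onLe s x ∪ p.onGt s x = s.on := by
  ext n
  simp only [onLe, onGt, Finset.mem_union, Finset.mem_filter]
  constructor
  · rintro (h | h) <;> exact h.1
  · intro h
    rcases le_or_gt (maxLevel p.A p.ξ (x n)) (p.level s.on x) with h1 | h1
    · exact Or.inl ⟨h, h1⟩
    · exact Or.inr ⟨h, h1⟩

lemma disjoint_onLe_onGt : Disjoint (p.onLe s x) (p.onGt s x) := by
  rw [Finset.disjoint_left]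
  intro n h1 h2
  exact absurd (Finset.mem_filter.1 h1).2 (not_le.2 (Finset.mem_filter.1 h2).2)

lemma onLe_subset : p.onLe s x ⊆ s.on := Finset.filter_subset _ _

lemma onGt_subset : p.onGt s x ⊆ s.on := Finset.filter_subset _ _

lemma level_ne_top (h : ¬ (p.zmax : EReal) < p.level s.on x) : p.level s.on x ≠ ⊤ :=
  ne_top_of_le_ne_top (EReal.coe_ne_top _) (not_lt.1 h)

/-- If no replica were above the order statistic, the level would have been set to `+∞`. So there
are parents to choose from. -/
lemma onGt_nonempty (hs : s.on.card = p.nrep) (h : ¬ (p.zmax : EReal) < p.level s.on x) :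
    (p.onGt s x).Nonempty := by
  rw [Finset.nonempty_iff_ne_empty]
  intro h1
  have h2 := p.onLe_union_onGt (s := s) (x := x)
  rw [h1, Finset.union_empty] at h2
  refine p.card_filter_ne (p.level_ne_top h) ?_
  rw [← hs]
  exact congrArg Finset.card h2

lemma card_onLe_add_card_onGt (hs : s.on.card = p.nrep) :
    (p.onLe s x).card + (p.onGt s x).card = p.nrep := by
  rw [← Finset.card_union_of_disjoint p.disjoint_onLe_onGt, p.onLe_union_onGt, hs]

lemma card_newLabels (h : ¬ (p.zmax : EReal) < p.level s.on x) :
    (p.newLabels s x).card = (p.onLe s x).card := by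
  rw [newLabels, if_neg h]
  simp

lemma newLabels_of_lt (h : (p.zmax : EReal) < p.level s.on x) : p.newLabels s x = ∅ := if_pos h

end Params

/-- The invariants of the states of the algorithm. -/
structure State.Valid (N : ℕ) (s : State) : Prop where
  card_on : s.on.card = N
  disjoint : Disjoint s.on s.off
  labels : s.on ∪ s.off = Finset.Icc 1 (s.on ∪ s.off).card
  weight_eq : ∀ n ∈ s.on, ∀ n' ∈ s.on, s.weight n = s.weight n'
  sum_weight : ∑ n ∈ s.on ∪ s.off, s.weight n = 1
  weight_nonneg : ∀ n, 0 ≤ s.weight n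

/-- The mean weight of the working replicas. -/
def State.mean (N : ℕ) (s : State) : ℝ := (∑ n ∈ s.on, s.weight n) / N

namespace State.Valid

variable {N : ℕ} {s : State}

lemma mean_eq (hs : s.Valid N) {n : ℕ} (hn : n ∈ s.on) : s.weight n = s.mean N := by
  have hN : (N : ℝ) ≠ 0 := by
    rw [← hs.card_on]
    exact_mod_cast (Finset.card_pos.2 ⟨n, hn⟩).ne'
  rw [State.mean, Finset.sum_congr rfl fun m hm => hs.weight_eq m hm n hn, Finset.sum_const,
    hs.card_on, nsmul_eq_mul]
  field_simp

end State.Valid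

/-! ### Preservation of the invariants by one step -/

namespace Params

variable {S : Type*} (p : Params S) {s : State} {x x' : ℕ → ℕ → S} {par : ℕ → ℕ}

lemma disjoint_newLabels (hs : s.Valid p.nrep) : Disjoint (s.on ∪ s.off) (p.newLabels s x) := by
  rw [newLabels]
  split_ifs
  · simp
  · rw [hs.labels, Finset.disjoint_left]
    intro n h1 h2
    simp only [Finset.mem_Icc, Nat.card_Icc] at h1 h2
    omega

lemma step_of_lt (h : (p.zmax : EReal) < p.level s.on x) : p.step s x par = s := if_pos h

lemma step_on (h : ¬ (p.zmax : EReal) < p.level s.on x) :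
    (p.step s x par).on = p.onGt s x ∪ p.newLabels s x := by
  rw [step, if_neg h]

lemma step_off (h : ¬ (p.zmax : EReal) < p.level s.on x) :
    (p.step s x par).off = s.off ∪ p.onLe s x := by
  rw [step, if_neg h]

/-- The factor by which the weights of the working replicas are multiplied. -/
def factor (s : State) (x : ℕ → ℕ → S) : ℝ := ((p.nrep : ℝ) - (p.onLe s x).card) / p.nrep

lemma step_weight (h : ¬ (p.zmax : EReal) < p.level s.on x) (n : ℕ) :
    (p.step s x par).weight n = if n ∈ p.onGt s x then p.factor s x * s.weight n
        else if n ∈ p.newLabels s x then p.factor s x * s.weight (par n)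
        else s.weight n := by
  rw [step, if_neg h]
  rfl

lemma step_labels : (p.step s x par).on ∪ (p.step s x par).off =
    s.on ∪ s.off ∪ p.newLabels s x := by
  by_cases h : (p.zmax : EReal) < p.level s.on x
  · rw [step_of_lt p h, newLabels_of_lt p h, Finset.union_empty]
  · rw [step_on p h, step_off p h, ← p.onLe_union_onGt (s := s) (x := x)]
    ext n
    simp only [Finset.mem_union]
    tauto

lemma factor_eq (hs : s.on.card = p.nrep) :
    p.factor s x = (p.onGt s x).card / p.nrep := by
  rw [factor, ← p.card_onLe_add_card_onGt hs (x := x)]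
  push_cast
  ring

lemma factor_nonneg (hs : s.on.card = p.nrep) : 0 ≤ p.factor s x := by
  rw [p.factor_eq hs]
  positivity

lemma notMem_onGt_of_mem_newLabels (hs : s.Valid p.nrep) {n : ℕ} (hn : n ∈ p.newLabels s x) :
    n ∉ s.on ∪ s.off := fun h => Finset.disjoint_left.1 (p.disjoint_newLabels hs) h hn

lemma step_weight_onGt (h : ¬ (p.zmax : EReal) < p.level s.on x) {n : ℕ}
    (hn : n ∈ p.onGt s x) : (p.step s x par).weight n = p.factor s x * s.weight n := by
  rw [step_weight p h, if_pos hn]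

lemma step_weight_new (hs : s.Valid p.nrep) (h : ¬ (p.zmax : EReal) < p.level s.on x) {n : ℕ}
    (hn : n ∈ p.newLabels s x) :
    (p.step s x par).weight n = p.factor s x * s.weight (par n) := by
  rw [step_weight p h, if_neg fun h1 => p.notMem_onGt_of_mem_newLabels hs hn
    (Finset.mem_union_left _ (p.onGt_subset h1)), if_pos hn]

lemma step_weight_off (hs : s.Valid p.nrep) (h : ¬ (p.zmax : EReal) < p.level s.on x) {n : ℕ}
    (hn : n ∈ s.off ∪ p.onLe s x) : (p.step s x par).weight n = s.weight n := by
  have h1 : n ∉ p.onGt s x := by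
    intro h1
    rcases Finset.mem_union.1 hn with h2 | h2
    · exact Finset.disjoint_left.1 hs.disjoint (p.onGt_subset h1) h2
    · exact Finset.disjoint_left.1 p.disjoint_onLe_onGt h2 h1
  have h2 : n ∉ p.newLabels s x := by
    intro h2
    refine p.notMem_onGt_of_mem_newLabels hs h2 ?_
    rcases Finset.mem_union.1 hn with h3 | h3
    · exact Finset.mem_union_right _ h3
    · exact Finset.mem_union_left _ (p.onLe_subset h3)
  rw [step_weight p h, if_neg h1, if_neg h2]

lemma disjoint_onGt_newLabels (hs : s.Valid p.nrep) :
    Disjoint (p.onGt s x) (p.newLabels s x) :=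
  (p.disjoint_newLabels hs).mono_left (p.onGt_subset.trans Finset.subset_union_left)

lemma disjoint_off_onLe (hs : s.Valid p.nrep) : Disjoint s.off (p.onLe s x) :=
  hs.disjoint.symm.mono_right p.onLe_subset

/-- Survivors are rescaled by one factor and children inherit from survivors, so the working
replicas keep a common weight. -/
lemma step_weight_eq_mean (hs : s.Valid p.nrep) (h : ¬ (p.zmax : EReal) < p.level s.on x)
    (hpar : ∀ n ∈ p.newLabels s x, par n ∈ p.onGt s x) {n : ℕ}
    (hn : n ∈ p.onGt s x ∪ p.newLabels s x) :
    (p.step s x par).weight n = p.factor s x * s.mean p.nrep := by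
  rcases Finset.mem_union.1 hn with h1 | h1
  · rw [p.step_weight_onGt h h1, hs.mean_eq (p.onGt_subset h1)]
  · rw [p.step_weight_new hs h h1, hs.mean_eq (p.onGt_subset (hpar n h1))]

/-- With `N` working replicas of weight `w`, of which `K` are retired, mass is conserved because `N
((N - K)/N) w + K w = N w`. -/
lemma valid_step (hs : s.Valid p.nrep) (hpar : ∀ n ∈ p.newLabels s x, par n ∈ p.onGt s x) :
    (p.step s x par).Valid p.nrep := by
  by_cases h : (p.zmax : EReal) < p.level s.on x
  · rwa [step_of_lt p h]
  have hcard : (p.onGt s x ∪ p.newLabels s x).card = p.nrep := by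
    rw [Finset.card_union_of_disjoint (p.disjoint_onGt_newLabels hs), card_newLabels p h,
      add_comm, p.card_onLe_add_card_onGt hs.card_on]
  have hdisj : Disjoint (p.onGt s x ∪ p.newLabels s x) (s.off ∪ p.onLe s x) := by
    rw [Finset.disjoint_union_left, Finset.disjoint_union_right, Finset.disjoint_union_right]
    refine ⟨⟨hs.disjoint.mono_left p.onGt_subset, p.disjoint_onLe_onGt.symm⟩,
      (p.disjoint_newLabels hs).symm.mono_right Finset.subset_union_right,
      (p.disjoint_newLabels hs).symm.mono_right (p.onLe_subset.trans Finset.subset_union_left)⟩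
  refine ⟨?_, ?_, ?_, ?_, ?_, ?_⟩
  · rwa [step_on p h]
  · rwa [step_on p h, step_off p h]
  · rw [step_labels, Finset.card_union_of_disjoint (p.disjoint_newLabels hs), newLabels, if_neg h,
      hs.labels]
    ext n
    simp only [Finset.mem_union, Finset.mem_Icc, Nat.card_Icc]
    omega
  · rw [step_on p h]
    intro n hn n' hn'
    rw [p.step_weight_eq_mean hs h hpar hn, p.step_weight_eq_mean hs h hpar hn']
  · rw [step_on p h, step_off p h, Finset.sum_union hdisj,
      Finset.sum_congr rfl fun n hn => p.step_weight_eq_mean hs h hpar hn,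
      Finset.sum_congr rfl fun n hn => p.step_weight_off hs h hn, Finset.sum_const, hcard,
      Finset.sum_union (p.disjoint_off_onLe hs), nsmul_eq_mul,
      Finset.sum_congr (s₁ := p.onLe s x) rfl fun n hn => hs.mean_eq (p.onLe_subset hn),
      Finset.sum_const, nsmul_eq_mul, p.factor_eq hs.card_on]
    have h1 := hs.sum_weight
    rw [Finset.sum_union hs.disjoint, Finset.sum_congr rfl fun n hn => hs.mean_eq hn,
      Finset.sum_const, hs.card_on, nsmul_eq_mul] at h1
    generalize s.mean p.nrep = w at h1 ⊢
    rw [← p.card_onLe_add_card_onGt hs.card_on (x := x)] at h1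
    have hN : (p.nrep : ℝ) ≠ 0 := by
      have h2 := Finset.card_pos.2 (p.onGt_nonempty hs.card_on h)
      have h3 := p.card_onLe_add_card_onGt hs.card_on (x := x)
      exact_mod_cast (by omega : p.nrep ≠ 0)
    rw [← mul_assoc, mul_div_cancel₀ _ hN, ← h1]
    push_cast
    ring
  · intro n
    have hf := p.factor_nonneg hs.card_on (x := x)
    rw [step_weight p h]
    split_ifs
    · exact mul_nonneg hf (hs.weight_nonneg _)
    · exact mul_nonneg hf (hs.weight_nonneg _)
    · exact hs.weight_nonneg _

lemma mean_step (hs : s.Valid p.nrep) (hN : 0 < p.nrep)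
    (h : ¬ (p.zmax : EReal) < p.level s.on x)
    (hpar : ∀ n ∈ p.newLabels s x, par n ∈ p.onGt s x) :
    (p.step s x par).mean p.nrep = p.factor s x * s.mean p.nrep := by
  have h1 := p.valid_step hs hpar
  obtain ⟨n, hn⟩ : (p.step s x par).on.Nonempty := by
    rw [← Finset.card_pos, h1.card_on]
    exact hN
  rw [← h1.mean_eq hn]
  rw [step_on p h] at hn
  exact p.step_weight_eq_mean hs h hpar hn

lemma valid_init (hN : 0 < p.nrep) :
    State.Valid p.nrep ⟨Finset.Icc 1 p.nrep, ∅, fun _ => 1 / p.nrep⟩ := by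
  refine ⟨by simp, by simp, by simp, fun _ _ _ _ => rfl, ?_, fun _ => by positivity⟩
  have : (p.nrep : ℝ) ≠ 0 := by exact_mod_cast hN.ne'
  simp [this]

end Params

end AMS

namespace AMS

/-! ### Measurability of random finite sets -/

section RandomSets

variable {Ω : Type*} {m : MeasurableSpace Ω}

/-- Used to evaluate a family at a random label or along a random finite set. -/
lemma measurable_comp_countable {β γ : Type*} [Countable β] [MeasurableSpace β]
    [MeasurableSingletonClass β] [MeasurableSpace γ] {V : Ω → β} (hV : Measurable V)
    {F : β → Ω → γ} (hF : ∀ b, Measurable (F b)) : Measurable fun ω => F (V ω) ω :=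
  Measurable.comp (g := fun q : β × Ω => F q.1 q.2) (f := fun ω => (V ω, ω))
    (measurable_from_prod_countable_right hF) (hV.prodMk measurable_id)

lemma measurable_finset {T : Ω → Finset ℕ} (h : ∀ n, MeasurableSet {ω | n ∈ T ω}) :
    Measurable T := by
  refine measurable_to_countable' fun T₀ => ?_
  have : T ⁻¹' {T₀} = ⋂ n, {ω | n ∈ T ω ↔ n ∈ T₀} := by
    ext ω
    simp [Finset.ext_iff]
  rw [this]
  refine .iInter fun n => ?_
  by_cases hn : n ∈ T₀
  · simpa only [hn, iff_true] using h n
  · simpa only [hn, iff_false, Set.compl_ofPred] using (h n).compl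

lemma measurableSet_mem_finset {T : Ω → Finset ℕ} (h : Measurable T) (n : ℕ) :
    MeasurableSet {ω | n ∈ T ω} := h (MeasurableSet.of_discrete (s := {t : Finset ℕ | n ∈ t}))

lemma measurable_finset_binop {T T' : Ω → Finset ℕ} (h : Measurable T) (h' : Measurable T')
    {γ : Type*} [MeasurableSpace γ] (f : Finset ℕ → Finset ℕ → γ) :
    Measurable fun ω => f (T ω) (T' ω) :=
  measurable_comp_countable h fun _ => measurable_comp_countable h' fun _ => measurable_const

lemma measurable_finset_op {T : Ω → Finset ℕ} (h : Measurable T)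
    {γ : Type*} [MeasurableSpace γ] (f : Finset ℕ → γ) : Measurable fun ω => f (T ω) :=
  measurable_comp_countable h fun _ => measurable_const

lemma measurable_random_sum {T : Ω → Finset ℕ} (h : Measurable T) {M : Type*} [AddCommMonoid M]
    [MeasurableSpace M] [MeasurableAdd₂ M] {f : ℕ → Ω → M} (hf : ∀ n, Measurable (f n)) :
    Measurable fun ω => ∑ n ∈ T ω, f n ω :=
  measurable_comp_countable h fun t => Finset.measurable_fun_sum t fun n _ => hf n

lemma measurable_random_prod {T : Ω → Finset ℕ} (h : Measurable T) {M : Type*} [CommMonoid M]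
    [MeasurableSpace M] [MeasurableMul₂ M] {f : ℕ → Ω → M} (hf : ∀ n, Measurable (f n)) :
    Measurable fun ω => ∏ n ∈ T ω, f n ω :=
  measurable_comp_countable h fun t => Finset.measurable_fun_prod t fun n _ => hf n

lemma measurableSet_forall_mem {T : Ω → Finset ℕ} (h : Measurable T) {E : ℕ → Ω → Prop}
    (hE : ∀ n, MeasurableSet {ω | E n ω}) : MeasurableSet {ω | ∀ n ∈ T ω, E n ω} := by
  have : {ω | ∀ n ∈ T ω, E n ω} = ⋂ n, ({ω | n ∈ T ω}ᶜ ∪ {ω | E n ω}) := by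
    ext ω
    simp [imp_iff_not_or]
  rw [this]
  exact .iInter fun n => (measurableSet_mem_finset h n).compl.union (hE n)

end RandomSets

namespace Params

/-! ### Measurability of one step -/

section StepMeasurable

variable {S : Type*} [MeasurableSpace S] (p : Params S) {Ω : Type*} {m : MeasurableSpace Ω}
  {s : Ω → State} {x : Ω → ℕ → ℕ → S} {par : Ω → ℕ → ℕ}

/-- Measurability of a random state. -/
structure _root_.AMS.State.IsMeasurable {Ω : Type*} (m : MeasurableSpace Ω) (s : Ω → State) :
    Prop where
  on : Measurable fun ω => (s ω).on
  off : Measurable fun ω => (s ω).off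
  weight : ∀ n, Measurable fun ω => (s ω).weight n

lemma measurable_level_comp (hA : MeasurableSet p.A) (hξ : Measurable p.ξ) (hk : 1 ≤ p.k)
    (hs : Measurable fun ω => (s ω).on) (hx : ∀ n, Measurable fun ω => x ω n) :
    Measurable fun ω => p.level (s ω).on (x ω) :=
  Measurable.comp (g := fun y : Finset ℕ × (ℕ → ℕ → S) => p.level y.1 y.2)
    (f := fun ω => ((s ω).on, x ω)) (p.measurable_level hA hξ hk)
    (hs.prodMk (measurable_pi_lambda _ hx))

lemma measurable_onGt (hA : MeasurableSet p.A) (hξ : Measurable p.ξ) (hk : 1 ≤ p.k)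
    (hs : Measurable fun ω => (s ω).on) (hx : ∀ n, Measurable fun ω => x ω n) :
    Measurable fun ω => p.onGt (s ω) (x ω) := by
  refine measurable_finset fun n => ?_
  simp only [onGt, Finset.mem_filter, Set.ofPred_and]
  exact (measurableSet_mem_finset hs n).inter (measurableSet_lt
    (p.measurable_level_comp hA hξ hk hs hx) ((measurable_maxLevel hA hξ).comp (hx n)))

lemma measurable_onLe (hA : MeasurableSet p.A) (hξ : Measurable p.ξ) (hk : 1 ≤ p.k)
    (hs : Measurable fun ω => (s ω).on) (hx : ∀ n, Measurable fun ω => x ω n) :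
    Measurable fun ω => p.onLe (s ω) (x ω) := by
  refine measurable_finset fun n => ?_
  simp only [onLe, Finset.mem_filter, Set.ofPred_and]
  exact (measurableSet_mem_finset hs n).inter (measurableSet_le
    ((measurable_maxLevel hA hξ).comp (hx n)) (p.measurable_level_comp hA hξ hk hs hx))

lemma measurable_newLabels (hA : MeasurableSet p.A) (hξ : Measurable p.ξ) (hk : 1 ≤ p.k)
    (hs : Measurable fun ω => (s ω).on) (hs' : Measurable fun ω => (s ω).off)
    (hx : ∀ n, Measurable fun ω => x ω n) :
    Measurable fun ω => p.newLabels (s ω) (x ω) := by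
  refine Measurable.ite (measurableSet_lt measurable_const
    (p.measurable_level_comp hA hξ hk hs hx)) measurable_const ?_
  exact measurable_finset_binop (measurable_finset_binop hs hs' fun a b => a ∪ b)
    (p.measurable_onLe hA hξ hk hs hx) fun a b => Finset.Icc (a.card + 1) (a.card + b.card)

lemma measurable_factor (hA : MeasurableSet p.A) (hξ : Measurable p.ξ) (hk : 1 ≤ p.k)
    (hs : Measurable fun ω => (s ω).on) (hx : ∀ n, Measurable fun ω => x ω n) :
    Measurable fun ω => p.factor (s ω) (x ω) :=
  measurable_finset_op (p.measurable_onLe hA hξ hk hs hx)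
    fun a => ((p.nrep : ℝ) - a.card) / p.nrep

lemma isMeasurable_step (hA : MeasurableSet p.A) (hξ : Measurable p.ξ) (hk : 1 ≤ p.k)
    (hs : State.IsMeasurable m s) (hx : ∀ n, Measurable fun ω => x ω n)
    (hpar : ∀ n, Measurable fun ω => par ω n) :
    State.IsMeasurable m fun ω => p.step (s ω) (x ω) (par ω) := by
  have hlt : MeasurableSet {ω | (p.zmax : EReal) < p.level (s ω).on (x ω)} :=
    measurableSet_lt measurable_const (p.measurable_level_comp hA hξ hk hs.on hx)
  have hgt := p.measurable_onGt hA hξ hk hs.on hx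
  have hnew := p.measurable_newLabels hA hξ hk hs.on hs.off hx
  have hf := p.measurable_factor hA hξ hk hs.on hx
  refine ⟨?_, ?_, fun n => ?_⟩
  · have : (fun ω => (p.step (s ω) (x ω) (par ω)).on) = fun ω =>
        if (p.zmax : EReal) < p.level (s ω).on (x ω) then (s ω).on
        else p.onGt (s ω) (x ω) ∪ p.newLabels (s ω) (x ω) := by
      ext1 ω
      by_cases h : (p.zmax : EReal) < p.level (s ω).on (x ω)
      · rw [step_of_lt p h, if_pos h]
      · rw [step_on p h, if_neg h]
    rw [this]
    exact Measurable.ite hlt hs.on (measurable_finset_binop hgt hnew fun a b => a ∪ b)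
  · have : (fun ω => (p.step (s ω) (x ω) (par ω)).off) = fun ω =>
        if (p.zmax : EReal) < p.level (s ω).on (x ω) then (s ω).off
        else (s ω).off ∪ p.onLe (s ω) (x ω) := by
      ext1 ω
      by_cases h : (p.zmax : EReal) < p.level (s ω).on (x ω)
      · rw [step_of_lt p h, if_pos h]
      · rw [step_off p h, if_neg h]
    rw [this]
    exact Measurable.ite hlt hs.off (measurable_finset_binop hs.off
      (p.measurable_onLe hA hξ hk hs.on hx) fun a b => a ∪ b)
  · have : (fun ω => (p.step (s ω) (x ω) (par ω)).weight n) = fun ω =>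
        if (p.zmax : EReal) < p.level (s ω).on (x ω) then (s ω).weight n
        else if n ∈ p.onGt (s ω) (x ω) then p.factor (s ω) (x ω) * (s ω).weight n
        else if n ∈ p.newLabels (s ω) (x ω) then p.factor (s ω) (x ω) * (s ω).weight (par ω n)
        else (s ω).weight n := by
      ext1 ω
      by_cases h : (p.zmax : EReal) < p.level (s ω).on (x ω)
      · rw [step_of_lt p h, if_pos h]
      · rw [step_weight p h, if_neg h]
    rw [this]
    exact Measurable.ite hlt (hs.weight n) <| Measurable.ite (measurableSet_mem_finset hgt n)
      (hf.mul (hs.weight n)) <| Measurable.ite (measurableSet_mem_finset hnew n)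
      (hf.mul (measurable_comp_countable (F := fun j ω => (s ω).weight j) (hpar n) hs.weight))
      (hs.weight n)

end StepMeasurable

end Params

/-! ### Pathwise properties of a run -/

section Run

variable {S Ω : Type*} {p : Params S} {X : ℕ → ℕ → Ω → ℕ → S} {par : ℕ → ℕ → Ω → ℕ}
  [mΩ : MeasurableSpace Ω] [MeasurableSpace S] {P : Kernel S S} [IsMarkovKernel P]
  {π : Measure (ℕ → S)} {μ : Measure Ω} {H : Filtration ℕ mΩ}

lemma stateAt_succ (q : ℕ) (ω : Ω) : stateAt p X par (q + 1) ω =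
    p.step (stateAt p X par q ω) (fun n => X q n ω) fun n => par q n ω := rfl

namespace IsAMS

lemma valid (h : IsAMS p X par P π μ H) (hN : 0 < p.nrep) (q : ℕ) (ω : Ω) :
    (stateAt p X par q ω).Valid p.nrep := by
  induction q with
  | zero => exact p.valid_init hN
  | succ q ih =>
    rw [stateAt_succ]
    exact p.valid_step ih (h.par_mem q ω)

lemma stateAt_succ_of_lt {q : ℕ} {ω : Ω} (hlt : (p.zmax : EReal) < levelAt p X par q ω) :
    stateAt p X par (q + 1) ω = stateAt p X par q ω := p.step_of_lt hlt

lemma levelAt_succ_of_lt (h : IsAMS p X par P π μ H) {q : ℕ} {ω : Ω}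
    (hlt : (p.zmax : EReal) < levelAt p X par q ω) :
    levelAt p X par (q + 1) ω = levelAt p X par q ω := by
  rw [levelAt, levelAt, stateAt_succ_of_lt hlt]
  exact p.level_congr fun n hn => h.keep q ω n (Finset.mem_union_left _ hn)

lemma not_run_mono (h : IsAMS p X par P π μ H) {q r : ℕ} (hqr : q ≤ r) {ω : Ω}
    (hlt : (p.zmax : EReal) < levelAt p X par q ω) :
    (p.zmax : EReal) < levelAt p X par r ω ∧ stateAt p X par r ω = stateAt p X par q ω ∧
      ∀ n ∈ (stateAt p X par q ω).on ∪ (stateAt p X par q ω).off, X r n ω = X q n ω := by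
  induction r, hqr using Nat.le_induction with
  | base => exact ⟨hlt, rfl, fun _ _ => rfl⟩
  | succ r _ ih =>
    refine ⟨?_, ?_, fun n hn => ?_⟩
    · rw [h.levelAt_succ_of_lt ih.1]; exact ih.1
    · rw [stateAt_succ_of_lt ih.1]; exact ih.2.1
    · rw [h.keep r ω n (by rw [ih.2.1]; exact hn), ih.2.2 n hn]

/-- A replica is retired at a level at most `zmax` and is never modified afterwards. This removes
the retired replicas from the estimator of the probability. -/
lemma maxLevel_off_le (h : IsAMS p X par P π μ H) (q : ℕ) (ω : Ω) :
    ∀ n ∈ (stateAt p X par q ω).off, maxLevel p.A p.ξ (X q n ω) ≤ (p.zmax : EReal) := by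
  induction q with
  | zero => intro n hn; simp [stateAt, Params.state] at hn
  | succ q ih =>
    by_cases hlt : (p.zmax : EReal) < levelAt p X par q ω
    · rw [stateAt_succ_of_lt hlt]
      intro n hn
      rw [h.keep q ω n (Finset.mem_union_right _ hn)]
      exact ih n hn
    · rw [stateAt_succ, p.step_off hlt]
      intro n hn
      rcases Finset.mem_union.1 hn with h1 | h1
      · rw [h.keep q ω n (Finset.mem_union_right _ h1)]
        exact ih n h1
      · rw [h.keep q ω n (Finset.mem_union_left _ (p.onLe_subset h1))]
        exact (Finset.mem_filter.1 h1).2.trans (not_lt.1 hlt)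

lemma newAt_of_lt {q : ℕ} {ω : Ω} (hlt : (p.zmax : EReal) < levelAt p X par q ω) :
    newAt p X par q ω = ∅ := p.newLabels_of_lt hlt

lemma not_lt_of_mem_newAt {q n : ℕ} {ω : Ω} (hn : n ∈ newAt p X par q ω) :
    ¬ (p.zmax : EReal) < levelAt p X par q ω := fun hlt => by
  rw [newAt_of_lt hlt] at hn
  simp at hn

/-- Branching numbers are at least one: retired replicas are kept, and nothing is killed in the
sense of the framework. -/
lemma killed_eq (q : ℕ) (ω : Ω) : (toScheme p X par).killed q ω = ∅ := by
  refine Finset.filter_eq_empty_iff.2 fun n _ => ?_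
  simp only [toScheme]
  omega

/-- Each new label has exactly one parent, which is an existing label; counting children parent by
parent counts the new labels. -/
lemma newCard_eq (h : IsAMS p X par P π μ H) (q : ℕ) (ω : Ω) :
    (toScheme p X par).newCard q ω = (newAt p X par q ω).card := by
  have hmaps : ∀ n ∈ newAt p X par q ω, par q n ω ∈
      (stateAt p X par q ω).on ∪ (stateAt p X par q ω).off := fun n hn =>
    Finset.mem_union_left _ (p.onGt_subset (h.par_mem q ω n hn))
  rw [Finset.card_eq_sum_card_fiberwise hmaps]
  exact Finset.sum_congr rfl fun n _ => by simp [toScheme]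

/-- The framework numbers from the largest label and the algorithm from the number of labels; they
agree because the labels form an interval starting at `1`. -/
lemma newLabels_eq (h : IsAMS p X par P π μ H) (hN : 0 < p.nrep) (q : ℕ) (ω : Ω) :
    (toScheme p X par).newLabels q ω = newAt p X par q ω := by
  have hsup : ((toScheme p X par).labels q ω).sup id =
      ((stateAt p X par q ω).on ∪ (stateAt p X par q ω).off).card := by
    have h1 : (toScheme p X par).labels q ω = _ := (h.valid hN q ω).labels
    rw [h1]
    refine le_antisymm (Finset.sup_le fun n hn => (Finset.mem_Icc.1 hn).2) ?_
    rcases Nat.eq_zero_or_pos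
      ((stateAt p X par q ω).on ∪ (stateAt p X par q ω).off).card with h0 | h0
    · rw [h0]; exact Nat.zero_le _
    · exact Finset.le_sup (f := id) (Finset.mem_Icc.2 ⟨h0, le_rfl⟩)
  rw [GAMS.Scheme.newLabels, hsup, h.newCard_eq]
  by_cases hlt : (p.zmax : EReal) < levelAt p X par q ω
  · rw [newAt_of_lt hlt]
    simp
  · have h1 : newAt p X par q ω = _ := if_neg hlt
    rw [h1]
    simp

lemma parentMap_of_new (h : IsAMS p X par P π μ H) (hN : 0 < p.nrep) {q n : ℕ} {ω : Ω}
    (hn : n ∈ newAt p X par q ω) : (toScheme p X par).parentMap q n ω = par q n ω := by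
  rw [GAMS.Scheme.parentMap, h.newLabels_eq hN, if_pos hn]
  rfl

lemma disjoint_newAt (h : IsAMS p X par P π μ H) (hN : 0 < p.nrep) (q : ℕ) (ω : Ω) :
    Disjoint ((stateAt p X par q ω).on ∪ (stateAt p X par q ω).off) (newAt p X par q ω) :=
  p.disjoint_newLabels (h.valid hN q ω)

lemma parentMap_of_old (h : IsAMS p X par P π μ H) (hN : 0 < p.nrep) {q n : ℕ} {ω : Ω}
    (hn : n ∈ (stateAt p X par q ω).on ∪ (stateAt p X par q ω).off) :
    (toScheme p X par).parentMap q n ω = n := by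
  rw [GAMS.Scheme.parentMap, h.newLabels_eq hN, if_neg fun h1 =>
    Finset.disjoint_left.1 (h.disjoint_newAt hN q ω) hn h1, killed_eq, Finset.sdiff_empty]
  exact if_pos hn

lemma parentMap_of_notMem (h : IsAMS p X par P π μ H) (hN : 0 < p.nrep) {q n : ℕ} {ω : Ω}
    (hn : n ∉ newAt p X par q ω)
    (hn' : n ∉ (stateAt p X par q ω).on ∪ (stateAt p X par q ω).off) :
    (toScheme p X par).parentMap q n ω = 0 := by
  rw [GAMS.Scheme.parentMap, h.newLabels_eq hN, if_neg hn, killed_eq, Finset.sdiff_empty]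
  exact if_neg hn'

/-! ### Adaptedness -/

variable (h : IsAMS p X par P π μ H) (hA : MeasurableSet p.A) (hξ : Measurable p.ξ)
  (hk : 1 ≤ p.k)

include h hA hξ hk

lemma isMeasurable_stateAt (q : ℕ) : State.IsMeasurable (H q) (stateAt p X par q) := by
  induction q with
  | zero => exact ⟨measurable_const, measurable_const, fun _ => measurable_const⟩
  | succ q ih =>
    have hle : H q ≤ H (q + 1) := H.mono (Nat.le_succ q)
    exact p.isMeasurable_step hA hξ hk ⟨ih.on.mono hle le_rfl, ih.off.mono hle le_rfl,
      fun n => (ih.weight n).mono hle le_rfl⟩ (fun n => (h.X_adapted q n).mono hle le_rfl)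
      fun n => h.par_adapted q n

lemma measurable_levelAt (q : ℕ) : Measurable[H q] (levelAt p X par q) :=
  p.measurable_level_comp hA hξ hk (h.isMeasurable_stateAt hA hξ hk q).on (h.X_adapted q)

lemma measurable_onGtAt (q : ℕ) : Measurable[H q] (onGtAt p X par q) :=
  p.measurable_onGt hA hξ hk (h.isMeasurable_stateAt hA hξ hk q).on (h.X_adapted q)

lemma measurable_newAt (q : ℕ) : Measurable[H q] (newAt p X par q) :=
  p.measurable_newLabels hA hξ hk (h.isMeasurable_stateAt hA hξ hk q).on
    (h.isMeasurable_stateAt hA hξ hk q).off (h.X_adapted q)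

lemma measurable_labelsAt (q : ℕ) : Measurable[H q] fun ω =>
    (stateAt p X par q ω).on ∪ (stateAt p X par q ω).off :=
  measurable_finset_binop (h.isMeasurable_stateAt hA hξ hk q).on
    (h.isMeasurable_stateAt hA hξ hk q).off fun a b => a ∪ b

end IsAMS

end Run

end AMS

namespace AMS

namespace IsAMS

section Sampling

variable {S Ω : Type*} {p : Params S} {X : ℕ → ℕ → Ω → ℕ → S} {par : ℕ → ℕ → Ω → ℕ}
  [mΩ : MeasurableSpace Ω] [MeasurableSpace S] {P : Kernel S S} [IsMarkovKernel P]
  {π : Measure (ℕ → S)} {μ : Measure Ω} [IsProbabilityMeasure μ] {H : Filtration ℕ mΩ}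
  (h : IsAMS p X par P π μ H) (hA : MeasurableSet p.A) (hξ : Measurable p.ξ) (hk : 1 ≤ p.k)

include h hA hξ hk

/-! ### The law of the parents -/

lemma measurableSet_par_eq (q : ℕ) (a : ℕ → ℕ) :
    MeasurableSet {ω | ∀ n ∈ newAt p X par q ω, par q n ω = a n} :=
  measurableSet_forall_mem ((h.measurable_newAt hA hξ hk q).mono (H.le q) le_rfl) fun n =>
    ((h.par_adapted q n).mono (H.le _) le_rfl) (measurableSet_singleton (a n))

lemma lintegral_par_eq (q : ℕ) (a : ℕ → ℕ) {U : Ω → ℝ≥0∞} (hU : Measurable[H q] U) :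
    ∫⁻ ω in {ω | ∀ n ∈ newAt p X par q ω, par q n ω = a n}, U ω ∂μ =
      ∫⁻ ω, U ω * ∏ n ∈ newAt p X par q ω,
        (if a n ∈ onGtAt p X par q ω then ((onGtAt p X par q ω).card : ℝ≥0∞)⁻¹ else 0) ∂μ := by
  have hfin : ∀ ω n, (if a n ∈ onGtAt p X par q ω then
      ((onGtAt p X par q ω).card : ℝ≥0∞)⁻¹ else 0) ≠ ∞ := fun ω n => by
    split_ifs with h1
    · exact ENNReal.inv_ne_top.2 (by exact_mod_cast (Finset.card_pos.2 ⟨_, h1⟩).ne')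
    · exact ENNReal.zero_ne_top
  refine lintegral_mul_of_condExp (H.le q) (h.measurableSet_par_eq hA hξ hk q a) ?_
    (fun ω => ENNReal.prod_ne_top fun n _ => hfin ω n) ?_ hU
  · refine measurable_random_prod (h.measurable_newAt hA hξ hk q) fun n => ?_
    exact measurable_finset_op (h.measurable_onGtAt hA hξ hk q)
      fun t => if a n ∈ t then (t.card : ℝ≥0∞)⁻¹ else 0
  · refine (h.par_law q a).trans (ae_of_all _ fun ω => ?_)
    simp only [ENNReal.toReal_prod]
    refine Finset.prod_congr rfl fun n _ => ?_
    split_ifs <;> simp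

/-- Given the past, the parents are independent and uniform. -/
lemma lintegral_prod_par (q : ℕ) {U : Ω → ℝ≥0∞} (hU : Measurable[H q] U)
    {r : ℕ → ℕ → Ω → ℝ≥0∞} (hr : ∀ n j, Measurable[H q] (r n j)) :
    ∫⁻ ω, U ω * ∏ n ∈ newAt p X par q ω, r n (par q n ω) ω ∂μ =
      ∫⁻ ω, U ω * ∏ n ∈ newAt p X par q ω, ∑ j ∈ onGtAt p X par q ω,
        ((onGtAt p X par q ω).card : ℝ≥0∞)⁻¹ * r n j ω ∂μ := by
  have hV : Measurable[H q] fun ω => (newAt p X par q ω, onGtAt p X par q ω) :=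
    (h.measurable_newAt hA hξ hk q).prodMk (h.measurable_onGtAt hA hξ hk q)
  -- With the sets of new labels and of possible parents fixed, there are finitely many assignments
  -- of parents.
  refine lintegral_eq_of_fibers (hV.mono (H.le q) le_rfl) fun v => ?_
  obtain ⟨N, O⟩ := v
  set F : Set Ω := (fun ω => (newAt p X par q ω, onGtAt p X par q ω)) ⁻¹' {(N, O)} with hF
  have hFm : MeasurableSet[H q] F := hV (measurableSet_singleton _)
  have hFm' : MeasurableSet F := H.le q _ hFm
  have hmem : ∀ ω ∈ F, newAt p X par q ω = N ∧ onGtAt p X par q ω = O := fun ω hω => by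
    simpa [hF] using hω
  let ext : ((n : ℕ) → n ∈ N → ℕ) → ℕ → ℕ := fun a n => if hn : n ∈ N then a n hn else 0
  let T : ((n : ℕ) → n ∈ N → ℕ) → Ω → ℝ≥0∞ := fun a ω =>
    U ω * ∏ n ∈ N.attach, r n (a n n.2) ω
  let E : ((n : ℕ) → n ∈ N → ℕ) → Set Ω := fun a =>
    {ω | ∀ n ∈ newAt p X par q ω, par q n ω = ext a n}
  have hT : ∀ a, Measurable[H q] (T a) := fun a =>
    hU.mul (Finset.measurable_fun_prod _ fun n _ => hr _ _)
  have hE : ∀ a, MeasurableSet (E a) := fun a => h.measurableSet_par_eq hA hξ hk q (ext a)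
  -- Exactly one assignment occurs, the one given by `par`, so the sum over assignments has a single
  -- nonzero term.
  have h1 : ∀ ω ∈ F, U ω * ∏ n ∈ newAt p X par q ω, r n (par q n ω) ω =
      ∑ a ∈ N.pi fun _ => O, (E a).indicator (T a) ω := by
    intro ω hω
    obtain ⟨hN, hO⟩ := hmem ω hω
    have hp : ∀ n ∈ N, par q n ω ∈ O := fun n hn => by
      rw [← hO]; exact h.par_mem q ω n (by rwa [hN])
    rw [Finset.sum_eq_single fun n _ => par q n ω]
    · have : ω ∈ E fun n _ => par q n ω := fun n hn => by
        rw [hN] at hn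
        simp [ext, hn]
      rw [Set.indicator_of_mem this, hN]
      simp only [T]
      rw [← Finset.prod_attach]
    · intro a _ ha
      refine Set.indicator_of_notMem (fun hω' => ha ?_) _
      ext n hn
      have := hω' n (by rwa [hN])
      simpa [ext, hn] using this.symm
    · intro hn
      exact absurd (Finset.mem_pi.2 fun n hn => hp n hn) hn
  have h2 : ∀ ω ∈ F, U ω * ∏ n ∈ newAt p X par q ω, ∑ j ∈ onGtAt p X par q ω,
        ((onGtAt p X par q ω).card : ℝ≥0∞)⁻¹ * r n j ω =
      ∑ a ∈ N.pi fun _ => O, T a ω * ∏ _n ∈ N, (O.card : ℝ≥0∞)⁻¹ := by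
    intro ω hω
    obtain ⟨hN, hO⟩ := hmem ω hω
    -- Expanding the product of sums produces the same sum over assignments.
    rw [hN, hO, Finset.prod_sum, Finset.mul_sum]
    refine Finset.sum_congr rfl fun a _ => ?_
    rw [Finset.prod_mul_distrib, Finset.prod_const, Finset.prod_const, Finset.card_attach]
    simp only [T]
    ring
  have hL : ∀ a, Measurable ((E a).indicator (T a)) := fun a =>
    ((hT a).mono (H.le q) le_rfl).indicator (hE a)
  rw [setLIntegral_congr_fun hFm' h1, setLIntegral_congr_fun hFm' h2,
    lintegral_finsetSum _ fun a _ => hL a,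
    lintegral_finsetSum _ fun a _ => ((hT a).mono (H.le q) le_rfl).mul_const _]
  refine Finset.sum_congr rfl fun a ha => ?_
  have hUm : Measurable[H q] (F.indicator (T a)) := (hT a).indicator hFm
  have h3 := h.lintegral_par_eq hA hξ hk q (ext a) hUm
  rw [setLIntegral_indicator (hE a), Set.inter_comm, ← setLIntegral_indicator hFm', h3,
    ← lintegral_indicator hFm']
  refine lintegral_congr fun ω => ?_
  by_cases hω : ω ∈ F
  · obtain ⟨hN, hO⟩ := hmem ω hω
    rw [Set.indicator_of_mem hω, Set.indicator_of_mem hω, hN, hO]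
    congr 1
    refine Finset.prod_congr rfl fun n hn => ?_
    have : ext a n ∈ O := by
      simp only [ext, hn, dite_true]
      exact Finset.mem_pi.1 ha n hn
    rw [if_pos this]
  · simp [Set.indicator_of_notMem hω]

/-! ### The law of the new replicas -/

lemma iSup_comap_par_le (q : ℕ) : (⨆ n, MeasurableSpace.comap (par q n) ⊤) ≤ mΩ :=
  iSup_le fun n => ((h.par_adapted q n).mono (H.le _) le_rfl).comap_le

lemma measurableSet_new_mem (q : ℕ) {s : ℕ → Set (ℕ → S)} (hs : ∀ n, MeasurableSet (s n)) :
    MeasurableSet {ω | ∀ n ∈ newAt p X par q ω, X (q + 1) n ω ∈ s n} :=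
  measurableSet_forall_mem ((h.measurable_newAt hA hξ hk q).mono (H.le q) le_rfl) fun n =>
    ((h.X_adapted (q + 1) n).mono (H.le _) le_rfl) (hs n)

lemma measurable_resample_X (q j : ℕ) {s : Set (ℕ → S)} (hs : MeasurableSet s) :
    Measurable[H q] fun ω =>
      resample P p.A p.ξ (levelAt p X par q ω).toReal (X q j ω) s := by
  have h1 : Measurable[H q] fun ω => ((levelAt p X par q ω).toReal, X q j ω) :=
    (measurable_ereal_toReal.comp (h.measurable_levelAt hA hξ hk q)).prodMk (h.X_adapted q j)
  exact Measurable.comp (g := fun y : ℝ × (ℕ → S) => resampleKernel P hA hξ y s)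
    (f := fun ω => ((levelAt p X par q ω).toReal, X q j ω))
    ((resampleKernel P hA hξ).measurable_coe hs) h1

/-- Given the past, the new replicas are independent, with law the mean of the resampling laws
from the replicas above the level. -/
lemma lintegral_new_mem (q : ℕ) {s : ℕ → Set (ℕ → S)} (hs : ∀ n, MeasurableSet (s n))
    {U : Ω → ℝ≥0∞} (hU : Measurable[H q] U) :
    ∫⁻ ω in {ω | ∀ n ∈ newAt p X par q ω, X (q + 1) n ω ∈ s n}, U ω ∂μ =
      ∫⁻ ω, U ω * ∏ n ∈ newAt p X par q ω, ∑ j ∈ onGtAt p X par q ω,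
        ((onGtAt p X par q ω).card : ℝ≥0∞)⁻¹ *
          resample P p.A p.ξ (levelAt p X par q ω).toReal (X q j ω) (s n) ∂μ := by
  -- The average over uniform parents is turned back into an expression in the actual parents, where
  -- the conditional law of the new paths applies.
  rw [← h.lintegral_prod_par hA hξ hk q hU fun n j => h.measurable_resample_X hA hξ hk q j (hs n)]
  have hmle : H q ⊔ ⨆ n, MeasurableSpace.comap (par q n) ⊤ ≤ mΩ := sup_le (H.le q) (h.iSup_comap_par_le hA hξ hk q)
  have hHm : H q ≤ H q ⊔ ⨆ n, MeasurableSpace.comap (par q n) ⊤ := le_sup_left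
  have hpar : ∀ n, Measurable[H q ⊔ ⨆ n, MeasurableSpace.comap (par q n) ⊤] (par q n) := fun n =>
    (comap_measurable (par q n)).mono ((le_iSup (fun n => MeasurableSpace.comap (par q n) ⊤)
      n).trans le_sup_right) le_rfl
  have hprob := fun z => isProbabilityMeasure_resample P (A := p.A) (ξ := p.ξ) hA z
  refine lintegral_mul_of_condExp hmle (h.measurableSet_new_mem hA hξ hk q hs) ?_ ?_ ?_
    (hU.mono hHm le_rfl)
  · refine measurable_random_prod ((h.measurable_newAt hA hξ hk q).mono hHm le_rfl) fun n => ?_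
    exact measurable_comp_countable (F := fun j ω =>
        resample P p.A p.ξ (levelAt p X par q ω).toReal (X q j ω) (s n)) (hpar n)
      fun j => (h.measurable_resample_X hA hξ hk q j (hs n)).mono hHm le_rfl
  · exact fun ω => ENNReal.prod_ne_top fun n _ => measure_ne_top _ _
  · refine (h.new_law q s hs).trans (ae_of_all _ fun ω => ?_)
    simp only [ENNReal.toReal_prod]
    rfl

end Sampling

end IsAMS

end AMS

namespace AMS

/-! ### Configurations -/

/-- The data of an iteration that matter for the working replicas: the previous level, the labels
of the working and of the retired replicas, the common weight of the working replicas, and the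
working replicas. -/
abbrev Config (S : Type*) := (ℝ × Finset ℕ × Finset ℕ × ℝ) × (ℕ → ℕ → S)

namespace Config

variable {S : Type*}

/-- The state of the algorithm in the configuration `c`. -/
def state (c : Config S) : State := ⟨c.1.2.1, c.1.2.2.1, fun _ => c.1.2.2.2⟩

/-- The configuration `c` in which the replica `n` is replaced by `y`. -/
def replace (c : Config S) (n : ℕ) (y : ℕ → S) : Config S := (c.1, Function.update c.2 n y)

lemma replace_replace (c : Config S) (n : ℕ) (y w : ℕ → S) :
    (c.replace n y).replace n w = c.replace n w := by
  simp [replace]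

lemma replace_snd_self (c : Config S) (n : ℕ) (y : ℕ → S) : (c.replace n y).2 n = y := by
  simp [replace]

end Config

namespace Params

variable {S : Type*} (p : Params S)

section Congr

variable {s s' : State} {x x' : ℕ → ℕ → S}

lemma onGt_congr (hs : s.on = s'.on) (hx : ∀ n ∈ s.on, x n = x' n) :
    p.onGt s x = p.onGt s' x' := by
  have h1 := p.level_congr hx
  rw [onGt, onGt, ← hs, ← h1]
  exact Finset.filter_congr fun n hn => by rw [hx n hn]

lemma onLe_congr (hs : s.on = s'.on) (hx : ∀ n ∈ s.on, x n = x' n) :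
    p.onLe s x = p.onLe s' x' := by
  have h1 := p.level_congr hx
  rw [onLe, onLe, ← hs, ← h1]
  exact Finset.filter_congr fun n hn => by rw [hx n hn]

lemma newLabels_congr (hs : s.on = s'.on) (hs' : s.off = s'.off) (hx : ∀ n ∈ s.on, x n = x' n) :
    p.newLabels s x = p.newLabels s' x' := by
  rw [newLabels, newLabels, ← hs, ← hs', ← p.level_congr hx, p.onLe_congr hs hx]

end Congr

/-- Changing a replica after its entrance time above the current level does not change the
level. -/
lemma level_update (hk : 1 ≤ p.k) {on : Finset ℕ} {x : ℕ → ℕ → S} {n : ℕ} {y : ℕ → S}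
    (h : p.level on x ≠ ⊤) (hx : p.level on x < maxLevel p.A p.ξ (x n))
    (hy : p.level on x < maxLevel p.A p.ξ y) :
    p.level on (Function.update x n y) = p.level on x := by
  -- Counts below a threshold at most the level ignore the replica `n`, which is above the level
  -- before and after the change.
  have hfil : ∀ a ≤ p.level on x,
      (on.filter fun m => maxLevel p.A p.ξ (Function.update x n y m) ≤ a) =
        on.filter fun m => maxLevel p.A p.ξ (x m) ≤ a := by
    intro a ha
    refine Finset.filter_congr fun m _ => ?_
    by_cases hm : m = n
    · subst hm
      rw [Function.update_self]
      exact iff_of_false (not_le.2 (ha.trans_lt hy)) (not_le.2 (ha.trans_lt hx))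
    · rw [Function.update_of_ne hm]
  have hL := p.level_eq_orderStat h
  have h1 : orderStat p.k on (fun m => maxLevel p.A p.ξ (Function.update x n y m)) =
      p.level on x := by
    refine le_antisymm ?_ (not_lt.1 fun hlt => ?_)
    · rw [orderStat_le_iff hk _ _ h, hfil _ le_rfl, ← orderStat_le_iff hk _ _ h]
      exact hL.ge
    -- If the new order statistic were smaller, the same count at that smaller value would bound the
    -- old one.
    · have hb : orderStat p.k on (fun m => maxLevel p.A p.ξ (Function.update x n y m)) ≠ ⊤ :=
        hlt.ne_top
      have h2 := (orderStat_le_iff hk on _ hb).1 le_rfl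
      rw [hfil _ hlt.le, ← orderStat_le_iff hk _ _ hb, ← hL] at h2
      exact absurd hlt (not_lt.2 h2)
  have h3 := p.card_filter_ne h
  rw [level]
  simp only [h1]
  rw [hfil _ le_rfl, if_neg h3]

section Kernel

variable [MeasurableSpace S] (P : Kernel S S) [IsMarkovKernel P]

/-- The mean of the resampling laws from the replicas above the current level. -/
def meanLaw (c : Config S) : Measure (ℕ → S) :=
  ∑ j ∈ p.onGt c.state c.2, ((p.onGt c.state c.2).card : ℝ≥0∞)⁻¹ •
    resample P p.A p.ξ (p.level c.state.on c.2).toReal (c.2 j)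

lemma meanLaw_apply (c : Config S) (s : Set (ℕ → S)) : p.meanLaw P c s =
    ∑ j ∈ p.onGt c.state c.2, ((p.onGt c.state c.2).card : ℝ≥0∞)⁻¹ *
      resample P p.A p.ξ (p.level c.state.on c.2).toReal (c.2 j) s := by
  simp [meanLaw]

variable (hA : MeasurableSet p.A) (hξ : Measurable p.ξ) (hk : 1 ≤ p.k)

lemma measurable_config_on : Measurable fun c : Config S => c.state.on :=
  (measurable_fst.comp measurable_snd).comp measurable_fst

lemma measurable_config_off : Measurable fun c : Config S => c.state.off :=
  ((measurable_fst.comp measurable_snd).comp measurable_snd).comp measurable_fst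

lemma measurable_config_replica (n : ℕ) : Measurable fun c : Config S => c.2 n :=
  (measurable_pi_apply n).comp measurable_snd

include hA hξ hk

lemma measurable_config_level : Measurable fun c : Config S => p.level c.state.on c.2 :=
  p.measurable_level_comp hA hξ hk measurable_config_on measurable_config_replica

lemma measurable_config_onGt : Measurable fun c : Config S => p.onGt c.state c.2 :=
  p.measurable_onGt hA hξ hk measurable_config_on measurable_config_replica

lemma measurable_config_onLe : Measurable fun c : Config S => p.onLe c.state c.2 :=
  p.measurable_onLe hA hξ hk measurable_config_on measurable_config_replica

lemma measurable_config_newLabels : Measurable fun c : Config S => p.newLabels c.state c.2 :=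
  p.measurable_newLabels hA hξ hk measurable_config_on measurable_config_off
    measurable_config_replica

lemma measurable_config_resample (n : ℕ) : Measurable fun c : Config S =>
    resample P p.A p.ξ (p.level c.state.on c.2).toReal (c.2 n) := by
  have h1 : Measurable fun c : Config S => ((p.level c.state.on c.2).toReal, c.2 n) :=
    (measurable_ereal_toReal.comp (p.measurable_config_level hA hξ hk)).prodMk
      (measurable_config_replica n)
  exact Measurable.comp (g := fun y : ℝ × (ℕ → S) => resample P p.A p.ξ y.1 y.2)
    (f := fun c : Config S => ((p.level c.state.on c.2).toReal, c.2 n))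
    (measurable_resample P hA hξ) h1

lemma measurable_meanLaw : Measurable (p.meanLaw P) := by
  refine Measure.measurable_of_measurable_coe _ fun s hs => ?_
  simp_rw [meanLaw_apply]
  have hgt := p.measurable_config_onGt hA hξ hk
  refine measurable_random_sum hgt fun n => ?_
  exact (measurable_finset_op hgt fun t => (t.card : ℝ≥0∞)⁻¹).mul
    ((Measure.measurable_coe hs).comp (p.measurable_config_resample P hA hξ hk n))

/-- The mean of the resampling laws from the replicas above the current level, as a kernel. -/
def meanKernel : Kernel (Config S) (ℕ → S) := ⟨p.meanLaw P, p.measurable_meanLaw P hA hξ hk⟩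

-- In general only a sub-probability: the sum is empty when no replica is above the level.
omit hξ hk in
lemma meanLaw_le_one (c : Config S) (s : Set (ℕ → S)) : p.meanLaw P c s ≤ 1 := by
  have hprob := fun z => isProbabilityMeasure_resample P (A := p.A) (ξ := p.ξ) hA z
  rw [meanLaw_apply, ← Finset.mul_sum]
  calc ((p.onGt c.state c.2).card : ℝ≥0∞)⁻¹ * ∑ j ∈ p.onGt c.state c.2,
        resample P p.A p.ξ (p.level c.state.on c.2).toReal (c.2 j) s
      ≤ ((p.onGt c.state c.2).card : ℝ≥0∞)⁻¹ * ∑ j ∈ p.onGt c.state c.2, 1 := by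
        gcongr
        exact prob_le_one
    _ ≤ 1 := by
        rw [Finset.sum_const, nsmul_eq_mul, mul_one]
        exact ENNReal.inv_mul_le_one _

lemma isFiniteKernel_meanKernel : IsFiniteKernel (p.meanKernel P hA hξ hk) :=
  ⟨1, ENNReal.one_lt_top, fun c => p.meanLaw_le_one P hA c _⟩

end Kernel

/-! ### Stability of a configuration -/

section Stable

variable {p} {c : Config S} {n : ℕ} {y : ℕ → S} {t : ℕ}

/-- The path `y` agrees with the replica `n` of the configuration `c` up to the entrance
time of the latter above the current level, and this time is finite. -/
structure Stable (p : Params S) (c : Config S) (n : ℕ) (y : ℕ → S) (t : ℕ) : Prop where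
  k_pos : 1 ≤ p.k
  ne_top : p.level c.state.on c.2 ≠ ⊤
  levelTime_eq : levelTime p.A p.ξ (p.level c.state.on c.2).toReal (c.2 n) = t
  agree : AgreeUpTo t (c.2 n) y

namespace Stable

variable (h : Stable p c n y t)

include h

lemma levelTime_eq' : levelTime p.A p.ξ (p.level c.state.on c.2).toReal y = t :=
  h.agree.levelTime_eq h.levelTime_eq

lemma coe_level : ((p.level c.state.on c.2).toReal : EReal) = p.level c.state.on c.2 :=
  p.coe_toReal_level h.k_pos h.ne_top

lemma lt_maxLevel : p.level c.state.on c.2 < maxLevel p.A p.ξ (c.2 n) := by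
  rw [← h.coe_level, lt_maxLevel_iff_levelTime_ne_top, h.levelTime_eq]
  exact ENat.natCast_ne_top t

lemma lt_maxLevel' : p.level c.state.on c.2 < maxLevel p.A p.ξ y := by
  rw [← h.coe_level, lt_maxLevel_iff_levelTime_ne_top, h.levelTime_eq']
  exact ENat.natCast_ne_top t

lemma level_eq : p.level (c.replace n y).state.on (c.replace n y).2 = p.level c.state.on c.2 :=
  p.level_update h.k_pos h.ne_top h.lt_maxLevel h.lt_maxLevel'

lemma onGt_eq : p.onGt (c.replace n y).state (c.replace n y).2 = p.onGt c.state c.2 := by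
  rw [onGt, onGt, h.level_eq]
  refine Finset.filter_congr fun m _ => ?_
  by_cases hm : m = n
  · subst hm
    rw [Config.replace_snd_self]
    exact iff_of_true h.lt_maxLevel' h.lt_maxLevel
  · simp [Config.replace, Function.update_of_ne hm]

lemma onLe_eq : p.onLe (c.replace n y).state (c.replace n y).2 = p.onLe c.state c.2 := by
  rw [onLe, onLe, h.level_eq]
  refine Finset.filter_congr fun m _ => ?_
  by_cases hm : m = n
  · subst hm
    rw [Config.replace_snd_self]
    exact iff_of_false (not_le.2 h.lt_maxLevel') (not_le.2 h.lt_maxLevel)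
  · simp [Config.replace, Function.update_of_ne hm]

lemma newLabels_eq :
    p.newLabels (c.replace n y).state (c.replace n y).2 = p.newLabels c.state c.2 := by
  rw [newLabels, newLabels, h.level_eq, h.onLe_eq]
  rfl

lemma resample_eq [MeasurableSpace S] (P : Kernel S S) [IsMarkovKernel P]
    (hA : MeasurableSet p.A) :
    resample P p.A p.ξ (p.level c.state.on c.2).toReal y =
      resample P p.A p.ξ (p.level c.state.on c.2).toReal (c.2 n) :=
  (resample_congr P hA h.levelTime_eq h.agree).symm

/-- The law of the new replicas also reads the replica `n` only up to its entrance above the level.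
-/
lemma meanLaw_eq [MeasurableSpace S] (P : Kernel S S) [IsMarkovKernel P]
    (hA : MeasurableSet p.A) : p.meanLaw P (c.replace n y) = p.meanLaw P c := by
  rw [meanLaw, meanLaw, h.onGt_eq, h.level_eq]
  refine Finset.sum_congr rfl fun j _ => ?_
  by_cases hj : j = n
  · subst hj
    rw [Config.replace_snd_self, h.resample_eq P hA]
  · simp [Config.replace, Function.update_of_ne hj]

end Stable

end Stable

end Params

end AMS

namespace AMS

/-! ### Configurations along a run of the algorithm -/

section ConfigAt

variable {S Ω : Type*} (p : Params S) (X : ℕ → ℕ → Ω → ℕ → S) (par : ℕ → ℕ → Ω → ℕ) (x₀ : S)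

/-- The level of the previous iteration. Before the first iteration, it is a level below that
of the starting point. -/
def prevLevel : ℕ → Ω → ℝ
  | 0 => fun _ => p.ξ x₀ - 1
  | q + 1 => fun ω => (levelAt p X par q ω).toReal

/-- The iteration `q` is reached before the algorithm stops. -/
def Active : ℕ → Ω → Prop
  | 0 => fun _ => True
  | q + 1 => fun ω => ¬ (p.zmax : EReal) < levelAt p X par q ω

/-- The configuration of the working replicas at iteration `q`. -/
def configAt (q : ℕ) (ω : Ω) : Config S :=
  ((prevLevel p X par x₀ q ω, (stateAt p X par q ω).on, (stateAt p X par q ω).off,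
    (stateAt p X par q ω).mean p.nrep),
    fun n => if n ∈ (stateAt p X par q ω).on then X q n ω else fun _ => x₀)

variable {p X par x₀} {q n : ℕ} {ω : Ω}

lemma configAt_replica (hn : n ∈ (stateAt p X par q ω).on) :
    (configAt p X par x₀ q ω).2 n = X q n ω := if_pos hn

lemma level_configAt : p.level (configAt p X par x₀ q ω).state.on (configAt p X par x₀ q ω).2 =
    levelAt p X par q ω :=
  p.level_congr fun _ hn => configAt_replica hn

lemma onGt_configAt : p.onGt (configAt p X par x₀ q ω).state (configAt p X par x₀ q ω).2 =
    onGtAt p X par q ω :=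
  p.onGt_congr rfl fun _ hn => configAt_replica hn

lemma newLabels_configAt :
    p.newLabels (configAt p X par x₀ q ω).state (configAt p X par x₀ q ω).2 =
      newAt p X par q ω :=
  p.newLabels_congr rfl rfl fun _ hn => configAt_replica hn

lemma onLe_configAt : p.onLe (configAt p X par x₀ q ω).state (configAt p X par x₀ q ω).2 =
    p.onLe (stateAt p X par q ω) fun n => X q n ω :=
  p.onLe_congr rfl fun _ hn => configAt_replica hn

lemma meanLaw_configAt [MeasurableSpace S] (P : Kernel S S) [IsMarkovKernel P]
    (s : Set (ℕ → S)) : p.meanLaw P (configAt p X par x₀ q ω) s =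
      ∑ j ∈ onGtAt p X par q ω, ((onGtAt p X par q ω).card : ℝ≥0∞)⁻¹ *
        resample P p.A p.ξ (levelAt p X par q ω).toReal (X q j ω) s := by
  rw [p.meanLaw_apply, onGt_configAt, level_configAt]
  refine Finset.sum_congr rfl fun j hj => ?_
  rw [configAt_replica (p.onGt_subset hj)]

end ConfigAt

/-- The part of the path that is kept already contains a value above `z`. -/
lemma ae_lt_maxLevel_resample {S : Type*} [MeasurableSpace S] [MeasurableSingletonClass S]
    (P : Kernel S S) [IsMarkovKernel P] {A : Set S} {ξ : S → ℝ} (hA : MeasurableSet A) {z : ℝ}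
    {x : ℕ → S} (hx : (z : EReal) < maxLevel A ξ x) :
    ∀ᵐ y ∂resample P A ξ z x, (z : EReal) < maxLevel A ξ y := by
  obtain ⟨n, hn⟩ := exists_nat_of_ne_top (lt_maxLevel_iff_levelTime_ne_top.1 hx)
  filter_upwards [ae_agreeUpTo_resample P hA hn] with y hy
  rw [lt_maxLevel_iff_levelTime_ne_top, hy.levelTime_eq hn]
  exact ENat.natCast_ne_top n

lemma measurable_config {S Ω : Type*} [MeasurableSpace S] {m : MeasurableSpace Ω} {z : Ω → ℝ}
    {T T' : Ω → Finset ℕ} {w : Ω → ℝ} {X : ℕ → Ω → ℕ → S} (hz : Measurable z) (hT : Measurable T)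
    (hT' : Measurable T') (hw : Measurable w) (hX : ∀ n, Measurable (X n)) (x₀ : S) :
    Measurable fun ω => (((z ω, T ω, T' ω, w ω),
      fun n => if n ∈ T ω then X n ω else fun _ => x₀) : Config S) := by
  refine (hz.prodMk (hT.prodMk (hT'.prodMk hw))).prodMk (measurable_pi_lambda _ fun n => ?_)
  exact Measurable.ite (measurableSet_mem_finset hT n) (hX n) measurable_const

namespace IsAMS

section Sampling

variable {S Ω : Type*} {p : Params S} {X : ℕ → ℕ → Ω → ℕ → S} {par : ℕ → ℕ → Ω → ℕ}
  [mΩ : MeasurableSpace Ω] [MeasurableSpace S] {P : Kernel S S} [IsMarkovKernel P]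
  {π : Measure (ℕ → S)} {μ : Measure Ω} [IsProbabilityMeasure μ] {H : Filtration ℕ mΩ}
  (h : IsAMS p X par P π μ H) (hA : MeasurableSet p.A) (hξ : Measurable p.ξ) (hk : 1 ≤ p.k)
  (x₀ : S)

include h hA hξ hk

lemma measurable_prevLevel (q : ℕ) : Measurable[H q] (prevLevel p X par x₀ q) := by
  cases q with
  | zero => exact measurable_const
  | succ q =>
    exact (measurable_ereal_toReal.comp (h.measurable_levelAt hA hξ hk q)).mono
      (H.mono (Nat.le_succ q)) le_rfl

lemma measurableSet_run (q : ℕ) :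
    MeasurableSet[H q] {ω | ¬ (p.zmax : EReal) < levelAt p X par q ω} :=
  (measurableSet_lt measurable_const (h.measurable_levelAt hA hξ hk q)).compl

lemma measurable_configAt (q : ℕ) : Measurable[H q] (configAt p X par x₀ q) := by
  have hs := h.isMeasurable_stateAt hA hξ hk q
  exact measurable_config (h.measurable_prevLevel hA hξ hk x₀ q) hs.on hs.off
    ((measurable_random_sum hs.on hs.weight).div_const _) (fun n => h.X_adapted q n) x₀

lemma measurable_configAt' (q : ℕ) : Measurable (configAt p X par x₀ q) :=
  (h.measurable_configAt hA hξ hk x₀ q).mono (H.le q) le_rfl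

lemma measurable_X (q n : ℕ) : Measurable (X q n) := (h.X_adapted q n).mono (H.le q) le_rfl

lemma lintegral_new_mem' (q : ℕ) {s : ℕ → Set (ℕ → S)} (hs : ∀ n, MeasurableSet (s n))
    {U : Ω → ℝ≥0∞} (hU : Measurable[H q] U) :
    ∫⁻ ω in {ω | ∀ n ∈ newAt p X par q ω, X (q + 1) n ω ∈ s n}, U ω ∂μ =
      ∫⁻ ω, U ω * ∏ n ∈ newAt p X par q ω,
        p.meanLaw P (configAt p X par x₀ q ω) (s n) ∂μ := by
  rw [h.lintegral_new_mem hA hξ hk q hs hU]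
  simp_rw [meanLaw_configAt]

/-- The law of a new replica, given the past and the other new replicas. -/
lemma lintegral_new (q m : ℕ) {s : ℕ → Set (ℕ → S)} (hs : ∀ n, MeasurableSet (s n))
    {Ψ : Config S × (ℕ → S) → ℝ≥0∞} (hΨ : Measurable Ψ) :
    ∫⁻ ω in {ω | m ∈ newAt p X par q ω ∧
        ∀ n ∈ (newAt p X par q ω).erase m, X (q + 1) n ω ∈ s n},
      Ψ (configAt p X par x₀ q ω, X (q + 1) m ω) ∂μ =
    ∫⁻ ω in {ω | m ∈ newAt p X par q ω},
      (∏ n ∈ (newAt p X par q ω).erase m, p.meanLaw P (configAt p X par x₀ q ω) (s n)) *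
        ∫⁻ y, Ψ (configAt p X par x₀ q ω, y) ∂p.meanLaw P (configAt p X par x₀ q ω) ∂μ := by
  have hnew := h.measurable_newAt hA hξ hk q
  have hnew' := hnew.mono (H.le q) le_rfl
  have hW := h.measurable_configAt hA hξ hk x₀ q
  have hW' := h.measurable_configAt' hA hξ hk x₀ q
  have hXm := h.measurable_X hA hξ hk (q + 1)
  have hfin := p.isFiniteKernel_meanKernel P hA hξ hk
  set κ := p.meanKernel P hA hξ hk with hκ
  set M : Set Ω := {ω | m ∈ newAt p X par q ω} with hM
  have hMm : MeasurableSet[H q] M := measurableSet_mem_finset hnew m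
  have hMm' : MeasurableSet M := H.le q _ hMm
  have hEm : MeasurableSet {ω | ∀ n ∈ (newAt p X par q ω).erase m, X (q + 1) n ω ∈ s n} :=
    measurableSet_forall_mem (measurable_finset_op hnew' fun t => t.erase m) fun n =>
      hXm n (hs n)
  set E : Set Ω := {ω | m ∈ newAt p X par q ω ∧
        ∀ n ∈ (newAt p X par q ω).erase m, X (q + 1) n ω ∈ s n} with hE
  have hEm' : MeasurableSet E := hMm'.inter hEm
  have hterm : ∀ t, MeasurableSet t →
      Measurable[H q] fun ω => p.meanLaw P (configAt p X par x₀ q ω) t := fun t ht =>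
    ((Measure.measurable_coe ht).comp (p.measurable_meanLaw P hA hξ hk)).comp hW
  set ρ : Ω → ℝ≥0∞ := fun ω =>
    ∏ n ∈ (newAt p X par q ω).erase m, p.meanLaw P (configAt p X par x₀ q ω) (s n) with hρ
  have hρm : Measurable[H q] ρ :=
    measurable_random_prod (measurable_finset_op hnew fun t => t.erase m) fun n =>
      hterm _ (hs n)
  have hρm' : Measurable ρ := hρm.mono (H.le q) le_rfl
  have hρ1 : ∀ ω, ρ ω ≤ 1 := fun ω => Finset.prod_le_one' fun n _ => p.meanLaw_le_one P hA _ _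
  have hfd : IsFiniteMeasure ((μ.restrict M).withDensity ρ) := by
    refine isFiniteMeasure_withDensity (ne_top_of_le_ne_top (measure_ne_top (μ.restrict M)
      Set.univ) ?_)
    calc ∫⁻ ω, ρ ω ∂μ.restrict M ≤ ∫⁻ _, 1 ∂μ.restrict M := lintegral_mono hρ1
      _ = _ := by simp
  -- The joint law of the configuration and of the replica `m` on `E`: the other new replicas
  -- contribute the density `ρ`, and the replica `m` is drawn from the mean law. It suffices to
  -- check rectangles.
  have key : (μ.restrict E).map (fun ω => (configAt p X par x₀ q ω, X (q + 1) m ω)) =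
      (((μ.restrict M).withDensity ρ).map (configAt p X par x₀ q)) ⊗ₘ κ := by
    refine Measure.ext_prod fun {B t} hB ht => ?_
    have hB' : MeasurableSet[H q] (configAt p X par x₀ q ⁻¹' B) := hW hB
    -- The constraint `t` on the replica `m` is inserted in the family `s`, so that the product
    -- formula for all new replicas applies.
    have hs' : ∀ n, MeasurableSet (Function.update s m t n) := fun n => by
      by_cases hn : n = m
      · subst hn; rwa [Function.update_self]
      · rw [Function.update_of_ne hn]; exact hs n
    have h1 := h.lintegral_new_mem' hA hξ hk x₀ q hs'
      (U := (M ∩ configAt p X par x₀ q ⁻¹' B).indicator 1)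
      (measurable_indicator_one (hMm.inter hB'))
    rw [Measure.map_apply (hW'.prodMk (hXm m)) (hB.prod ht),
      Measure.restrict_apply ((hW'.prodMk (hXm m)) (hB.prod ht)),
      Measure.compProd_apply_prod hB ht,
      setLIntegral_map hB (κ.measurable_coe ht) hW',
      setLIntegral_withDensity_eq_setLIntegral_mul (g := fun ω => κ (configAt p X par x₀ q ω) t)
        _ hρm' ((κ.measurable_coe ht).comp hW') (H.le q _ hB'), Measure.restrict_restrict (H.le q _ hB')]
    rw [lintegral_indicator_one (H.le q _ (hMm.inter hB')), Measure.restrict_apply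
      (H.le q _ (hMm.inter hB'))] at h1
    have e1 : (fun ω => (configAt p X par x₀ q ω, X (q + 1) m ω)) ⁻¹' B ×ˢ t ∩ E =
        M ∩ configAt p X par x₀ q ⁻¹' B ∩
          {ω | ∀ n ∈ newAt p X par q ω, X (q + 1) n ω ∈ Function.update s m t n} := by
      ext ω
      simp only [Set.mem_inter_iff, Set.mem_preimage, Set.mem_prod, Set.mem_ofPred_eq, hE, hM,
        Finset.mem_erase]
      constructor
      · rintro ⟨⟨h2, h3⟩, h4, h5⟩
        refine ⟨⟨h4, h2⟩, fun n hn => ?_⟩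
        by_cases hnm : n = m
        · subst hnm; rwa [Function.update_self]
        · rw [Function.update_of_ne hnm]; exact h5 n ⟨hnm, hn⟩
      · rintro ⟨⟨h4, h2⟩, h5⟩
        refine ⟨⟨h2, ?_⟩, h4, fun n hn => ?_⟩
        · have := h5 m h4
          rwa [Function.update_self] at this
        · have := h5 n hn.2
          rwa [Function.update_of_ne hn.1] at this
    rw [e1, h1, Set.inter_comm _ M, ← lintegral_indicator (H.le q _ (hMm.inter hB'))]
    refine lintegral_congr fun ω => ?_
    by_cases hω : ω ∈ M ∩ configAt p X par x₀ q ⁻¹' B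
    · rw [Set.indicator_of_mem hω, Set.indicator_of_mem hω, ← Finset.mul_prod_erase _ _ hω.1,
        Function.update_self]
      simp only [Pi.one_apply, one_mul, Pi.mul_apply]
      rw [mul_comm, Finset.prod_congr rfl fun n hn => by
        rw [Function.update_of_ne (Finset.ne_of_mem_erase hn)]]
      rfl
    · rw [Set.indicator_of_notMem hω, Set.indicator_of_notMem hω, zero_mul]
  have hin : Measurable fun c => ∫⁻ y, Ψ (c, y) ∂κ c := hΨ.lintegral_kernel_prod_right'
  have h1 := congrArg (fun ν => ∫⁻ c, Ψ c ∂ν) key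
  rw [lintegral_map hΨ (hW'.prodMk (hXm m)), Measure.lintegral_compProd hΨ,
    lintegral_map hin hW', lintegral_withDensity_eq_lintegral_mul
      (g := fun ω => ∫⁻ y, Ψ (configAt p X par x₀ q ω, y) ∂κ (configAt p X par x₀ q ω)) _ hρm'
      (hin.comp hW')] at h1
  exact h1

/-! ### The new replicas are above the level -/

/-- Parents are strictly above the level, and a child keeps the path of its parent up to the first
value above it. -/
lemma ae_new_above [MeasurableSingletonClass S] (q : ℕ) :
    ∀ᵐ ω ∂μ, ∀ n ∈ newAt p X par q ω,
      levelAt p X par q ω < maxLevel p.A p.ξ (X (q + 1) n ω) := by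
  rw [ae_all_iff]
  intro m
  have x₀ : S := by
    have hne := μ.nonempty_of_neZero
    exact X 0 0 hne.some 0
  -- The exceptional pairs; the law of a single new replica gives them measure zero.
  set Q : Set (Config S × (ℕ → S)) :=
    {c | maxLevel p.A p.ξ c.2 ≤ p.level c.1.state.on c.1.2} with hQ
  have hQm : MeasurableSet Q := measurableSet_le
    ((measurable_maxLevel hA hξ).comp measurable_snd)
    ((p.measurable_config_level hA hξ hk).comp measurable_fst)
  have h1 := h.lintegral_new hA hξ hk x₀ q m (s := fun _ => Set.univ)
    (fun _ => MeasurableSet.univ) (measurable_indicator_one hQm)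
  have hMm : MeasurableSet {ω | m ∈ newAt p X par q ω} :=
    H.le q _ (measurableSet_mem_finset (h.measurable_newAt hA hξ hk q) m)
  have h2 : ∀ ω ∈ {ω | m ∈ newAt p X par q ω},
      (∏ n ∈ (newAt p X par q ω).erase m,
        p.meanLaw P (configAt p X par x₀ q ω) ((fun _ => Set.univ) n)) *
      ∫⁻ y, Q.indicator 1 (configAt p X par x₀ q ω, y)
        ∂p.meanLaw P (configAt p X par x₀ q ω) = 0 := by
    intro ω hω
    have hlev := p.coe_toReal_level (on := (stateAt p X par q ω).on)
      (x := fun n => X q n ω) hk (p.level_ne_top (not_lt_of_mem_newAt hω))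
    change ((levelAt p X par q ω).toReal : EReal) = levelAt p X par q ω at hlev
    have hQs : (fun y => Q.indicator (1 : Config S × (ℕ → S) → ℝ≥0∞)
        (configAt p X par x₀ q ω, y)) =
        Set.indicator {y | maxLevel p.A p.ξ y ≤ levelAt p X par q ω} 1 := by
      ext1 y
      simp only [Set.indicator, hQ, Set.mem_ofPred_eq, level_configAt, Pi.one_apply]
    have hQm' : MeasurableSet {y | maxLevel p.A p.ξ y ≤ levelAt p X par q ω} :=
      measurable_maxLevel hA hξ measurableSet_Iic
    rw [hQs, lintegral_indicator_one hQm', meanLaw_configAt, Finset.sum_eq_zero, mul_zero]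
    intro j hj
    have h3 : ((levelAt p X par q ω).toReal : EReal) < maxLevel p.A p.ξ (X q j ω) := by
      rw [hlev]
      exact (Finset.mem_filter.1 hj).2
    have h4 := ae_lt_maxLevel_resample P hA h3
    rw [hlev] at h4
    have h5 : resample P p.A p.ξ (levelAt p X par q ω).toReal (X q j ω)
        {y | maxLevel p.A p.ξ y ≤ levelAt p X par q ω} = 0 := by
      simpa [ae_iff] using h4
    rw [h5, mul_zero]
  rw [setLIntegral_congr_fun hMm h2, lintegral_zero] at h1
  have hg : Measurable fun ω => Q.indicator (1 : Config S × (ℕ → S) → ℝ≥0∞)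
      (configAt p X par x₀ q ω, X (q + 1) m ω) :=
    (measurable_indicator_one hQm).comp
      ((h.measurable_configAt' hA hξ hk x₀ q).prodMk (h.measurable_X hA hξ hk _ m))
  rw [lintegral_eq_zero_iff hg] at h1
  have hE : {ω | m ∈ newAt p X par q ω ∧ ∀ n ∈ (newAt p X par q ω).erase m,
      X (q + 1) n ω ∈ (fun _ => Set.univ : ℕ → Set (ℕ → S)) n} =
      {ω | m ∈ newAt p X par q ω} := by
    ext ω
    simp
  rw [hE] at h1
  have h3 := (ae_restrict_iff' hMm).1 h1
  filter_upwards [h3] with ω hω hm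
  by_contra hlt
  have h4 := hω hm
  have h5 : (configAt p X par x₀ q ω, X (q + 1) m ω) ∈ Q := by
    simp only [hQ, Set.mem_ofPred_eq, level_configAt]
    exact not_lt.1 hlt
  simp [Set.indicator_of_mem h5] at h4

/-- The working replicas are above the previous level. -/
lemma ae_on_above [MeasurableSingletonClass S] (hπ : π = cont P p.A 0 fun _ => x₀) (q : ℕ) :
    ∀ᵐ ω ∂μ, Active p X par q ω → ∀ n ∈ (stateAt p X par q ω).on,
      (prevLevel p X par x₀ q ω : EReal) < maxLevel p.A p.ξ (X q n ω) := by
  cases q with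
  | zero =>
    have h1 : ∀ n ∈ Finset.Icc 1 p.nrep, ∀ᵐ ω ∂μ, X 0 n ω 0 = x₀ := by
      intro n hn
      have h2 : ∀ᵐ y ∂μ.map (X 0 n), y 0 = x₀ := by
        rw [h.law_zero n hn, hπ]
        exact ae_start_cont P hA 0 _
      exact (ae_map_iff (h.measurable_X hA hξ hk 0 n).aemeasurable
        (measurableSet_start x₀)).1 h2
    have h2 : ∀ᵐ ω ∂μ, ∀ n, n ∈ Finset.Icc 1 p.nrep → X 0 n ω 0 = x₀ := by
      rw [ae_all_iff]
      intro n
      by_cases hn : n ∈ Finset.Icc 1 p.nrep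
      · filter_upwards [h1 n hn] with ω hω _ using hω
      · exact ae_of_all _ fun ω hn' => absurd hn' hn
    filter_upwards [h2] with ω hω _ n hn
    refine lt_maxLevel_iff.2 ⟨0, zero_le, ?_⟩
    rw [hω n hn]
    change ((p.ξ x₀ - 1 : ℝ) : EReal) < _
    exact_mod_cast sub_one_lt (p.ξ x₀)
  | succ q =>
    filter_upwards [h.ae_new_above hA hξ hk q] with ω hω hact n hn
    have hact' : ¬ (p.zmax : EReal) < p.level (stateAt p X par q ω).on (fun n => X q n ω) := hact
    have hlev : ((levelAt p X par q ω).toReal : EReal) = levelAt p X par q ω :=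
      p.coe_toReal_level hk (p.level_ne_top hact')
    rw [stateAt_succ, p.step_on hact'] at hn
    change ((levelAt p X par q ω).toReal : EReal) < _
    rw [hlev]
    rcases Finset.mem_union.1 hn with h1 | h1
    · rw [h.keep q ω n (Finset.mem_union_left _ (p.onGt_subset h1))]
      exact (Finset.mem_filter.1 h1).2
    · exact hω n h1

/-- All working replicas are strictly above the previous level, so the next order statistic is too.
-/
lemma ae_prevLevel_lt [MeasurableSingletonClass S] (hπ : π = cont P p.A 0 fun _ => x₀) (q : ℕ) :
    ∀ᵐ ω ∂μ, Active p X par q ω → (prevLevel p X par x₀ q ω : EReal) < levelAt p X par q ω := by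
  filter_upwards [h.ae_on_above hA hξ hk x₀ hπ q] with ω hω hact
  exact p.lt_level hk (hω hact)

lemma ae_levelAt_le_succ [MeasurableSingletonClass S] (q : ℕ) :
    ∀ᵐ ω ∂μ, levelAt p X par q ω ≤ levelAt p X par (q + 1) ω := by
  have x₀ : S := by
    have hne := μ.nonempty_of_neZero
    exact X 0 0 hne.some 0
  filter_upwards [h.ae_new_above hA hξ hk q] with ω hω
  by_cases hlt : (p.zmax : EReal) < levelAt p X par q ω
  · rw [h.levelAt_succ_of_lt hlt]
  · have hlev : ((levelAt p X par q ω).toReal : EReal) = levelAt p X par q ω :=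
      p.coe_toReal_level hk (p.level_ne_top hlt)
    rw [← hlev]
    refine (p.lt_level hk fun n hn => ?_).le
    rw [stateAt_succ, p.step_on hlt] at hn
    rw [hlev]
    rcases Finset.mem_union.1 hn with h1 | h1
    · rw [h.keep q ω n (Finset.mem_union_left _ (p.onGt_subset h1))]
      exact (Finset.mem_filter.1 h1).2
    · exact hω n h1

end Sampling

end IsAMS

end AMS

namespace AMS

/-! ### Invariance of a random configuration under the resampling of one replica -/

section Gibbs

variable {S Ω : Type*} [MeasurableSpace S] [MeasurableSpace Ω]

/-- On the event `E`, the law of the random configuration `W` is invariant when the replica `m` is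
replaced by a sample of `κ W`. -/
def GibbsOn (μ : Measure Ω) (E : Set Ω) (W : Ω → Config S) (κ : Config S → Measure (ℕ → S))
    (m : ℕ) : Prop :=
  ∀ f : Config S → ℝ≥0∞, Measurable f →
    ∫⁻ ω in E, f (W ω) ∂μ = ∫⁻ ω in E, ∫⁻ y, f ((W ω).replace m y) ∂κ (W ω) ∂μ

lemma measurable_replace (m : ℕ) :
    Measurable fun c : Config S × (ℕ → S) => c.1.replace m c.2 := by
  refine Measurable.prodMk (measurable_fst.comp measurable_fst) (measurable_pi_lambda _ fun n => ?_)
  by_cases hn : n = m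
  · subst hn
    simp only [Function.update_self]
    exact measurable_snd
  · simp only [Function.update_of_ne hn]
    exact (measurable_pi_apply n).comp (measurable_snd.comp measurable_fst)

lemma generateFrom_boxes : MeasurableSpace.generateFrom (Set.pi Set.univ '' Set.pi Set.univ
    fun _ : ℕ => {s : Set (ℕ → S) | MeasurableSet s}) = MeasurableSpace.pi := by
  refine le_antisymm (MeasurableSpace.generateFrom_le ?_) (iSup_le fun n => ?_)
  · rintro _ ⟨s, hs, rfl⟩
    exact MeasurableSet.univ_pi fun n => hs n trivial
  · rintro _ ⟨s, hs, rfl⟩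
    refine MeasurableSpace.measurableSet_generateFrom
      ⟨Function.update (fun _ => Set.univ) n s, fun j _ => ?_, ?_⟩
    · by_cases hj : j = n
      · subst hj; simpa using hs
      · simp [Function.update_of_ne hj]
    · ext x
      simp only [Set.mem_univ_pi, Set.mem_preimage]
      refine ⟨fun hx => by simpa using hx n, fun hx j => ?_⟩
      by_cases hj : j = n
      · subst hj; simpa using hx
      · simp [Function.update_of_ne hj]

/-- Boxes form a generating π-system. On a box, replacing the replica `m` leaves the constraints on
the other replicas and turns the one on `m` into the factor `κ (W ω) (s m)`. -/
lemma GibbsOn.of_boxes {μ : Measure Ω} [IsFiniteMeasure μ] {E : Set Ω}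
    {W : Ω → Config S} (hW : Measurable W) (κ : Kernel (Config S) (ℕ → S)) [IsMarkovKernel κ]
    {m : ℕ}
    (h : ∀ (G : Set (ℝ × Finset ℕ × Finset ℕ × ℝ)) (s : ℕ → Set (ℕ → S)), MeasurableSet G →
      (∀ n, MeasurableSet (s n)) →
      μ (E ∩ {ω | (W ω).1 ∈ G ∧ ∀ n, (W ω).2 n ∈ s n}) =
        ∫⁻ ω in E ∩ {ω | (W ω).1 ∈ G ∧ ∀ n ≠ m, (W ω).2 n ∈ s n}, κ (W ω) (s m) ∂μ) :
    GibbsOn μ E W κ m := by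
  have key : (μ.restrict E).map W =
      (((μ.restrict E).map W) ⊗ₘ κ).map fun c => c.1.replace m c.2 := by
    have hfin : IsFiniteMeasure ((μ.restrict E).map W) := inferInstance
    have hb : MeasurableSpace.generateFrom (Set.image2 (· ×ˢ ·) {G : Set (ℝ × Finset ℕ × Finset ℕ × ℝ) |
        MeasurableSet G} (Set.pi Set.univ '' Set.pi Set.univ fun _ : ℕ =>
          {s : Set (ℕ → S) | MeasurableSet s})) = Prod.instMeasurableSpace := by
      refine generateFrom_eq_prod MeasurableSpace.generateFrom_measurableSet generateFrom_boxes ?_ ?_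
      · exact ⟨fun _ => Set.univ, fun _ => Set.mem_ofPred_eq ▸ MeasurableSet.univ, Set.iUnion_const _⟩
      · exact ⟨fun _ => Set.univ, fun _ => ⟨fun _ => Set.univ, fun _ _ => Set.mem_ofPred_eq ▸ MeasurableSet.univ,
          Set.pi_univ _⟩, Set.iUnion_const _⟩
    have hu : ∀ ν : Measure (Config S), IsFiniteMeasure ν → (ν ⊗ₘ κ) Set.univ = ν Set.univ := by
      intro ν _
      rw [Measure.compProd_apply MeasurableSet.univ]
      simp
    refine ext_of_generate_finite _ hb.symm (MeasurableSpace.isPiSystem_measurableSet.prod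
      isPiSystem_pi) ?_ ?_
    · rintro _ ⟨G, hG, _, ⟨s, hs, rfl⟩, rfl⟩
      replace hs : ∀ n, MeasurableSet (s n) := fun n => hs n trivial
      replace hG : MeasurableSet G := hG
      have hbox : MeasurableSet (G ×ˢ Set.pi Set.univ s) :=
        MeasurableSet.prod hG (MeasurableSet.univ_pi hs)
      have hoff : MeasurableSet {c : Config S | c.1 ∈ G ∧ ∀ n ≠ m, c.2 n ∈ s n} := by
        have h2 : MeasurableSet (⋂ n, ⋂ (_ : n ≠ m), {c : Config S | c.2 n ∈ s n}) :=
          .iInter fun n => .iInter fun _ => (hs n).preimage (Params.measurable_config_replica n)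
        convert (hG.preimage measurable_fst).inter h2 using 1
        ext c
        simp
      rw [Measure.map_apply hW hbox, Measure.restrict_apply (hW hbox),
        Measure.map_apply (measurable_replace m) hbox,
        Measure.compProd_apply (measurable_replace m hbox),
        lintegral_map (Kernel.measurable_kernel_prodMk_left (measurable_replace m hbox)) hW]
      have hD := hW hoff
      have e1 : W ⁻¹' G ×ˢ Set.pi Set.univ s ∩ E =
          E ∩ {ω | (W ω).1 ∈ G ∧ ∀ n, (W ω).2 n ∈ s n} := by
        ext ω
        simp only [Set.mem_inter_iff, Set.mem_preimage, Set.mem_prod, Set.mem_univ_pi,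
          Set.mem_ofPred_eq]
        tauto
      rw [e1, h G s hG hs, Set.inter_comm]
      change ∫⁻ ω in W ⁻¹' {c : Config S | c.1 ∈ G ∧ ∀ n ≠ m, c.2 n ∈ s n} ∩ E, _ ∂μ = _
      rw [← Measure.restrict_restrict hD, ← lintegral_indicator hD]
      refine lintegral_congr fun ω => ?_
      by_cases hω : ω ∈ W ⁻¹' {c : Config S | c.1 ∈ G ∧ ∀ n ≠ m, c.2 n ∈ s n}
      · rw [Set.indicator_of_mem hω]
        congr 1
        ext y
        simp only [Set.mem_preimage, Set.mem_prod, Set.mem_univ_pi, Config.replace]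
        refine ⟨fun hy => ⟨hω.1, fun n => ?_⟩, fun hy => by simpa using hy.2 m⟩
        by_cases hn : n = m
        · subst hn; rwa [Function.update_self]
        · rw [Function.update_of_ne hn]; exact hω.2 n hn
      · rw [Set.indicator_of_notMem hω]
        rw [← measure_empty (μ := κ (W ω))]
        congr 1
        refine (Set.eq_empty_of_forall_notMem fun y hy => hω ?_).symm
        simp only [Set.mem_preimage, Set.mem_prod, Set.mem_univ_pi, Config.replace] at hy
        exact ⟨hy.1, fun n hn => by simpa [Function.update_of_ne hn] using hy.2 n⟩
    · rw [Measure.map_apply (measurable_replace m) MeasurableSet.univ, Set.preimage_univ,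
        hu _ hfin]
  intro f hf
  have h1 := congrArg (fun ν => ∫⁻ c, f c ∂ν) key
  have hf' := hf.comp (measurable_replace m)
  have h2 := Measure.lintegral_compProd (μ := (μ.restrict E).map W) (κ := κ) hf'
  have h3 := lintegral_map (μ := μ.restrict E) (Measurable.lintegral_kernel_prod_right' (κ := κ)
    hf') hW
  rw [lintegral_map hf hW, lintegral_map hf (measurable_replace m)] at h1
  exact h1.trans (h2.trans h3)

/-- The Markov property at a fixed time `t` under the resampling law from `z`. If `x` does not
exceed `z` by time `t`, neither does its resampled path, so `h` vanishes almost surely; otherwise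
the path was continued from a time at most `t`. -/
lemma lintegral_resample_mul_cont [MeasurableSingletonClass S] (P : Kernel S S) [IsMarkovKernel P]
    {A : Set S} {ξ : S → ℝ} (hA : MeasurableSet A) {z : ℝ} {t : ℕ} (x : ℕ → S)
    {h F : (ℕ → S) → ℝ≥0∞} (hh : Measurable h) (hF : Measurable F)
    (hdep : ∀ y y', AgreeUpTo t y y' → h y = h y')
    (hhit : ∀ y, h y ≠ 0 → (t : ℕ∞) ≤ hit A y ∧ levelTime A ξ z y ≤ t) :
    ∫⁻ y, h y * F y ∂resample P A ξ z x =
      ∫⁻ y, h y * ∫⁻ w, F w ∂cont P A t y ∂resample P A ξ z x := by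
  have hK : Measurable fun y => ∫⁻ w, F w ∂cont P A t y := by
    have := isMarkovKernel_cont P hA t
    exact hF.lintegral_kernel
  have hzero : (∀ᵐ y ∂resample P A ξ z x, h y = 0) →
      ∫⁻ y, h y * F y ∂resample P A ξ z x =
        ∫⁻ y, h y * ∫⁻ w, F w ∂cont P A t y ∂resample P A ξ z x := fun h0 =>
    lintegral_congr_ae (by filter_upwards [h0] with y hy; rw [hy, zero_mul, zero_mul])
  by_cases hx : levelTime A ξ z x = ⊤
  · refine hzero ?_
    rw [resample_of_eq_top P hx, ae_dirac_iff (p := fun y => h y = 0) (hh (measurableSet_singleton 0))]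
    by_contra h1
    have h2 := (hhit _ h1).2
    rw [levelTime_stopIn, hx] at h2
    exact absurd h2 (by simp)
  · obtain ⟨n, hn⟩ := exists_nat_of_ne_top hx
    rcases le_or_gt n t with hnt | hnt
    · rw [resample_of_eq_coe P hA hn]
      exact lintegral_cont_mul P hA hnt x hh hF hdep fun y hy => (hhit y hy).1
    · refine hzero ?_
      filter_upwards [ae_agreeUpTo_resample P hA hn] with y hy
      by_contra h1
      have h2 := (hhit _ h1).2
      rw [hy.levelTime_eq hn] at h2
      exact absurd hnt (not_lt.2 (by exact_mod_cast h2))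

variable (p : Params S) (P : Kernel S S) [IsMarkovKernel P]

/-- The resampling law of the replica `n` at the previous level. -/
def Params.prevLaw (n : ℕ) (c : Config S) : Measure (ℕ → S) :=
  resample P p.A p.ξ c.1.1 (c.2 n)

/-- The resampling law of the replica `n` at the current level. -/
def Params.curLaw (n : ℕ) (c : Config S) : Measure (ℕ → S) :=
  resample P p.A p.ξ (p.level c.state.on c.2).toReal (c.2 n)

/-- The configurations with `n` among the replicas above the current level, if the algorithm
has not stopped. -/
def Params.parentSet (n : ℕ) : Set (Config S) :=
  {c | ¬ (p.zmax : EReal) < p.level c.state.on c.2 ∧ n ∈ p.onGt c.state c.2}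

variable {p} (hA : MeasurableSet p.A) (hξ : Measurable p.ξ) (hk : 1 ≤ p.k)

include hA hξ hk

lemma measurableSet_parentSet (n : ℕ) : MeasurableSet (p.parentSet n) :=
  (measurableSet_lt measurable_const (p.measurable_config_level hA hξ hk)).compl.inter
    (measurableSet_mem_finset (p.measurable_config_onGt hA hξ hk) n)

/-- Passage from the previous level to the current, higher one. The current level is random and
depends on the replica `m` itself, but only up to its entrance time above that level. Conditionally
on this time, the future of `m` is a fresh continuation, to which the Markov property applies. -/
lemma GibbsOn.current [MeasurableSingletonClass S] {μ : Measure Ω} {E : Set Ω}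
    {W : Ω → Config S} (hW : Measurable W) {m : ℕ}
    (h : GibbsOn μ E W (p.prevLaw P m) m)
    (hlt : ∀ᵐ ω ∂μ, ω ∈ E → ((W ω).1.1 : EReal) < p.level (W ω).state.on (W ω).2) :
    GibbsOn μ (E ∩ W ⁻¹' p.parentSet m) W (p.curLaw P m) m := by
  intro f hf
  have hlev := p.measurable_config_level hA hξ hk
  have hrep : ∀ n, Measurable fun c : Config S => c.2 n := Params.measurable_config_replica
  have hT : Measurable fun c : Config S =>
      levelTime p.A p.ξ (p.level c.state.on c.2).toReal (c.2 m) :=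
    Measurable.comp (g := fun y : ℝ × (ℕ → S) => levelTime p.A p.ξ y.1 y.2)
      (f := fun c : Config S => ((p.level c.state.on c.2).toReal, c.2 m))
      (measurable_levelTime_prod hA hξ) ((measurable_ereal_toReal.comp hlev).prodMk (hrep m))
  have hQ0 := (measurableSet_parentSet hA hξ hk m)
  -- The two levels are ordered only almost surely along `W`; recording the order in `Q` makes it
  -- available for every modified configuration.
  set Q : Set (Config S) := p.parentSet m ∩ {c | c.1.1 ≤ (p.level c.state.on c.2).toReal} with hQ
  have hQm : MeasurableSet Q := hQ0.inter (measurableSet_le (measurable_fst.comp measurable_fst)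
    (measurable_ereal_toReal.comp hlev))
  have hset : (E ∩ W ⁻¹' p.parentSet m : Set Ω) =ᵐ[μ] (E ∩ W ⁻¹' Q : Set Ω) := by
    filter_upwards [hlt] with ω hω
    refine propext ⟨fun h1 => ⟨h1.1, h1.2, ?_⟩, fun h1 => ⟨h1.1, h1.2.1⟩⟩
    have h2 := (hω h1.1).le
    rw [← p.coe_toReal_level hk (p.level_ne_top h1.2.1)] at h2
    exact EReal.coe_le_coe_iff.1 h2
  have hstable : ∀ c ∈ p.parentSet m, ∀ t : ℕ, ∀ y,
      levelTime p.A p.ξ (p.level c.state.on c.2).toReal (c.2 m) = t →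
      AgreeUpTo t (c.2 m) y → p.Stable c m y t := fun c hc t y h1 h2 =>
    ⟨hk, p.level_ne_top hc.1, h1, h2⟩
  rw [Measure.restrict_congr_set hset]
  refine lintegral_eq_of_fibers (hT.comp hW) fun v => ?_
  have hQW := hQm.preimage hW
  have hv : MeasurableSet ((fun c : Config S =>
      levelTime p.A p.ξ (p.level c.state.on c.2).toReal (c.2 m)) ⁻¹' {v}) :=
    hT (measurableSet_singleton v)
  -- The configurations of `Q` in which `m` enters above the current level at the time `v`.
  set C : Set (Config S) := (fun c : Config S =>
      levelTime p.A p.ξ (p.level c.state.on c.2).toReal (c.2 m)) ⁻¹' {v} ∩ Q with hC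
  have hCm : MeasurableSet C := hv.inter hQm
  have hrestr : ∀ g : Ω → ℝ≥0∞,
      ∫⁻ ω in ((fun c : Config S =>
        levelTime p.A p.ξ (p.level c.state.on c.2).toReal (c.2 m)) ∘ W) ⁻¹' {v}, g ω
          ∂μ.restrict (E ∩ W ⁻¹' Q) = ∫⁻ ω in E, (W ⁻¹' C).indicator g ω ∂μ := by
    intro g
    rw [Set.preimage_comp, Measure.restrict_restrict (hv.preimage hW), lintegral_indicator (hCm.preimage hW),
      Measure.restrict_restrict (hCm.preimage hW)]
    congr 2
    ext ω
    simp only [hC, Set.mem_inter_iff, Set.mem_preimage]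
    tauto
  rw [hrestr, hrestr]
  by_cases hvt : v = ⊤
  · have hempty : C = ∅ := by
      refine Set.eq_empty_of_forall_notMem fun c hc => ?_
      have h1 : p.level c.state.on c.2 < maxLevel p.A p.ξ (c.2 m) :=
        (Finset.mem_filter.1 hc.2.1.2).2
      rw [← p.coe_toReal_level hk (p.level_ne_top hc.2.1.1),
        lt_maxLevel_iff_levelTime_ne_top] at h1
      exact h1 (hc.1.trans hvt)
    simp [hempty]
  obtain ⟨t, rfl⟩ := exists_nat_of_ne_top hvt
  have := isMarkovKernel_cont P hA t
  -- the mean over the continuations after time `t`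
  set g : Config S → ℝ≥0∞ := fun c => ∫⁻ w, f (c.replace m w) ∂cont P p.A t (c.2 m) with hg
  have hgm : Measurable g := by
    have h1 : Measurable fun c : Config S × (ℕ → S) => f (c.1.replace m c.2) :=
      hf.comp (measurable_replace m)
    exact Measurable.lintegral_kernel_prod_right'
      (κ := (cont P p.A t).comap (fun c : Config S => c.2 m) (hrep m)) h1
  have hl : ∀ ω, (W ⁻¹' C).indicator (fun ω => f (W ω)) ω = C.indicator f (W ω) := fun ω => rfl
  have hr : ∀ ω, (W ⁻¹' C).indicator
      (fun ω => ∫⁻ y, f ((W ω).replace m y) ∂p.curLaw P m (W ω)) ω = C.indicator g (W ω) := by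
    intro ω
    by_cases hω : W ω ∈ C
    · rw [Set.indicator_of_mem hω, Set.indicator_of_mem (show ω ∈ W ⁻¹' C from hω), hg,
        Params.curLaw, resample_of_eq_coe P hA hω.1]
    · rw [Set.indicator_of_notMem hω, Set.indicator_of_notMem (show ω ∉ W ⁻¹' C from hω)]
  simp_rw [hl, hr]
  -- The hypothesis is applied to both sides: for fixed `ω` it remains to compare two integrals
  -- under resampling of `m` from the previous level.
  rw [h _ (hf.indicator hCm), h _ (hgm.indicator hCm)]
  refine lintegral_congr fun ω => ?_
  have hCrep : Measurable fun y => C.indicator (1 : Config S → ℝ≥0∞) ((W ω).replace m y) :=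
    (measurable_indicator_one hCm).comp ((measurable_replace m).comp measurable_prodMk_left)
  have hfrep : Measurable fun y => f ((W ω).replace m y) :=
    hf.comp ((measurable_replace m).comp measurable_prodMk_left)
  -- Membership in `C` is read from the replica `m` up to time `t`: by stability, a change after `t`
  -- alters neither the level nor the set of parents.
  have htrans : ∀ y y', AgreeUpTo t y y' → (W ω).replace m y ∈ C → (W ω).replace m y' ∈ C := by
    intro y y' hy hmem
    have h1 : p.Stable ((W ω).replace m y) m y' t := hstable _ hmem.2.1 t y' hmem.1
      (by rwa [Config.replace_snd_self])
    have h2 := h1.level_eq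
    have h3 := h1.onGt_eq
    rw [Config.replace_replace] at h2 h3
    refine ⟨?_, ⟨?_, ?_⟩, ?_⟩
    · have h4 := h1.levelTime_eq'
      rw [← h2] at h4
      simp only [Set.mem_preimage, Set.mem_singleton_iff, Config.replace_snd_self]
      exact h4
    · rw [h2]; exact hmem.2.1.1
    · rw [h3]; exact hmem.2.1.2
    · change (W ω).1.1 ≤ _
      rw [h2]; exact hmem.2.2
  have key := lintegral_resample_mul_cont P (A := p.A) (ξ := p.ξ) hA (z := (W ω).1.1) (t := t)
    ((W ω).2 m) hCrep hfrep (fun y y' hy => ?_) (fun y hy => ?_)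
  · have e1 : ∀ y, C.indicator f ((W ω).replace m y) =
        C.indicator 1 ((W ω).replace m y) * f ((W ω).replace m y) := fun y => by
      by_cases hy : (W ω).replace m y ∈ C
      · simp [Set.indicator_of_mem hy]
      · simp [Set.indicator_of_notMem hy]
    have e2 : ∀ y, C.indicator g ((W ω).replace m y) = C.indicator 1 ((W ω).replace m y) *
        ∫⁻ w, f ((W ω).replace m w) ∂cont P p.A t y := fun y => by
      by_cases hy : (W ω).replace m y ∈ C
      · rw [Set.indicator_of_mem hy, Set.indicator_of_mem hy, Pi.one_apply, one_mul, hg]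
        simp only [Config.replace_replace, Config.replace_snd_self]
      · simp [Set.indicator_of_notMem hy]
    simp_rw [e1, e2]
    exact key
  · by_cases h1 : (W ω).replace m y ∈ C
    · rw [Set.indicator_of_mem h1, Set.indicator_of_mem (htrans y y' hy h1)]
      rfl
    · rw [Set.indicator_of_notMem h1, Set.indicator_of_notMem fun h2 => h1 (htrans y' y hy.symm h2)]
  · have h1 : (W ω).replace m y ∈ C := Set.mem_of_indicator_ne_zero hy
    have h2 : levelTime p.A p.ξ (p.level ((W ω).replace m y).state.on
        ((W ω).replace m y).2).toReal y = t := by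
      have := h1.1
      simpa only [Set.mem_preimage, Set.mem_singleton_iff, Config.replace_snd_self] using this
    exact ⟨le_hit_of_levelTime_eq h2, h2 ▸ levelTime_mono h1.2.2⟩

end Gibbs

end AMS

namespace AMS

lemma GibbsOn.union {S Ω : Type*} [MeasurableSpace S] [MeasurableSpace Ω] {μ : Measure Ω}
    {E E' : Set Ω} {W : Ω → Config S} {κ : Config S → Measure (ℕ → S)} {m : ℕ}
    (h : GibbsOn μ E W κ m) (h' : GibbsOn μ E' W κ m) (hE' : MeasurableSet E')
    (hd : Disjoint E E') : GibbsOn μ (E ∪ E') W κ m := fun f hf => by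
  rw [lintegral_union hE' hd, lintegral_union hE' hd, h f hf, h' f hf]

/-! ### The next configuration as a function of the current one -/

section Next

variable {S : Type*} (p : Params S)

/-- The data of the configuration at the next iteration, apart from the replicas. -/
def Params.nextData (c : Config S) : ℝ × Finset ℕ × Finset ℕ × ℝ :=
  ((p.level c.state.on c.2).toReal, p.onGt c.state c.2 ∪ p.newLabels c.state c.2,
    c.state.off ∪ p.onLe c.state c.2, p.factor c.state c.2 * c.1.2.2.2)

/-- The condition on the current configuration for the next one to be in a box. -/
def Params.nextBox (x₀ : S) (G : Set (ℝ × Finset ℕ × Finset ℕ × ℝ)) (s : ℕ → Set (ℕ → S)) :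
    Set (Config S) :=
  {c | p.nextData c ∈ G ∧ ∀ n, n ∈ p.onGt c.state c.2 ∧ c.2 n ∈ s n ∨
    n ∉ p.onGt c.state c.2 ∧ (n ∈ p.newLabels c.state c.2 ∨ (fun _ => x₀) ∈ s n)}

variable {p}

lemma Params.Stable.nextData_eq {c : Config S} {n : ℕ} {y : ℕ → S} {t : ℕ}
    (h : p.Stable c n y t) : p.nextData (c.replace n y) = p.nextData c := by
  rw [nextData, nextData, h.level_eq, h.onGt_eq, h.onLe_eq, h.newLabels_eq, factor, factor,
    h.onLe_eq]
  rfl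

/-- A parent redrawn after its entrance time changes only its own coordinate in the next
configuration, so the constraint on it separates from the rest. -/
lemma Params.Stable.mem_nextBox {c : Config S} {n : ℕ} {y : ℕ → S} {t : ℕ} {x₀ : S}
    {G : Set (ℝ × Finset ℕ × Finset ℕ × ℝ)} {s : ℕ → Set (ℕ → S)}
    (h : p.Stable c n y t) (hn : n ∈ p.onGt c.state c.2) :
    c.replace n y ∈ p.nextBox x₀ G s ↔
      c ∈ p.nextBox x₀ G (Function.update s n Set.univ) ∧ y ∈ s n := by
  simp only [nextBox, Set.mem_ofPred_eq, h.nextData_eq, h.onGt_eq, h.newLabels_eq]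
  constructor
  · rintro ⟨h1, h2⟩
    refine ⟨⟨h1, fun j => ?_⟩, ?_⟩
    · by_cases hj : j = n
      · subst hj
        simp [hn]
      · simpa [Config.replace, Function.update_of_ne hj] using h2 j
    · simpa [hn, Config.replace] using h2 n
  · rintro ⟨⟨h1, h2⟩, h3⟩
    refine ⟨h1, fun j => ?_⟩
    by_cases hj : j = n
    · subst hj
      simp [hn, Config.replace, h3]
    · simpa [Config.replace, Function.update_of_ne hj] using h2 j

/-- A new label puts no condition on the current configuration, since its replica is yet to be
drawn. -/
lemma Params.mem_nextBox_update {c : Config S} {n : ℕ} {x₀ : S}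
    {G : Set (ℝ × Finset ℕ × Finset ℕ × ℝ)} {s : ℕ → Set (ℕ → S)}
    (hn : n ∉ p.onGt c.state c.2) (hn' : n ∈ p.newLabels c.state c.2) :
    c ∈ p.nextBox x₀ G (Function.update s n Set.univ) ↔ c ∈ p.nextBox x₀ G s := by
  refine and_congr_right fun _ => forall_congr' fun j => ?_
  by_cases hj : j = n
  · subst hj
    simp [hn, hn']
  · rw [Function.update_of_ne hj]

variable [MeasurableSpace S]

/-- Under the current resampling law of a parent, the condition on the rest of the box and the laws
of the new replicas are constant; only the constraint `s m` is integrated. -/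
lemma Params.lintegral_replace_nextBox [MeasurableSingletonClass S] (P : Kernel S S)
    [IsMarkovKernel P] (hA : MeasurableSet p.A) (hk : 1 ≤ p.k) {x₀ : S}
    {G : Set (ℝ × Finset ℕ × Finset ℕ × ℝ)} {s : ℕ → Set (ℕ → S)} {c : Config S} {m : ℕ}
    (hs : MeasurableSet (s m)) (hc : c ∈ p.parentSet m) :
    ∫⁻ y, (p.nextBox x₀ G s).indicator (fun c => ∏ n ∈ p.newLabels c.state c.2,
        p.meanLaw P c (s n)) (c.replace m y) ∂p.curLaw P m c =
      (p.nextBox x₀ G (Function.update s m Set.univ)).indicator (fun c => p.curLaw P m c (s m) *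
        ∏ n ∈ p.newLabels c.state c.2, p.meanLaw P c (s n)) c := by
  have h1 : p.level c.state.on c.2 < maxLevel p.A p.ξ (c.2 m) := (Finset.mem_filter.1 hc.2).2
  rw [← p.coe_toReal_level hk (p.level_ne_top hc.1), lt_maxLevel_iff_levelTime_ne_top] at h1
  obtain ⟨t, ht⟩ := exists_nat_of_ne_top h1
  have h2 : ∀ᵐ y ∂p.curLaw P m c, (p.nextBox x₀ G s).indicator
      (fun c => ∏ n ∈ p.newLabels c.state c.2, p.meanLaw P c (s n)) (c.replace m y) =
      (s m).indicator (fun _ => (p.nextBox x₀ G (Function.update s m Set.univ)).indicator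
        (fun c => ∏ n ∈ p.newLabels c.state c.2, p.meanLaw P c (s n)) c) y := by
    filter_upwards [ae_agreeUpTo_resample P hA ht] with y hy
    have hst : p.Stable c m y t := ⟨hk, p.level_ne_top hc.1, ht, hy⟩
    by_cases h3 : c ∈ p.nextBox x₀ G (Function.update s m Set.univ)
    · by_cases h4 : y ∈ s m
      · rw [Set.indicator_of_mem ((hst.mem_nextBox hc.2).2 ⟨h3, h4⟩), Set.indicator_of_mem h4,
          Set.indicator_of_mem h3, hst.newLabels_eq, hst.meanLaw_eq P hA]
      · rw [Set.indicator_of_notMem fun h5 => h4 ((hst.mem_nextBox hc.2).1 h5).2,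
          Set.indicator_of_notMem h4]
    · rw [Set.indicator_of_notMem fun h5 => h3 ((hst.mem_nextBox hc.2).1 h5).1]
      simp [Set.indicator_of_notMem h3]
  rw [lintegral_congr_ae h2, lintegral_indicator_const hs]
  by_cases h3 : c ∈ p.nextBox x₀ G (Function.update s m Set.univ)
  · rw [Set.indicator_of_mem h3, Set.indicator_of_mem h3, mul_comm]
  · rw [Set.indicator_of_notMem h3, Set.indicator_of_notMem h3, zero_mul]

lemma Params.measurableSet_nextBox (hA : MeasurableSet p.A) (hξ : Measurable p.ξ) (hk : 1 ≤ p.k)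
    (x₀ : S) {G : Set (ℝ × Finset ℕ × Finset ℕ × ℝ)} (hG : MeasurableSet G)
    {s : ℕ → Set (ℕ → S)} (hs : ∀ n, MeasurableSet (s n)) :
    MeasurableSet (p.nextBox x₀ G s) := by
  have hlev := p.measurable_config_level hA hξ hk
  have hgt := p.measurable_config_onGt hA hξ hk
  have hnew := p.measurable_config_newLabels hA hξ hk
  have hle := p.measurable_config_onLe hA hξ hk
  have hdata : Measurable p.nextData := by
    refine (measurable_ereal_toReal.comp hlev).prodMk
      ((measurable_finset_binop hgt hnew fun a b => a ∪ b).prodMk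
      ((measurable_finset_binop measurable_config_off hle fun a b => a ∪ b).prodMk ?_))
    have hw : Measurable fun c : Config S => c.1.2.2.2 :=
      ((measurable_snd.comp measurable_snd).comp measurable_snd).comp measurable_fst
    exact (measurable_finset_op hle fun a => ((p.nrep : ℝ) - a.card) / p.nrep).mul hw
  have h1 : ∀ n, MeasurableSet {c : Config S | n ∈ p.onGt c.state c.2 ∧ c.2 n ∈ s n ∨
      n ∉ p.onGt c.state c.2 ∧ (n ∈ p.newLabels c.state c.2 ∨ (fun _ => x₀) ∈ s n)} := fun n =>
    ((measurableSet_mem_finset hgt n).inter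
      ((hs n).preimage (measurable_config_replica n))).union
    ((measurableSet_mem_finset hgt n).compl.inter
      ((measurableSet_mem_finset hnew n).union (MeasurableSet.const _)))
  have h2 := (hG.preimage hdata).inter (MeasurableSet.iInter h1)
  convert h2 using 1
  ext c
  simp [nextBox]

/-- Resampling twice from the same level amounts to resampling once. -/
lemma lintegral_resample_resample [MeasurableSingletonClass S] (P : Kernel S S) [IsMarkovKernel P] {A : Set S}
    {ξ : S → ℝ} (hA : MeasurableSet A) (hξ : Measurable ξ) (z : ℝ) (x : ℕ → S)
    {F : (ℕ → S) → ℝ≥0∞} (hF : Measurable F) :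
    ∫⁻ y, ∫⁻ w, F w ∂resample P A ξ z y ∂resample P A ξ z x = ∫⁻ y, F y ∂resample P A ξ z x := by
  have h1 := lintegral_resample_mul P hA hξ le_rfl x (z' := z) (z := z) (h := fun _ => 1)
    measurable_const hF
  simpa using h1.symm

/-- The resampling law of the replica `n` at the previous level, as a kernel. -/
def Params.prevKernel (P : Kernel S S) [IsMarkovKernel P]
    (hA : MeasurableSet p.A) (hξ : Measurable p.ξ) (n : ℕ) : Kernel (Config S) (ℕ → S) :=
  (resampleKernel P hA hξ).comap (fun c : Config S => (c.1.1, c.2 n))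
    ((measurable_fst.comp measurable_fst).prodMk (Params.measurable_config_replica n))

instance (P : Kernel S S) [IsMarkovKernel P] (hA : MeasurableSet p.A) (hξ : Measurable p.ξ)
    (n : ℕ) : IsMarkovKernel (Params.prevKernel P hA hξ n) := by
  unfold Params.prevKernel; infer_instance

end Next

namespace IsAMS

/-! ### The invariance under resampling, by induction on the iterations -/

section Invariance

variable {S Ω : Type*} {p : Params S} {X : ℕ → ℕ → Ω → ℕ → S} {par : ℕ → ℕ → Ω → ℕ}
  [mΩ : MeasurableSpace Ω] [MeasurableSpace S] [MeasurableSingletonClass S] {P : Kernel S S}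
  [IsMarkovKernel P] {π : Measure (ℕ → S)} {μ : Measure Ω} [IsProbabilityMeasure μ]
  {H : Filtration ℕ mΩ} (h : IsAMS p X par P π μ H) (hA : MeasurableSet p.A)
  (hξ : Measurable p.ξ) (hk : 1 ≤ p.k) (hN : 0 < p.nrep) (x₀ : S)
  (hπ : π = cont P p.A 0 fun _ => x₀)

include h hA hξ hk hN

/-- Survivors keep their path, new labels receive a fresh one, and the remaining coordinates carry
the constant path `x₀`. -/
lemma configAt_succ_mem_box_iff {q : ℕ} {ω : Ω} (hrun : ¬ (p.zmax : EReal) < levelAt p X par q ω)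
    {G : Set (ℝ × Finset ℕ × Finset ℕ × ℝ)} {s : ℕ → Set (ℕ → S)} :
    ((configAt p X par x₀ (q + 1) ω).1 ∈ G ∧ ∀ n, (configAt p X par x₀ (q + 1) ω).2 n ∈ s n) ↔
      configAt p X par x₀ q ω ∈ p.nextBox x₀ G s ∧
        ∀ n ∈ newAt p X par q ω, X (q + 1) n ω ∈ s n := by
  have hv := h.valid hN q ω
  have hdis := p.disjoint_onGt_newLabels (x := fun n => X q n ω) hv
  have hrun' : ¬ (p.zmax : EReal) < p.level (stateAt p X par q ω).on fun n => X q n ω := hrun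
  have hdata : (configAt p X par x₀ (q + 1) ω).1 = p.nextData (configAt p X par x₀ q ω) := by
    have e1 := level_configAt (p := p) (X := X) (par := par) (x₀ := x₀) (q := q) (ω := ω)
    have e2 := onGt_configAt (p := p) (X := X) (par := par) (x₀ := x₀) (q := q) (ω := ω)
    have e3 := onLe_configAt (p := p) (X := X) (par := par) (x₀ := x₀) (q := q) (ω := ω)
    have e4 := newLabels_configAt (p := p) (X := X) (par := par) (x₀ := x₀) (q := q) (ω := ω)
    rw [Params.nextData, Params.factor, e1, e2, e3, e4]
    change ((levelAt p X par q ω).toReal, (stateAt p X par (q + 1) ω).on,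
      (stateAt p X par (q + 1) ω).off, (stateAt p X par (q + 1) ω).mean p.nrep) = _
    rw [stateAt_succ, p.mean_step hv hN hrun' (h.par_mem q ω), p.step_on hrun', p.step_off hrun']
    rfl
  have hrep : ∀ n, (configAt p X par x₀ (q + 1) ω).2 n =
      if n ∈ onGtAt p X par q ω then (configAt p X par x₀ q ω).2 n
      else if n ∈ newAt p X par q ω then X (q + 1) n ω else fun _ => x₀ := by
    intro n
    have hon : (stateAt p X par (q + 1) ω).on = onGtAt p X par q ω ∪ newAt p X par q ω := by
      rw [stateAt_succ, p.step_on hrun']; rfl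
    by_cases h1 : n ∈ onGtAt p X par q ω
    · rw [if_pos h1, configAt_replica (p.onGt_subset h1),
        configAt_replica (hon ▸ Finset.mem_union_left _ h1)]
      exact h.keep q ω n (Finset.mem_union_left _ (p.onGt_subset h1))
    · rw [if_neg h1]
      by_cases h2 : n ∈ newAt p X par q ω
      · rw [if_pos h2, configAt_replica (hon ▸ Finset.mem_union_right _ h2)]
      · rw [if_neg h2]
        have h3 : n ∉ (stateAt p X par (q + 1) ω).on := by
          rw [hon, Finset.mem_union]
          tauto
        exact if_neg h3
  rw [hdata, Params.nextBox, Set.mem_ofPred_eq, onGt_configAt, newLabels_configAt, and_assoc]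
  refine and_congr_right fun _ => ?_
  rw [← forall_and]
  refine forall_congr' fun n => ?_
  rw [hrep n]
  have h1 : n ∈ onGtAt p X par q ω → n ∉ newAt p X par q ω := fun a b =>
    Finset.disjoint_left.1 hdis a b
  by_cases h2 : n ∈ onGtAt p X par q ω
  · simp [h2, h1 h2]
  · by_cases h3 : n ∈ newAt p X par q ω <;> simp [h2, h3]

include hπ

/-- Resampling from the initial previous level is a fresh draw from `π`, so the invariance is the
independence of the initial replicas. -/
lemma gibbsOn_zero (m : ℕ) :
    GibbsOn μ {ω | Active p X par 0 ω ∧ m ∈ (stateAt p X par 0 ω).on} (configAt p X par x₀ 0)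
      (p.prevLaw P m) m := by
  have hX := fun n => h.measurable_X hA hξ hk 0 n
  refine GibbsOn.of_boxes (h.measurable_configAt' hA hξ hk x₀ 0) (Params.prevKernel P hA hξ m) ?_
  intro G s hG hs
  by_cases hm : m ∈ Finset.Icc 1 p.nrep
  swap
  · have hE : {ω | Active p X par 0 ω ∧ m ∈ (stateAt p X par 0 ω).on} = ∅ :=
      Set.eq_empty_of_forall_notMem fun ω hω => hm hω.2
    simp [hE]
  have hprod : ∀ s : ℕ → Set (ℕ → S), (∀ n, MeasurableSet (s n)) →
      μ {ω | ∀ n ∈ Finset.Icc 1 p.nrep, X 0 n ω ∈ s n} =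
        ∏ n ∈ Finset.Icc 1 p.nrep, π (s n) := by
    intro s hs
    have h1 := h.indep_zero.measure_inter_preimage_eq_mul Finset.univ
      (sets := fun n => s n) fun n _ => hs n
    have h2 : (⋂ n ∈ (Finset.univ : Finset (Finset.Icc 1 p.nrep)), X 0 n ⁻¹' s n) =
        {ω | ∀ n ∈ Finset.Icc 1 p.nrep, X 0 n ω ∈ s n} := by
      ext ω
      simp
    rw [h2] at h1
    rw [h1, ← Finset.prod_coe_sort (Finset.Icc 1 p.nrep) fun n => π (s n)]
    refine Finset.prod_congr rfl fun n _ => ?_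
    rw [← h.law_zero n n.2, Measure.map_apply (hX n) (hs n)]
  set D : ℝ × Finset ℕ × Finset ℕ × ℝ := (p.ξ x₀ - 1, Finset.Icc 1 p.nrep, ∅,
    State.mean p.nrep ⟨Finset.Icc 1 p.nrep, ∅, fun _ => 1 / p.nrep⟩) with hD
  have hbox : ∀ s : ℕ → Set (ℕ → S),
      {ω | Active p X par 0 ω ∧ m ∈ (stateAt p X par 0 ω).on} ∩
        {ω | (configAt p X par x₀ 0 ω).1 ∈ G ∧ ∀ n, (configAt p X par x₀ 0 ω).2 n ∈ s n} =
      {ω | (D ∈ G ∧ ∀ n ∉ Finset.Icc 1 p.nrep, (fun _ => x₀) ∈ s n) ∧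
        ∀ n ∈ Finset.Icc 1 p.nrep, X 0 n ω ∈ s n} := by
    intro s
    ext ω
    have h1 : ∀ n, (configAt p X par x₀ 0 ω).2 n =
        if n ∈ Finset.Icc 1 p.nrep then X 0 n ω else fun _ => x₀ := fun n => rfl
    have h2 : (configAt p X par x₀ 0 ω).1 = D := rfl
    simp only [Set.mem_inter_iff, Set.mem_ofPred_eq, h1, h2]
    constructor
    · rintro ⟨-, h3, h4⟩
      exact ⟨⟨h3, fun n hn => by simpa only [if_neg hn] using h4 n⟩,
        fun n hn => by simpa only [if_pos hn] using h4 n⟩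
    · rintro ⟨⟨h3, h4⟩, h5⟩
      refine ⟨⟨trivial, hm⟩, h3, fun n => ?_⟩
      split_ifs with hn
      · exact h5 n hn
      · exact h4 n hn
  have hne : {ω | (configAt p X par x₀ 0 ω).1 ∈ G ∧
      ∀ n ≠ m, (configAt p X par x₀ 0 ω).2 n ∈ s n} =
      {ω | (configAt p X par x₀ 0 ω).1 ∈ G ∧
        ∀ n, (configAt p X par x₀ 0 ω).2 n ∈ Function.update s m Set.univ n} := by
    ext ω
    refine and_congr_right fun _ => forall_congr' fun n => ?_
    by_cases hn : n = m
    · subst hn; simp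
    · simp [hn]
  -- The level `ξ x₀ - 1` is exceeded at time `0`, so the whole path is redrawn.
  have hlaw : ∀ᵐ ω ∂μ, Params.prevKernel P hA hξ m (configAt p X par x₀ 0 ω) (s m) = π (s m) := by
    have h1 : ∀ᵐ y ∂μ.map (X 0 m), y 0 = x₀ := by
      rw [h.law_zero m hm, hπ]
      exact ae_start_cont P hA 0 _
    filter_upwards [(ae_map_iff (hX m).aemeasurable (measurableSet_start x₀)).1 h1] with ω hω
    have h2 : (configAt p X par x₀ 0 ω).2 m = X 0 m ω := if_pos hm
    change resample P p.A p.ξ (p.ξ x₀ - 1) ((configAt p X par x₀ 0 ω).2 m) (s m) = _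
    rw [h2, resample_of_eq_coe P hA (levelTime_eq_zero (by rw [hω]; linarith)),
      cont_zero P hA hω, hπ]
  rw [hne, hbox, hbox, lintegral_congr_ae (ae_restrict_of_ae hlaw), setLIntegral_const]
  have hs' : ∀ n, MeasurableSet (Function.update s m Set.univ n) := fun n => by
    by_cases hn : n = m
    · subst hn; simp
    · rw [Function.update_of_ne hn]; exact hs n
  have hcond : (D ∈ G ∧ ∀ n ∉ Finset.Icc 1 p.nrep,
      (fun _ => x₀) ∈ Function.update s m Set.univ n) ↔
      (D ∈ G ∧ ∀ n ∉ Finset.Icc 1 p.nrep, (fun _ => x₀) ∈ s n) := by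
    refine and_congr_right fun _ => forall_congr' fun n => imp_congr_right fun hn => ?_
    rw [Function.update_of_ne (by rintro rfl; exact hn hm)]
  simp only [hcond]
  by_cases hc : D ∈ G ∧ ∀ n ∉ Finset.Icc 1 p.nrep, (fun _ => x₀) ∈ s n
  · have hprob : IsProbabilityMeasure π := by
      rw [← h.law_zero m hm]; exact Measure.isProbabilityMeasure_map (hX m).aemeasurable
    have hset : ∀ R : Ω → Prop, {ω | (D ∈ G ∧ ∀ n ∉ Finset.Icc 1 p.nrep, (fun _ => x₀) ∈ s n) ∧
        R ω} = {ω | R ω} := fun R => Set.ext fun ω => and_iff_right hc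
    rw [hset, hset, hprod s hs, hprod _ hs', ← Finset.mul_prod_erase _ _ hm,
      ← Finset.mul_prod_erase _ (fun n => π (Function.update s m Set.univ n)) hm,
      Function.update_self, measure_univ, one_mul]
    congr 1
    exact Finset.prod_congr rfl fun n hn => by
      rw [Function.update_of_ne (Finset.ne_of_mem_erase hn)]
  · have hset : ∀ R : Ω → Prop, {ω | (D ∈ G ∧ ∀ n ∉ Finset.Icc 1 p.nrep, (fun _ => x₀) ∈ s n) ∧
        R ω} = ∅ := fun R => Set.eq_empty_of_forall_notMem fun ω hω => hc hω.1
    rw [hset, hset, measure_empty, mul_zero]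

omit hN hπ in
lemma measurableSet_parents (q m : ℕ) : MeasurableSet
    {ω | ¬ (p.zmax : EReal) < levelAt p X par q ω ∧ m ∈ onGtAt p X par q ω} :=
  H.le q _ ((h.measurableSet_run hA hξ hk q).inter
    (measurableSet_mem_finset (h.measurable_onGtAt hA hξ hk q) m))

lemma gibbsOn_parents (q m : ℕ) (hq : GibbsOn μ
      {ω | Active p X par q ω ∧ m ∈ (stateAt p X par q ω).on} (configAt p X par x₀ q)
      (p.prevLaw P m) m) :
    GibbsOn μ {ω | ¬ (p.zmax : EReal) < levelAt p X par q ω ∧ m ∈ onGtAt p X par q ω}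
      (configAt p X par x₀ q) (p.curLaw P m) m := by
  have h1 := hq.current P hA hξ hk (h.measurable_configAt' hA hξ hk x₀ q) (by
    filter_upwards [h.ae_prevLevel_lt hA hξ hk x₀ hπ q] with ω hω hact
    rw [level_configAt]
    exact hω hact.1)
  convert h1 using 1
  ext ω
  simp only [Params.parentSet, Set.mem_inter_iff, Set.mem_preimage, Set.mem_ofPred_eq,
    level_configAt, onGt_configAt]
  refine ⟨fun h2 => ⟨⟨?_, p.onGt_subset h2.2⟩, h2⟩, fun h2 => h2.2⟩
  cases q with
  | zero => trivial
  | succ q => exact fun h3 => h2.1 (h.not_run_mono (Nat.le_succ q) h3).1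

/-- Integrate out the new replicas: given the configuration, neither their law nor the next data
change when the survivor `m` is redrawn, so its invariance survives the iteration. -/
lemma gibbsOn_succ_parents (q m : ℕ) (hq : GibbsOn μ
      {ω | ¬ (p.zmax : EReal) < levelAt p X par q ω ∧ m ∈ onGtAt p X par q ω}
      (configAt p X par x₀ q) (p.curLaw P m) m) :
    GibbsOn μ {ω | ¬ (p.zmax : EReal) < levelAt p X par q ω ∧ m ∈ onGtAt p X par q ω}
      (configAt p X par x₀ (q + 1)) (p.prevLaw P m) m := by
  refine GibbsOn.of_boxes (h.measurable_configAt' hA hξ hk x₀ (q + 1))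
    (Params.prevKernel P hA hξ m) fun G s hG hs => ?_
  have hW := h.measurable_configAt hA hξ hk x₀ q
  have hW' := h.measurable_configAt' hA hξ hk x₀ q
  set E : Set Ω := {ω | ¬ (p.zmax : EReal) < levelAt p X par q ω ∧ m ∈ onGtAt p X par q ω}
    with hE
  have hEm : MeasurableSet[H q] E := (h.measurableSet_run hA hξ hk q).inter
    (measurableSet_mem_finset (h.measurable_onGtAt hA hξ hk q) m)
  have hs' : ∀ n, MeasurableSet (Function.update s m Set.univ n) := fun n => by
    by_cases hn : n = m
    · subst hn; simp
    · rw [Function.update_of_ne hn]; exact hs n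
  have hB := Params.measurableSet_nextBox hA hξ hk x₀ hG hs
  have hB' := Params.measurableSet_nextBox hA hξ hk x₀ hG hs'
  have hnotnew : ∀ ω ∈ E, m ∉ newAt p X par q ω := fun ω hω =>
    Finset.disjoint_left.1 (p.disjoint_onGt_newLabels (h.valid hN q ω)) hω.2
  set N : Set Ω := {ω | ∀ n ∈ newAt p X par q ω, X (q + 1) n ω ∈ s n} with hNdef
  have hNm : MeasurableSet N := h.measurableSet_new_mem hA hξ hk q hs
  have e1 : E ∩ {ω | (configAt p X par x₀ (q + 1) ω).1 ∈ G ∧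
      ∀ n, (configAt p X par x₀ (q + 1) ω).2 n ∈ s n} =
      E ∩ configAt p X par x₀ q ⁻¹' p.nextBox x₀ G s ∩ N := by
    ext ω
    rw [Set.inter_assoc]
    refine and_congr_right fun hω => ?_
    exact h.configAt_succ_mem_box_iff hA hξ hk hN x₀ hω.1
  have e2 : E ∩ {ω | (configAt p X par x₀ (q + 1) ω).1 ∈ G ∧
      ∀ n ≠ m, (configAt p X par x₀ (q + 1) ω).2 n ∈ s n} =
      E ∩ configAt p X par x₀ q ⁻¹' p.nextBox x₀ G (Function.update s m Set.univ) ∩ N := by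
    ext ω
    rw [Set.inter_assoc]
    refine and_congr_right fun hω => ?_
    have h1 := h.configAt_succ_mem_box_iff hA hξ hk hN x₀ hω.1 (G := G)
      (s := Function.update s m Set.univ)
    have h2 : (∀ n ∈ newAt p X par q ω, X (q + 1) n ω ∈ Function.update s m Set.univ n) ↔
        ω ∈ N := forall_congr' fun n => imp_congr_right fun hn => by
      rw [Function.update_of_ne (by rintro rfl; exact hnotnew ω hω hn)]
    rw [h2] at h1
    refine Iff.trans (and_congr_right fun _ => forall_congr' fun n => ?_) h1
    by_cases hn : n = m
    · subst hn; simp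
    · simp [hn]
  -- The replica `m` is kept, and the current level is the previous level of the next iteration.
  have hcur : ∀ ω ∈ E, Params.prevKernel P hA hξ m (configAt p X par x₀ (q + 1) ω) (s m) =
      p.curLaw P m (configAt p X par x₀ q ω) (s m) := by
    intro ω hω
    have h1 : m ∈ (stateAt p X par (q + 1) ω).on := by
      rw [stateAt_succ, p.step_on hω.1]
      exact Finset.mem_union_left _ hω.2
    change resample P p.A p.ξ (levelAt p X par q ω).toReal
      ((configAt p X par x₀ (q + 1) ω).2 m) (s m) = _
    rw [Params.curLaw, level_configAt, configAt_replica h1, configAt_replica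
      (p.onGt_subset hω.2), h.keep q ω m (Finset.mem_union_left _ (p.onGt_subset hω.2))]
  have hcm : Measurable fun c => p.curLaw P m c (s m) :=
    (Measure.measurable_coe (hs m)).comp (p.measurable_config_resample P hA hξ hk m)
  have hnewm := p.measurable_config_newLabels hA hξ hk
  have hρ : Measurable fun c : Config S => ∏ n ∈ p.newLabels c.state c.2, p.meanLaw P c (s n) :=
    measurable_random_prod hnewm fun n =>
      (Measure.measurable_coe (hs n)).comp (p.measurable_meanLaw P hA hξ hk)
  have hE1 : MeasurableSet[H q] (E ∩ configAt p X par x₀ q ⁻¹' p.nextBox x₀ G s) :=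
    hEm.inter (hW hB)
  have hE2 : MeasurableSet[H q]
      (E ∩ configAt p X par x₀ q ⁻¹' p.nextBox x₀ G (Function.update s m Set.univ)) :=
    hEm.inter (hW hB')
  rw [e1, e2, setLIntegral_congr_fun (((H.le q _ hE2)).inter hNm)
    fun ω hω => hcur ω hω.1.1]
  -- the left-hand side
  have h1 := h.lintegral_new_mem' hA hξ hk x₀ q hs (measurable_indicator_one hE1)
  rw [lintegral_indicator_one (H.le q _ hE1), Measure.restrict_apply (H.le q _ hE1)] at h1
  -- the right-hand side
  have hU2 : Measurable[H q] ((E ∩ configAt p X par x₀ q ⁻¹'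
      p.nextBox x₀ G (Function.update s m Set.univ)).indicator
        fun ω => p.curLaw P m (configAt p X par x₀ q ω) (s m)) :=
    (hcm.comp hW).indicator hE2
  have h2 := h.lintegral_new_mem' hA hξ hk x₀ q hs hU2
  rw [← hNdef, lintegral_indicator (H.le q _ hE2), Measure.restrict_restrict (H.le q _ hE2)] at h2
  rw [h1, h2]
  -- The test function is the conditional probability, given the current configuration, that the
  -- next one lies in the box.
  have h3 := hq (fun c => (p.nextBox x₀ G s).indicator
    (fun c => ∏ n ∈ p.newLabels c.state c.2, p.meanLaw P c (s n)) c) (hρ.indicator hB)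
  have hE0 := H.le q _ hEm
  rw [← lintegral_indicator hE0, ← lintegral_indicator hE0] at h3
  refine Eq.trans ?_ (h3.trans ?_)
  · refine lintegral_congr fun ω => ?_
    by_cases h4 : ω ∈ E
    · by_cases h5 : configAt p X par x₀ q ω ∈ p.nextBox x₀ G s
      · rw [Set.indicator_of_mem (show ω ∈ _ ∩ _ from ⟨h4, h5⟩), Set.indicator_of_mem h4,
          Set.indicator_of_mem h5, newLabels_configAt, Pi.one_apply, one_mul]
      · rw [Set.indicator_of_notMem (fun h6 => h5 h6.2), Set.indicator_of_mem h4,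
          Set.indicator_of_notMem h5, zero_mul]
    · rw [Set.indicator_of_notMem (fun h6 => h4 h6.1), Set.indicator_of_notMem h4, zero_mul]
  · refine lintegral_congr fun ω => ?_
    by_cases h4 : ω ∈ E
    swap
    · rw [Set.indicator_of_notMem h4, Set.indicator_of_notMem (fun h6 => h4 h6.1), zero_mul]
    rw [Set.indicator_of_mem h4]
    have hc : configAt p X par x₀ q ω ∈ p.parentSet m := by
      simp only [Params.parentSet, Set.mem_ofPred_eq, level_configAt, onGt_configAt]
      exact h4
    rw [p.lintegral_replace_nextBox P hA hk (hs m) hc]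
    by_cases h5 : configAt p X par x₀ q ω ∈ p.nextBox x₀ G (Function.update s m Set.univ)
    · rw [Set.indicator_of_mem h5, Set.indicator_of_mem (show ω ∈ _ ∩ _ from ⟨h4, h5⟩),
        newLabels_configAt]
    · rw [Set.indicator_of_notMem h5, Set.indicator_of_notMem (fun h6 => h5 h6.2), zero_mul]

/-- A new replica is drawn from a mixture of resampling laws at the current level, independently of
the other new ones given the past; redrawing it from that same level preserves the mixture. -/
lemma gibbsOn_succ_new (q m : ℕ) :
    GibbsOn μ {ω | m ∈ newAt p X par q ω} (configAt p X par x₀ (q + 1)) (p.prevLaw P m) m := by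
  refine GibbsOn.of_boxes (h.measurable_configAt' hA hξ hk x₀ (q + 1))
    (Params.prevKernel P hA hξ m) fun G s hG hs => ?_
  have hW := h.measurable_configAt hA hξ hk x₀ q
  set E : Set Ω := {ω | m ∈ newAt p X par q ω} with hE
  have hEm : MeasurableSet[H q] E := measurableSet_mem_finset (h.measurable_newAt hA hξ hk q) m
  have hEm' : MeasurableSet E := H.le q _ hEm
  have hrun : ∀ ω ∈ E, ¬ (p.zmax : EReal) < levelAt p X par q ω := fun ω hω =>
    not_lt_of_mem_newAt hω
  have hnot : ∀ ω ∈ E, m ∉ onGtAt p X par q ω := fun ω hω h1 =>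
    Finset.disjoint_left.1 (p.disjoint_onGt_newLabels (h.valid hN q ω)) h1 hω
  have hB := Params.measurableSet_nextBox hA hξ hk x₀ hG hs
  have hB' : MeasurableSet (configAt p X par x₀ q ⁻¹' p.nextBox x₀ G s) := H.le q _ (hW hB)
  set N : Set Ω := {ω | ∀ n ∈ newAt p X par q ω, X (q + 1) n ω ∈ s n} with hNdef
  set N' : Set Ω := {ω | m ∈ newAt p X par q ω ∧
    ∀ n ∈ (newAt p X par q ω).erase m, X (q + 1) n ω ∈ s n} with hNdef'
  have hNm' : MeasurableSet N' := hEm'.inter (measurableSet_forall_mem (measurable_finset_op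
    ((h.measurable_newAt hA hξ hk q).mono (H.le q) le_rfl) fun t => t.erase m) fun n =>
      h.measurable_X hA hξ hk (q + 1) n (hs n))
  have e1 : E ∩ {ω | (configAt p X par x₀ (q + 1) ω).1 ∈ G ∧
      ∀ n, (configAt p X par x₀ (q + 1) ω).2 n ∈ s n} =
      E ∩ configAt p X par x₀ q ⁻¹' p.nextBox x₀ G s ∩ N := by
    ext ω
    rw [Set.inter_assoc]
    refine and_congr_right fun hω => ?_
    exact h.configAt_succ_mem_box_iff hA hξ hk hN x₀ (hrun ω hω)
  have e2 : E ∩ {ω | (configAt p X par x₀ (q + 1) ω).1 ∈ G ∧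
      ∀ n ≠ m, (configAt p X par x₀ (q + 1) ω).2 n ∈ s n} =
      configAt p X par x₀ q ⁻¹' p.nextBox x₀ G s ∩ N' := by
    have h0 : configAt p X par x₀ q ⁻¹' p.nextBox x₀ G s ∩ N' =
        E ∩ (configAt p X par x₀ q ⁻¹' p.nextBox x₀ G s ∩
          {ω | ∀ n ∈ (newAt p X par q ω).erase m, X (q + 1) n ω ∈ s n}) := by
      ext ω
      simp only [hNdef', hE, Set.mem_inter_iff, Set.mem_ofPred_eq]
      tauto
    rw [h0]
    ext ω
    refine and_congr_right fun hω => ?_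
    have h1 := h.configAt_succ_mem_box_iff hA hξ hk hN x₀ (hrun ω hω) (G := G)
      (s := Function.update s m Set.univ)
    rw [Params.mem_nextBox_update (by rw [onGt_configAt]; exact hnot ω hω)
      (by rw [newLabels_configAt]; exact hω)] at h1
    refine Iff.trans (and_congr_right fun _ => forall_congr' fun n => ?_)
      (h1.trans (and_congr_right fun _ => forall_congr' fun n => ?_))
    · by_cases hn : n = m
      · subst hn; simp
      · simp [hn]
    · by_cases hn : n = m
      · subst hn; simp
      · simp [hn]
  have hcur : ∀ ω ∈ configAt p X par x₀ q ⁻¹' p.nextBox x₀ G s ∩ N',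
      Params.prevKernel P hA hξ m (configAt p X par x₀ (q + 1) ω) (s m) =
      (p.nextBox x₀ G s).indicator 1 (configAt p X par x₀ q ω) *
        resample P p.A p.ξ (p.level (configAt p X par x₀ q ω).state.on
          (configAt p X par x₀ q ω).2).toReal (X (q + 1) m ω) (s m) := by
    rintro ω ⟨hω, hω'⟩
    have h1 : m ∈ (stateAt p X par (q + 1) ω).on := by
      rw [stateAt_succ, p.step_on (hrun ω hω'.1)]
      exact Finset.mem_union_right _ hω'.1
    change resample P p.A p.ξ (levelAt p X par q ω).toReal
      ((configAt p X par x₀ (q + 1) ω).2 m) (s m) = _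
    rw [level_configAt, configAt_replica h1, Set.indicator_of_mem (by exact hω), Pi.one_apply,
      one_mul]
  have hr : Measurable fun c : Config S × (ℕ → S) =>
      resample P p.A p.ξ (p.level c.1.state.on c.1.2).toReal c.2 (s m) := by
    have h1 : Measurable fun c : Config S × (ℕ → S) =>
        ((p.level c.1.state.on c.1.2).toReal, c.2) :=
      (measurable_ereal_toReal.comp ((p.measurable_config_level hA hξ hk).comp
        measurable_fst)).prodMk measurable_snd
    exact Measurable.comp (g := fun y : ℝ × (ℕ → S) => resampleKernel P hA hξ y (s m))
      (f := fun c : Config S × (ℕ → S) => ((p.level c.1.state.on c.1.2).toReal, c.2))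
      ((resampleKernel P hA hξ).measurable_coe (hs m)) h1
  -- The probability that the new replica, once redrawn, satisfies its constraint, cut off to the
  -- configurations compatible with the box.
  have hΨ : Measurable fun c : Config S × (ℕ → S) => (p.nextBox x₀ G s).indicator 1 c.1 *
      resample P p.A p.ξ (p.level c.1.state.on c.1.2).toReal c.2 (s m) :=
    ((measurable_indicator_one hB).comp measurable_fst).mul hr
  have hE1 : MeasurableSet[H q] (E ∩ configAt p X par x₀ q ⁻¹' p.nextBox x₀ G s) :=
    hEm.inter (hW hB)
  rw [e1, e2, setLIntegral_congr_fun (hB'.inter hNm') hcur]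
  have h1 := h.lintegral_new_mem' hA hξ hk x₀ q hs (measurable_indicator_one hE1)
  rw [lintegral_indicator_one (H.le q _ hE1), Measure.restrict_apply (H.le q _ hE1)] at h1
  have h2 := h.lintegral_new hA hξ hk x₀ q m hs hΨ
  rw [h1, ← setLIntegral_indicator hB']
  have h3 : ∫⁻ ω in N', (configAt p X par x₀ q ⁻¹' p.nextBox x₀ G s).indicator
      (fun ω => (p.nextBox x₀ G s).indicator 1 (configAt p X par x₀ q ω) *
        resample P p.A p.ξ (p.level (configAt p X par x₀ q ω).state.on
          (configAt p X par x₀ q ω).2).toReal (X (q + 1) m ω) (s m)) ω ∂μ =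
      ∫⁻ ω in N', (p.nextBox x₀ G s).indicator 1 (configAt p X par x₀ q ω) *
        resample P p.A p.ξ (p.level (configAt p X par x₀ q ω).state.on
          (configAt p X par x₀ q ω).2).toReal (X (q + 1) m ω) (s m) ∂μ := by
    refine lintegral_congr fun ω => ?_
    by_cases h4 : configAt p X par x₀ q ω ∈ p.nextBox x₀ G s
    · rw [Set.indicator_of_mem (by exact h4)]
    · rw [Set.indicator_of_notMem (by exact h4), Set.indicator_of_notMem h4, zero_mul]
  rw [h3, h2, ← lintegral_indicator hEm']
  refine lintegral_congr fun ω => ?_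
  by_cases h4 : ω ∈ E
  swap
  · rw [Set.indicator_of_notMem (fun h6 => h4 h6.1), Set.indicator_of_notMem h4, zero_mul]
  rw [Set.indicator_of_mem h4]
  by_cases h5 : configAt p X par x₀ q ω ∈ p.nextBox x₀ G s
  swap
  · rw [Set.indicator_of_notMem (fun h6 => h5 h6.2)]
    simp [Set.indicator_of_notMem h5]
  rw [Set.indicator_of_mem (show ω ∈ _ ∩ _ from ⟨h4, h5⟩), Pi.one_apply, one_mul]
  simp only [Set.indicator_of_mem h5, Pi.one_apply, one_mul]
  rw [← Finset.mul_prod_erase _ _ (show m ∈ newAt p X par q ω from h4), mul_comm]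
  congr 1
  have hres : ∀ x, ∫⁻ y, resample P p.A p.ξ (p.level (configAt p X par x₀ q ω).state.on
      (configAt p X par x₀ q ω).2).toReal y (s m) ∂resample P p.A p.ξ
        (p.level (configAt p X par x₀ q ω).state.on (configAt p X par x₀ q ω).2).toReal x =
      resample P p.A p.ξ (p.level (configAt p X par x₀ q ω).state.on
        (configAt p X par x₀ q ω).2).toReal x (s m) := fun x => by
    have h6 := lintegral_resample_resample P hA hξ (p.level (configAt p X par x₀ q ω).state.on
      (configAt p X par x₀ q ω).2).toReal x (measurable_indicator_one (hs m))
    simpa only [lintegral_indicator_one (hs m)] using h6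
  rw [p.meanLaw_apply, Params.meanLaw, lintegral_finsetSum_measure]
  simp_rw [lintegral_smul_measure, hres, smul_eq_mul]

/-- At each iteration, the working replicas are invariant under resampling at the previous
level. -/
lemma gibbsOn_working (q m : ℕ) :
    GibbsOn μ {ω | Active p X par q ω ∧ m ∈ (stateAt p X par q ω).on} (configAt p X par x₀ q)
      (p.prevLaw P m) m := by
  induction q with
  | zero => exact h.gibbsOn_zero hA hξ hk hN x₀ hπ m
  | succ q ih =>
    have h1 := h.gibbsOn_succ_parents hA hξ hk hN x₀ hπ q m
      (h.gibbsOn_parents hA hξ hk hN x₀ hπ q m ih)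
    have h2 := h.gibbsOn_succ_new hA hξ hk hN x₀ hπ q m
    convert h1.union h2 (H.le q _ (measurableSet_mem_finset (h.measurable_newAt hA hξ hk q) m)) ?_
      using 1
    · ext ω
      simp only [Set.mem_ofPred_eq, Set.mem_union, Active]
      constructor
      · rintro ⟨h3, h4⟩
        rw [stateAt_succ, p.step_on h3, Finset.mem_union] at h4
        exact h4.imp (fun h5 => ⟨h3, h5⟩) id
      · rintro (⟨h3, h4⟩ | h4)
        · refine ⟨h3, ?_⟩
          rw [stateAt_succ, p.step_on h3]
          exact Finset.mem_union_left _ h4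
        · have h3 := not_lt_of_mem_newAt h4
          refine ⟨h3, ?_⟩
          rw [stateAt_succ, p.step_on h3]
          exact Finset.mem_union_right _ h4
    · rw [Set.disjoint_left]
      exact fun ω h3 h4 =>
        Finset.disjoint_left.1 (p.disjoint_onGt_newLabels (h.valid hN q ω)) h3.2 h4

/-- The replicas above the current level are invariant under resampling at this level. -/
lemma gibbsOn_above (q m : ℕ) :
    GibbsOn μ {ω | ¬ (p.zmax : EReal) < levelAt p X par q ω ∧ m ∈ onGtAt p X par q ω}
      (configAt p X par x₀ q) (p.curLaw P m) m :=
  h.gibbsOn_parents hA hξ hk hN x₀ hπ q m (h.gibbsOn_working hA hξ hk hN x₀ hπ q m)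

end Invariance

end IsAMS

end AMS

namespace AMS

lemma lintegral_random_sum {Ω : Type*} [MeasurableSpace Ω] {μ : Measure Ω} {T : Ω → Finset ℕ}
    (hT : Measurable T) {g : ℕ → Ω → ℝ≥0∞} (hg : ∀ n, Measurable (g n)) :
    ∫⁻ ω, ∑ n ∈ T ω, g n ω ∂μ = ∑' n, ∫⁻ ω in {ω | n ∈ T ω}, g n ω ∂μ := by
  have h1 : ∀ n, MeasurableSet {ω | n ∈ T ω} := measurableSet_mem_finset hT
  have h2 : ∀ ω, ∑ n ∈ T ω, g n ω = ∑' n, {ω | n ∈ T ω}.indicator (g n) ω := fun ω => by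
    rw [tsum_eq_sum (s := T ω) fun n hn => Set.indicator_of_notMem (by exact hn) _]
    exact Finset.sum_congr rfl fun n hn => (Set.indicator_of_mem (by exact hn) _).symm
  simp_rw [h2]
  rw [lintegral_tsum fun n => ((hg n).indicator (h1 n)).aemeasurable]
  exact tsum_congr fun n => lintegral_indicator (h1 n) _

lemma Params.meanLaw_univ {S : Type*} {p : Params S} [MeasurableSpace S] (P : Kernel S S)
    [IsMarkovKernel P] (hA : MeasurableSet p.A) {c : Config S}
    (hc : (p.onGt c.state c.2).Nonempty) : p.meanLaw P c Set.univ = 1 := by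
  have hprob := fun z => isProbabilityMeasure_resample P (A := p.A) (ξ := p.ξ) hA z
  rw [meanLaw_apply]
  simp only [measure_univ, mul_one, Finset.sum_const, nsmul_eq_mul]
  exact ENNReal.mul_inv_cancel (by exact_mod_cast hc.card_pos.ne') (ENNReal.natCast_ne_top _)

/-! ### Unbiasedness at a fixed iteration -/

section Estimators

variable {S Ω : Type*} (p : Params S) (X : ℕ → ℕ → Ω → ℕ → S) (par : ℕ → ℕ → Ω → ℕ)

/-- Labels of the replicas from which the parents are drawn in iteration `q`; none if the
algorithm has stopped. -/
def parentsAt (q : ℕ) (ω : Ω) : Finset ℕ :=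
  if (p.zmax : EReal) < levelAt p X par q ω then ∅ else onGtAt p X par q ω

/-- The weight of the working replicas after iteration `q`. -/
def newWeight (q : ℕ) (ω : Ω) : ℝ :=
  p.factor (stateAt p X par q ω) (fun n => X q n ω) * (stateAt p X par q ω).mean p.nrep

/-- The weight removed from the working replicas in iteration `q`. -/
def lostWeight (q : ℕ) (ω : Ω) : ℝ :=
  (p.onLe (stateAt p X par q ω) fun n => X q n ω).card / p.nrep *
    (stateAt p X par q ω).mean p.nrep

/-- The weighted empirical average of a nonnegative function. -/
def estimateENN (φ : (ℕ → S) → ℝ≥0∞) (q : ℕ) (ω : Ω) : ℝ≥0∞ :=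
  ∑ n ∈ (stateAt p X par q ω).on ∪ (stateAt p X par q ω).off,
    ENNReal.ofReal ((stateAt p X par q ω).weight n) * φ (X q n ω)

variable {p X par}

lemma mem_parentsAt {q n : ℕ} {ω : Ω} : n ∈ parentsAt p X par q ω ↔
    ¬ (p.zmax : EReal) < levelAt p X par q ω ∧ n ∈ onGtAt p X par q ω := by
  rw [parentsAt]
  split_ifs with h1 <;> simp [h1]

lemma parentsAt_subset (q : ℕ) (ω : Ω) :
    parentsAt p X par q ω ⊆ (stateAt p X par q ω).on ∪ (stateAt p X par q ω).off := fun _ hn =>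
  Finset.mem_union_left _ (p.onGt_subset (mem_parentsAt.1 hn).2)

end Estimators

lemma State.Valid.mean_nonneg {N : ℕ} {s : State} (hs : s.Valid N) : 0 ≤ s.mean N :=
  div_nonneg (Finset.sum_nonneg fun n _ => hs.weight_nonneg n) (Nat.cast_nonneg N)

namespace IsAMS

section Estimators

variable {S Ω : Type*} {p : Params S} {X : ℕ → ℕ → Ω → ℕ → S} {par : ℕ → ℕ → Ω → ℕ}
  [mΩ : MeasurableSpace Ω] [MeasurableSpace S] [MeasurableSingletonClass S] {P : Kernel S S}
  [IsMarkovKernel P] {π : Measure (ℕ → S)} {μ : Measure Ω} [IsProbabilityMeasure μ]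
  {H : Filtration ℕ mΩ} (h : IsAMS p X par P π μ H)

include h

/-- The weight of a parent splits into the part that it keeps and the part that its iteration gives
to the new replicas. -/
lemma weight_decomp (hN : 0 < p.nrep) (q : ℕ) (ω : Ω) :
    ENNReal.ofReal ((stateAt p X par q ω).mean p.nrep) =
      ENNReal.ofReal (newWeight p X par q ω) + ENNReal.ofReal (lostWeight p X par q ω) := by
  have hv := h.valid hN q ω
  have hm := hv.mean_nonneg
  have hf := p.factor_nonneg (x := fun n => X q n ω) hv.card_on
  rw [newWeight, lostWeight, ← ENNReal.ofReal_add (by positivity) (by positivity), ← add_mul]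
  congr 1
  have hN' : (p.nrep : ℝ) ≠ 0 := by exact_mod_cast hN.ne'
  rw [Params.factor]
  field_simp
  ring

lemma estimateENN_eq (hN : 0 < p.nrep) (φ : (ℕ → S) → ℝ≥0∞) (q : ℕ) (ω : Ω) :
    estimateENN p X par φ q ω =
      ∑ n ∈ ((stateAt p X par q ω).on ∪ (stateAt p X par q ω).off) \ parentsAt p X par q ω,
        ENNReal.ofReal ((stateAt p X par q ω).weight n) * φ (X q n ω) +
      ∑ n ∈ parentsAt p X par q ω, ENNReal.ofReal (newWeight p X par q ω) * φ (X q n ω) +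
      ∑ n ∈ parentsAt p X par q ω, ENNReal.ofReal (lostWeight p X par q ω) * φ (X q n ω) := by
  have hv := h.valid hN q ω
  rw [estimateENN, ← Finset.sum_sdiff (parentsAt_subset q ω), add_assoc]
  congr 1
  rw [← Finset.sum_add_distrib]
  refine Finset.sum_congr rfl fun n hn => ?_
  rw [← add_mul, ← h.weight_decomp hN, hv.mean_eq (p.onGt_subset (mem_parentsAt.1 hn).2)]

/-- Only the last sum differs from that in `estimateENN_eq`: the lost weight on the parents is
exchanged for new replicas. -/
lemma estimateENN_succ_eq (hN : 0 < p.nrep) (φ : (ℕ → S) → ℝ≥0∞) (q : ℕ) (ω : Ω) :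
    estimateENN p X par φ (q + 1) ω =
      ∑ n ∈ ((stateAt p X par q ω).on ∪ (stateAt p X par q ω).off) \ parentsAt p X par q ω,
        ENNReal.ofReal ((stateAt p X par q ω).weight n) * φ (X q n ω) +
      ∑ n ∈ parentsAt p X par q ω, ENNReal.ofReal (newWeight p X par q ω) * φ (X q n ω) +
      ∑ n ∈ newAt p X par q ω,
        ENNReal.ofReal (newWeight p X par q ω) * φ (X (q + 1) n ω) := by
  have hv := h.valid hN q ω
  have hlab : (stateAt p X par (q + 1) ω).on ∪ (stateAt p X par (q + 1) ω).off =
      (stateAt p X par q ω).on ∪ (stateAt p X par q ω).off ∪ newAt p X par q ω := by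
    rw [stateAt_succ, p.step_labels]
    rfl
  have hd : Disjoint ((stateAt p X par q ω).on ∪ (stateAt p X par q ω).off)
      (newAt p X par q ω) := p.disjoint_newLabels hv
  rw [estimateENN, hlab, Finset.sum_union hd, ← Finset.sum_sdiff (parentsAt_subset q ω)]
  congr 1
  · congr 1
    · refine Finset.sum_congr rfl fun n hn => ?_
      obtain ⟨hn1, hn2⟩ := Finset.mem_sdiff.1 hn
      rw [h.keep q ω n hn1]
      congr 2
      by_cases hlt : (p.zmax : EReal) < levelAt p X par q ω
      · rw [stateAt_succ_of_lt hlt]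
      · have h1 : n ∉ onGtAt p X par q ω := fun h2 => hn2 (mem_parentsAt.2 ⟨hlt, h2⟩)
        have h2 : n ∉ newAt p X par q ω := Finset.disjoint_left.1 hd hn1
        rw [stateAt_succ, p.step_weight hlt]
        exact (if_neg h1).trans (if_neg h2)
    · refine Finset.sum_congr rfl fun n hn => ?_
      obtain ⟨h1, h2⟩ := mem_parentsAt.1 hn
      rw [h.keep q ω n (parentsAt_subset q ω hn), stateAt_succ, p.step_weight_onGt h1 h2,
        hv.mean_eq (p.onGt_subset h2)]
      rfl
  · refine Finset.sum_congr rfl fun n hn => ?_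
    have h1 := not_lt_of_mem_newAt hn
    rw [stateAt_succ, p.step_weight_eq_mean hv h1 (h.par_mem q ω) (Finset.mem_union_right _ hn)]
    rfl

variable (hA : MeasurableSet p.A) (hξ : Measurable p.ξ) (hk : 1 ≤ p.k)

include hA hξ hk

lemma measurable_parentsAt (q : ℕ) : Measurable[H q] (parentsAt p X par q) := by
  refine measurable_finset fun n => ?_
  simp only [mem_parentsAt]
  exact (h.measurableSet_run hA hξ hk q).inter
    (measurableSet_mem_finset (h.measurable_onGtAt hA hξ hk q) n)

lemma measurable_mean (q : ℕ) : Measurable[H q] fun ω => (stateAt p X par q ω).mean p.nrep := by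
  have hs := h.isMeasurable_stateAt hA hξ hk q
  exact (measurable_random_sum hs.on hs.weight).div_const _

variable (hN : 0 < p.nrep) (x₀ : S) (hπ : π = cont P p.A 0 fun _ => x₀)

include hN

/-- The mean contribution of the new replicas. -/
lemma lintegral_sum_new {φ : (ℕ → S) → ℝ≥0∞} (hφ : Measurable φ) (q : ℕ) :
    ∫⁻ ω, ∑ n ∈ newAt p X par q ω,
        ENNReal.ofReal (newWeight p X par q ω) * φ (X (q + 1) n ω) ∂μ =
      ∫⁻ ω, ∑ n ∈ parentsAt p X par q ω, ENNReal.ofReal (lostWeight p X par q ω) *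
        ∫⁻ y, φ y ∂p.curLaw P n (configAt p X par x₀ q ω) ∂μ := by
  have hW := h.measurable_configAt' hA hξ hk x₀ q
  have hnew := (h.measurable_newAt hA hξ hk q).mono (H.le q) le_rfl
  set a : Config S → ℝ≥0∞ := fun c =>
    ENNReal.ofReal (p.factor c.state c.2 * c.1.2.2.2) with ha
  have ham : Measurable a := by
    have hw : Measurable fun c : Config S => c.1.2.2.2 :=
      ((measurable_snd.comp measurable_snd).comp measurable_snd).comp measurable_fst
    exact ((measurable_finset_op (p.measurable_config_onLe hA hξ hk)
      fun a => ((p.nrep : ℝ) - a.card) / p.nrep).mul hw).ennreal_ofReal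
  have haW : ∀ ω, a (configAt p X par x₀ q ω) = ENNReal.ofReal (newWeight p X par q ω) := by
    intro ω
    simp only [ha, Params.factor, onLe_configAt]
    rfl
  simp_rw [← haW]
  have hfin := p.isFiniteKernel_meanKernel P hA hξ hk
  have hin : Measurable fun c => ∫⁻ y, φ y ∂p.meanKernel P hA hξ hk c := hφ.lintegral_kernel
  rw [lintegral_random_sum (g := fun n ω => a (configAt p X par x₀ q ω) * φ (X (q + 1) n ω))
    hnew fun n => (ham.comp hW).mul (hφ.comp (h.measurable_X hA hξ hk (q + 1) n))]
  have h1 : ∀ m, ∫⁻ ω in {ω | m ∈ newAt p X par q ω},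
      a (configAt p X par x₀ q ω) * φ (X (q + 1) m ω) ∂μ =
      ∫⁻ ω in {ω | m ∈ newAt p X par q ω}, a (configAt p X par x₀ q ω) *
        ∫⁻ y, φ y ∂p.meanLaw P (configAt p X par x₀ q ω) ∂μ := by
    intro m
    have h2 := h.lintegral_new hA hξ hk x₀ q m (s := fun _ => Set.univ)
      (fun _ => MeasurableSet.univ) (Ψ := fun c => a c.1 * φ c.2)
      ((ham.comp measurable_fst).mul (hφ.comp measurable_snd))
    have h3 : {ω | m ∈ newAt p X par q ω ∧ ∀ n ∈ (newAt p X par q ω).erase m,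
        X (q + 1) n ω ∈ (fun _ => Set.univ : ℕ → Set (ℕ → S)) n} =
        {ω | m ∈ newAt p X par q ω} := by
      ext ω; simp
    rw [h3] at h2
    rw [h2]
    refine setLIntegral_congr_fun (measurableSet_mem_finset hnew m) fun ω hω => ?_
    have hne : (p.onGt (configAt p X par x₀ q ω).state (configAt p X par x₀ q ω).2).Nonempty := by
      rw [onGt_configAt]
      exact p.onGt_nonempty (h.valid hN q ω).card_on (not_lt_of_mem_newAt hω)
    simp only [Params.meanLaw_univ P hA hne, Finset.prod_const_one, one_mul]
    rw [lintegral_const_mul _ hφ]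
  simp_rw [h1]
  rw [← lintegral_random_sum (g := fun _ ω => a (configAt p X par x₀ q ω) *
    ∫⁻ y, φ y ∂p.meanLaw P (configAt p X par x₀ q ω)) hnew
    fun n => (ham.comp hW).mul (hin.comp hW)]
  refine lintegral_congr fun ω => ?_
  by_cases hlt : (p.zmax : EReal) < levelAt p X par q ω
  · rw [newAt_of_lt hlt, parentsAt, if_pos hlt, Finset.sum_empty, Finset.sum_empty]
  have hv := h.valid hN q ω
  have hne : (onGtAt p X par q ω).Nonempty := p.onGt_nonempty hv.card_on hlt
  rw [parentsAt, if_neg hlt, Finset.sum_const, nsmul_eq_mul, Params.meanLaw, onGt_configAt,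
    lintegral_finsetSum_measure, haW, ← mul_assoc, Finset.mul_sum]
  refine Finset.sum_congr rfl fun j _ => ?_
  rw [lintegral_smul_measure, smul_eq_mul, ← mul_assoc]
  congr 1
  -- The constants balance: `K` new replicas of weight `((N - K)/N) w`, each choosing a given parent
  -- with probability `1/(N - K)`, contribute `(K/N) w` per parent.
  have hc : (newAt p X par q ω).card = (p.onLe (stateAt p X par q ω) fun n => X q n ω).card :=
    p.card_newLabels hlt
  have hpos : (0 : ℝ) < (onGtAt p X par q ω).card := by exact_mod_cast hne.card_pos
  have hm := hv.mean_nonneg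
  have hN' : (0 : ℝ) < p.nrep := by exact_mod_cast hN
  rw [hc, newWeight, lostWeight, p.factor_eq hv.card_on, ← ENNReal.ofReal_natCast,
    ← ENNReal.ofReal_natCast (onGtAt p X par q ω).card, ← ENNReal.ofReal_inv_of_pos hpos,
    ← ENNReal.ofReal_mul (by positivity), ← ENNReal.ofReal_mul (by positivity)]
  congr 1
  change _ * ((onGtAt p X par q ω).card / (p.nrep : ℝ) * _) * _ = _
  field_simp

include hπ

/-- The invariance of a parent under resampling from the current level is applied to lost weight
times `φ`; the lost weight is not affected by the redraw. -/
lemma lintegral_sum_parents {φ : (ℕ → S) → ℝ≥0∞} (hφ : Measurable φ) (q : ℕ) :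
    ∫⁻ ω, ∑ n ∈ parentsAt p X par q ω, ENNReal.ofReal (lostWeight p X par q ω) *
        ∫⁻ y, φ y ∂p.curLaw P n (configAt p X par x₀ q ω) ∂μ =
      ∫⁻ ω, ∑ n ∈ parentsAt p X par q ω,
        ENNReal.ofReal (lostWeight p X par q ω) * φ (X q n ω) ∂μ := by
  have hW := h.measurable_configAt' hA hξ hk x₀ q
  have hpar := (h.measurable_parentsAt hA hξ hk q).mono (H.le q) le_rfl
  set b : Config S → ℝ≥0∞ := fun c =>
    ENNReal.ofReal ((p.onLe c.state c.2).card / p.nrep * c.1.2.2.2) with hb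
  have hbm : Measurable b := by
    have hw : Measurable fun c : Config S => c.1.2.2.2 :=
      ((measurable_snd.comp measurable_snd).comp measurable_snd).comp measurable_fst
    exact ((measurable_finset_op (p.measurable_config_onLe hA hξ hk)
      fun a => (a.card : ℝ) / p.nrep).mul hw).ennreal_ofReal
  have hbW : ∀ ω, b (configAt p X par x₀ q ω) = ENNReal.ofReal (lostWeight p X par q ω) := by
    intro ω
    simp only [hb, onLe_configAt]
    rfl
  simp_rw [← hbW]
  have hcur : ∀ n, Measurable fun c => ∫⁻ y, φ y ∂p.curLaw P n c := fun n =>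
    (Measure.measurable_lintegral hφ).comp (p.measurable_config_resample P hA hξ hk n)
  rw [lintegral_random_sum (g := fun n ω => b (configAt p X par x₀ q ω) *
      ∫⁻ y, φ y ∂p.curLaw P n (configAt p X par x₀ q ω)) hpar
      fun n => (hbm.comp hW).mul ((hcur n).comp hW),
    lintegral_random_sum (g := fun n ω => b (configAt p X par x₀ q ω) * φ (X q n ω)) hpar
      fun n => (hbm.comp hW).mul (hφ.comp (h.measurable_X hA hξ hk q n))]
  refine tsum_congr fun m => ?_
  simp only [mem_parentsAt]
  have h1 := h.gibbsOn_above hA hξ hk hN x₀ hπ q m (fun c => b c * φ (c.2 m))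
    (hbm.mul (hφ.comp (Params.measurable_config_replica m)))
  have hE := h.measurableSet_parents hA hξ hk q m
  have h2 : ∫⁻ ω in {ω | ¬ (p.zmax : EReal) < levelAt p X par q ω ∧ m ∈ onGtAt p X par q ω},
      b (configAt p X par x₀ q ω) * φ (X q m ω) ∂μ =
      ∫⁻ ω in {ω | ¬ (p.zmax : EReal) < levelAt p X par q ω ∧ m ∈ onGtAt p X par q ω},
        b (configAt p X par x₀ q ω) * φ ((configAt p X par x₀ q ω).2 m) ∂μ :=
    setLIntegral_congr_fun hE fun ω hω => by
      simp only [configAt_replica (p.onGt_subset hω.2)]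
  rw [h2, h1]
  refine setLIntegral_congr_fun hE fun ω hω => ?_
  have hrun : ¬ (p.zmax : EReal) < p.level (configAt p X par x₀ q ω).state.on
      (configAt p X par x₀ q ω).2 := by rw [level_configAt]; exact hω.1
  have hgt : m ∈ p.onGt (configAt p X par x₀ q ω).state (configAt p X par x₀ q ω).2 := by
    rw [onGt_configAt]; exact hω.2
  have h3 : p.level (configAt p X par x₀ q ω).state.on (configAt p X par x₀ q ω).2 <
      maxLevel p.A p.ξ ((configAt p X par x₀ q ω).2 m) := (Finset.mem_filter.1 hgt).2
  rw [← p.coe_toReal_level hk (p.level_ne_top hrun), lt_maxLevel_iff_levelTime_ne_top] at h3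
  obtain ⟨t, ht⟩ := exists_nat_of_ne_top h3
  rw [← lintegral_const_mul _ hφ]
  refine lintegral_congr_ae ?_
  filter_upwards [ae_agreeUpTo_resample P hA ht] with y hy
  have hst : p.Stable (configAt p X par x₀ q ω) m y t := ⟨hk, p.level_ne_top hrun, ht, hy⟩
  simp only [hb, hst.onLe_eq, Config.replace_snd_self]
  rfl

/-- By induction: the two sums shared by consecutive estimates cancel, and the exchanged sums have
the same integral. -/
lemma lintegral_estimateENN {φ : (ℕ → S) → ℝ≥0∞} (hφ : Measurable φ) (q : ℕ) :
    ∫⁻ ω, estimateENN p X par φ q ω ∂μ = ∫⁻ y, φ y ∂π := by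
  induction q with
  | zero =>
    have h1 : ∀ ω, estimateENN p X par φ 0 ω =
        ∑ n ∈ Finset.Icc 1 p.nrep, ENNReal.ofReal (1 / p.nrep) * φ (X 0 n ω) := fun ω => by
      simp [estimateENN, stateAt, Params.state]
    simp_rw [h1]
    rw [lintegral_finsetSum (f := fun n ω => ENNReal.ofReal (1 / p.nrep) * φ (X 0 n ω)) _
      fun n _ => (hφ.comp (h.measurable_X hA hξ hk 0 n)).const_mul _]
    have h2 : ∀ n ∈ Finset.Icc 1 p.nrep,
        ∫⁻ ω, ENNReal.ofReal (1 / p.nrep) * φ (X 0 n ω) ∂μ =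
          ENNReal.ofReal (1 / p.nrep) * ∫⁻ y, φ y ∂π := fun n hn => by
      rw [lintegral_const_mul (f := fun ω => φ (X 0 n ω)) _
        (hφ.comp (h.measurable_X hA hξ hk 0 n)), ← h.law_zero n hn,
        lintegral_map hφ (h.measurable_X hA hξ hk 0 n)]
    rw [Finset.sum_congr rfl h2, Finset.sum_const, Nat.card_Icc, Nat.add_sub_cancel,
      nsmul_eq_mul, ← mul_assoc, ← ENNReal.ofReal_natCast, ← ENNReal.ofReal_mul (by positivity)]
    have hN' : (p.nrep : ℝ) ≠ 0 := by exact_mod_cast hN.ne'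
    rw [mul_one_div_cancel hN', ENNReal.ofReal_one, one_mul]
  | succ q ih =>
    rw [← ih]
    simp_rw [h.estimateENN_succ_eq hN, h.estimateENN_eq hN φ q]
    have hs := h.isMeasurable_stateAt hA hξ hk q
    have hpar := (h.measurable_parentsAt hA hξ hk q).mono (H.le q) le_rfl
    have hlab := (h.measurable_labelsAt hA hξ hk q).mono (H.le q) le_rfl
    have hφX := fun n => hφ.comp (h.measurable_X hA hξ hk q n)
    have hw : Measurable fun ω => ENNReal.ofReal (newWeight p X par q ω) := by
      refine ((Measurable.mul ?_ (h.measurable_mean hA hξ hk q)).mono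
        (H.le q) le_rfl).ennreal_ofReal
      exact p.measurable_factor hA hξ hk hs.on fun n => h.X_adapted q n
    have hleft : Measurable fun ω =>
        ∑ n ∈ ((stateAt p X par q ω).on ∪ (stateAt p X par q ω).off) \ parentsAt p X par q ω,
          ENNReal.ofReal ((stateAt p X par q ω).weight n) * φ (X q n ω) +
        ∑ n ∈ parentsAt p X par q ω, ENNReal.ofReal (newWeight p X par q ω) * φ (X q n ω) := by
      refine Measurable.add ?_ ?_
      · exact measurable_random_sum (measurable_finset_binop hlab hpar fun a b => a \ b) fun n =>
          (((hs.weight n).mono (H.le q) le_rfl).ennreal_ofReal).mul (hφX n)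
      · exact measurable_random_sum hpar fun n => hw.mul (hφX n)
    rw [lintegral_add_left hleft, lintegral_add_left hleft, h.lintegral_sum_new hA hξ hk hN x₀ hφ,
      h.lintegral_sum_parents hA hξ hk hN x₀ hπ hφ]

end Estimators

end IsAMS

end AMS

namespace AMS

namespace IsAMS

/-! ### From a fixed iteration to the stopped algorithm -/

section Unbiased

variable {S Ω : Type*} {p : Params S} {X : ℕ → ℕ → Ω → ℕ → S} {par : ℕ → ℕ → Ω → ℕ}
  [mΩ : MeasurableSpace Ω] [MeasurableSpace S] [MeasurableSingletonClass S] {P : Kernel S S}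
  [IsMarkovKernel P] {π : Measure (ℕ → S)} {μ : Measure Ω} [IsProbabilityMeasure μ]
  {H : Filtration ℕ mΩ} (h : IsAMS p X par P π μ H) (hN : 0 < p.nrep)

include h hN

lemma estimate_one (q : ℕ) (ω : Ω) : (toScheme p X par).estimate (fun _ => 1) q ω = 1 := by
  simp only [GAMS.Scheme.estimate, mul_one]
  exact (h.valid hN q ω).sum_weight

lemma estimate_add_const (φ : (ℕ → S) → ℝ) (C : ℝ) (q : ℕ) (ω : Ω) :
    (toScheme p X par).estimate (fun x => φ x + C) q ω =
      (toScheme p X par).estimate φ q ω + C := by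
  have h1 := h.estimate_one hN q ω
  simp only [GAMS.Scheme.estimate, mul_one] at h1 ⊢
  simp_rw [mul_add]
  rw [Finset.sum_add_distrib, ← Finset.sum_mul, h1, one_mul]

lemma abs_estimate_le {φ : (ℕ → S) → ℝ} {C : ℝ} (hC : ∀ x, |φ x| ≤ C) (q : ℕ) (ω : Ω) :
    |(toScheme p X par).estimate φ q ω| ≤ C := by
  have hv := h.valid hN q ω
  have h1 := h.estimate_one hN q ω
  simp only [GAMS.Scheme.estimate, mul_one] at h1 ⊢
  calc _ ≤ ∑ n ∈ (toScheme p X par).labels q ω, |(toScheme p X par).weight q n ω *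
        φ ((toScheme p X par).X q n ω)| := Finset.abs_sum_le_sum_abs _ _
    _ ≤ ∑ n ∈ (toScheme p X par).labels q ω, (toScheme p X par).weight q n ω * C := by
        refine Finset.sum_le_sum fun n _ => ?_
        have hw : 0 ≤ (toScheme p X par).weight q n ω := hv.weight_nonneg n
        rw [abs_mul, abs_of_nonneg hw]
        exact mul_le_mul_of_nonneg_left (hC _) hw
    _ = C := by rw [← Finset.sum_mul, h1, one_mul]

lemma estimateENN_eq_ofReal {φ : (ℕ → S) → ℝ} (hφ : ∀ x, 0 ≤ φ x) (q : ℕ) (ω : Ω) :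
    estimateENN p X par (fun x => ENNReal.ofReal (φ x)) q ω =
      ENNReal.ofReal ((toScheme p X par).estimate φ q ω) := by
  have hv := h.valid hN q ω
  rw [GAMS.Scheme.estimate, ENNReal.ofReal_sum_of_nonneg
    (f := fun n => (toScheme p X par).weight q n ω * φ ((toScheme p X par).X q n ω))
    fun n _ => mul_nonneg (hv.weight_nonneg n) (hφ _)]
  exact Finset.sum_congr rfl fun n _ => (ENNReal.ofReal_mul (hv.weight_nonneg n)).symm

omit hN in
lemma estimate_of_halted (φ : (ℕ → S) → ℝ) {q r : ℕ} (hqr : q ≤ r) {ω : Ω}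
    (hq : (p.zmax : EReal) < levelAt p X par q ω) :
    (toScheme p X par).estimate φ r ω = (toScheme p X par).estimate φ q ω := by
  obtain ⟨-, h1, h2⟩ := h.not_run_mono hqr hq
  simp only [GAMS.Scheme.estimate, toScheme]
  rw [h1]
  exact Finset.sum_congr rfl fun n hn => by rw [h2 n hn]

omit h hN in
lemma halted_iterations {ω : Ω} (hω : (toScheme p X par).iterations ω ≠ ⊤) :
    (p.zmax : EReal) < levelAt p X par ((toScheme p X par).iterations ω).toNat ω := by
  obtain ⟨n, hn⟩ := exists_nat_of_ne_top hω
  rw [hn, ENat.toNat_natCast]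
  exact not_le.1 (firstTime_eq_coe_iff.1 hn).1

omit hN in
lemma tendsto_estimate (φ : (ℕ → S) → ℝ) {ω : Ω}
    (hω : (toScheme p X par).iterations ω ≠ ⊤) :
    Tendsto (fun q => (toScheme p X par).estimate φ q ω) atTop
      (𝓝 ((toScheme p X par).finalEstimate φ ω)) := by
  refine tendsto_const_nhds.congr' ?_
  filter_upwards [eventually_ge_atTop ((toScheme p X par).iterations ω).toNat] with r hr
  exact (h.estimate_of_halted φ hr (halted_iterations hω)).symm

variable (hA : MeasurableSet p.A) (hξ : Measurable p.ξ) (hk : 1 ≤ p.k)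

include hA hξ hk

omit hN in
lemma measurable_estimate {φ : (ℕ → S) → ℝ} (hφ : Measurable φ) (q : ℕ) :
    Measurable ((toScheme p X par).estimate φ q) := by
  have hs := h.isMeasurable_stateAt hA hξ hk q
  refine measurable_random_sum ((h.measurable_labelsAt hA hξ hk q).mono (H.le q) le_rfl) fun n => ?_
  exact ((hs.weight n).mono (H.le q) le_rfl).mul (hφ.comp (h.measurable_X hA hξ hk q n))

lemma integrable_estimate {φ : (ℕ → S) → ℝ} (hφ : Measurable φ) {C : ℝ}
    (hC : ∀ x, |φ x| ≤ C) (q : ℕ) : Integrable ((toScheme p X par).estimate φ q) μ :=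
  Integrable.of_bound (h.measurable_estimate hA hξ hk hφ q).aestronglyMeasurable C
    (ae_of_all _ fun ω => h.abs_estimate_le hN hC q ω)

variable (x₀ : S) (hπ : π = cont P p.A 0 fun _ => x₀)

include hπ

lemma isProbabilityMeasure_law : IsProbabilityMeasure π := by
  have := isMarkovKernel_cont P hA 0
  rw [hπ]
  infer_instance

lemma integral_estimate {φ : (ℕ → S) → ℝ} (hφ : Measurable φ) {C : ℝ}
    (hC : ∀ x, |φ x| ≤ C) (q : ℕ) :
    ∫ ω, (toScheme p X par).estimate φ q ω ∂μ = ∫ x, φ x ∂π := by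
  have hprob := h.isProbabilityMeasure_law hN hA hξ hk x₀ hπ
  have hφi : Integrable φ π := Integrable.of_bound hφ.aestronglyMeasurable C (ae_of_all _ hC)
  -- Adding a constant reduces to nonnegative functions, and it shifts the estimate by the same
  -- constant because the total mass is one.
  have hpos : ∀ x, 0 ≤ φ x + C := fun x => by have := neg_le_of_abs_le (hC x); linarith
  have hφ' : Measurable fun x => φ x + C := hφ.add_const C
  have hest : ∀ ω, 0 ≤ (toScheme p X par).estimate (fun x => φ x + C) q ω := fun ω =>
    Finset.sum_nonneg fun n _ => mul_nonneg ((h.valid hN q ω).weight_nonneg n) (hpos _)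
  have h1 := h.lintegral_estimateENN hA hξ hk hN x₀ hπ hφ'.ennreal_ofReal q
  simp_rw [h.estimateENN_eq_ofReal hN hpos] at h1
  have h2 : ∫ ω, (toScheme p X par).estimate (fun x => φ x + C) q ω ∂μ = ∫ x, φ x + C ∂π := by
    rw [integral_eq_lintegral_of_nonneg_ae (ae_of_all _ hest)
      (h.measurable_estimate hA hξ hk hφ' q).aestronglyMeasurable, h1,
      integral_eq_lintegral_of_nonneg_ae (ae_of_all _ hpos) hφ'.aestronglyMeasurable]
  simp_rw [h.estimate_add_const hN] at h2
  rw [integral_add (h.integrable_estimate hN hA hξ hk hφ hC q) (integrable_const C),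
    integral_add hφi (integrable_const C)] at h2
  simpa using h2

/-- The estimates are eventually equal to the final one and are bounded by `C`, so dominated
convergence applies. -/
lemma integral_finalEstimate (hfinite : ∀ᵐ ω ∂μ, (toScheme p X par).iterations ω ≠ ⊤)
    {φ : (ℕ → S) → ℝ} (hφ : Measurable φ) {C : ℝ} (hC : ∀ x, |φ x| ≤ C) :
    Integrable ((toScheme p X par).finalEstimate φ) μ ∧
      ∫ ω, (toScheme p X par).finalEstimate φ ω ∂μ = ∫ x, φ x ∂π := by
  have hlim : ∀ᵐ ω ∂μ, Tendsto (fun q => (toScheme p X par).estimate φ q ω) atTop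
      (𝓝 ((toScheme p X par).finalEstimate φ ω)) := by
    filter_upwards [hfinite] with ω hω
    exact h.tendsto_estimate φ hω
  have hm := fun q => (h.measurable_estimate hA hξ hk hφ q).aestronglyMeasurable (μ := μ)
  refine ⟨Integrable.of_bound (aestronglyMeasurable_of_tendsto_ae atTop hm hlim) C
    (ae_of_all _ fun ω => h.abs_estimate_le hN hC _ ω), ?_⟩
  have h1 := tendsto_integral_of_dominated_convergence (fun _ => C) hm (integrable_const C)
    (fun q => ae_of_all _ fun ω => h.abs_estimate_le hN hC q ω) hlim
  simp_rw [h.integral_estimate hN hA hξ hk x₀ hπ hφ hC] at h1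
  exact tendsto_nhds_unique h1 tendsto_const_nhds

-- Reaching `B` before `A` forces a value above `zmax`, which no retired replica has; their terms
-- vanish.
omit hπ hA hξ hk in
lemma pHat_eq_finalEstimate {B : Set S} (hBz : B ⊆ p.ξ ⁻¹' Set.Ioi p.zmax) (ω : Ω) :
    pHat p X par B ω = (toScheme p X par).finalEstimate
      ({x | hit B x < hit p.A x}.indicator fun _ => 1) ω := by
  rw [pHat, GAMS.Scheme.finalEstimate, GAMS.Scheme.estimate]
  set Q := ((toScheme p X par).iterations ω).toNat
  change _ = ∑ n ∈ (stateAt p X par Q ω).on ∪ (stateAt p X par Q ω).off,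
    (stateAt p X par Q ω).weight n * _
  rw [Finset.sum_union (h.valid hN Q ω).disjoint]
  refine (add_eq_left.2 (Finset.sum_eq_zero fun n hn => ?_)).symm
  rw [Set.indicator_of_notMem, mul_zero]
  intro hlt
  change hit B (X Q n ω) < hit p.A (X Q n ω) at hlt
  obtain ⟨t, ht⟩ := exists_nat_of_ne_top hlt.ne_top
  have h1 : X Q n ω t ∈ B := (firstTime_eq_coe_iff.1 ht).1
  have h2 : (p.zmax : EReal) < maxLevel p.A p.ξ (X Q n ω) := by
    refine lt_maxLevel_iff.2 ⟨t, ht ▸ hlt.le, ?_⟩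
    exact_mod_cast hBz h1
  exact absurd h2 (not_lt.2 (h.maxLevel_off_le Q ω n hn))

end Unbiased

end IsAMS

section Hit

variable {S : Type*} {A B : Set S}

/-- The comparison is decided by the values of the path up to its entrance in `A`. -/
lemma hit_lt_hit_stopIn (x : ℕ → S) :
    hit B (stopIn A x) < hit A (stopIn A x) ↔ hit B x < hit A x := by
  rw [hit_stopIn]
  have key : ∀ x y : ℕ → S, (∀ t : ℕ, (t : ℕ∞) ≤ hit A x → x t = y t) →
      hit B x < hit A x → hit B y < hit A x := by
    intro x y hxy hlt
    obtain ⟨t, ht⟩ := exists_nat_of_ne_top hlt.ne_top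
    have h1 : x t ∈ B := (firstTime_eq_coe_iff.1 ht).1
    have h2 : hit B y ≤ t := firstTime_le_iff.2 ⟨t, le_rfl, by rwa [← hxy t (ht ▸ hlt.le)]⟩
    exact h2.trans_lt (ht ▸ hlt)
  constructor
  · intro hlt
    rw [← hit_stopIn (A := A) (x := x)] at hlt
    have h1 := key (stopIn A x) x (fun t ht => stopIn_of_le_hit (by rwa [hit_stopIn] at ht)) hlt
    rwa [hit_stopIn] at h1
  · exact key x _ fun t ht => (stopIn_of_le_hit ht).symm

lemma measurableSet_hit_lt_hit [MeasurableSpace S] (hA : MeasurableSet A) (hB : MeasurableSet B) :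
    MeasurableSet {x : ℕ → S | hit B x < hit A x} :=
  (Set.to_countable {c : ℕ∞ × ℕ∞ | c.1 < c.2}).measurableSet.preimage
    ((measurable_hit hB).prodMk (measurable_hit hA))

end Hit

end AMS

namespace GAMS

/-! ### General properties of the σ-fields of the framework -/

section Fields

variable {Ω E : Type*}

lemma systemField_mono {filt : ℝ → MeasurableSpace E} (hf : Monotone filt) {I : Ω → Finset ℕ}
    {X : ℕ → Ω → E} {z z' : ℝ} (hz : z ≤ z') :
    systemField filt I X z ≤ systemField filt I X z' := by
  refine sup_le_sup le_rfl (MeasurableSpace.generateFrom_mono ?_)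
  rintro _ ⟨n, s, hs, rfl⟩
  exact ⟨n, s, hf hz s hs, rfl⟩

lemma systemField_le {m : MeasurableSpace Ω} [mE : MeasurableSpace E]
    {filt : ℝ → MeasurableSpace E} (hf : ∀ z, filt z ≤ mE) {I : Ω → Finset ℕ} {X : ℕ → Ω → E}
    (hI : Measurable I) (hX : ∀ n, Measurable (X n)) (z : ℝ) : systemField filt I X z ≤ m := by
  refine sup_le hI.comap_le (MeasurableSpace.generateFrom_le ?_)
  rintro _ ⟨n, s, hs, rfl⟩
  exact (AMS.measurableSet_mem_finset hI n).inter (hX n (hf z s hs))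

lemma stoppedField_le {m : MeasurableSpace Ω} {F : ℝ → MeasurableSpace Ω} {Z : Ω → EReal} :
    stoppedField m F Z ≤ m := MeasurableSpace.generateFrom_le fun _ hG => hG.1

lemma measurableSet_stoppedField {m : MeasurableSpace Ω} {F : ℝ → MeasurableSpace Ω}
    {Z : Ω → EReal} {G : Set Ω} (hG : MeasurableSet[m] G)
    (h : ∀ z : ℝ, MeasurableSet[F z] (G ∩ {ω | Z ω ≤ (z : EReal)})) :
    MeasurableSet[stoppedField m F Z] G :=
  MeasurableSpace.measurableSet_generateFrom ⟨hG, h⟩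

lemma measurableSet_stoppedField_of_forall {m : MeasurableSpace Ω} {F : ℝ → MeasurableSpace Ω}
    {Z : Ω → EReal} (hF : ∀ z, F z ≤ m) (hZ : IsStoppingLevel F Z) {G : Set Ω}
    (h : ∀ z : ℝ, MeasurableSet[F z] G) : MeasurableSet[stoppedField m F Z] G :=
  measurableSet_stoppedField (hF 0 _ (h 0)) fun z => MeasurableSet.inter (h z) (hZ z)

namespace Scheme

variable {D : Scheme Ω E} {m : MeasurableSpace Ω} {filt : ℝ → MeasurableSpace E}

lemma levelField_mono (hf : Monotone filt) (q : ℕ) : Monotone (D.levelField m filt q) := by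
  intro z z' hz
  cases q with
  | zero => exact systemField_mono hf hz
  | succ q => exact sup_le_sup le_rfl (systemField_mono hf hz)

lemma systemField_le_levelField (q : ℕ) (z : ℝ) :
    systemField filt (D.labels q) (D.X q) z ≤ D.levelField m filt q z := by
  cases q with
  | zero => exact le_rfl
  | succ q => exact le_sup_right

lemma measurable_labels_levelField (q : ℕ) (z : ℝ) :
    Measurable[D.levelField m filt q z] (D.labels q) :=
  Measurable.of_comap_le (le_sup_left.trans (systemField_le_levelField q z))

lemma measurableSet_levelField (q : ℕ) {z : ℝ} (n : ℕ) {s : Set E} (hs : MeasurableSet[filt z] s) :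
    MeasurableSet[D.levelField m filt q z] {ω | n ∈ D.labels q ω ∧ D.X q n ω ∈ s} :=
  (le_sup_right.trans (systemField_le_levelField q z)) _
    (MeasurableSpace.measurableSet_generateFrom ⟨n, s, hs, rfl⟩)

end Scheme

end Fields

/-- The σ-field of the sets whose intersection with `T` is measurable. -/
@[reducible]
def traceOn {Ω : Type*} (m : MeasurableSpace Ω) {T : Set Ω} (hT : MeasurableSet[m] T) :
    MeasurableSpace Ω where
  MeasurableSet' G := MeasurableSet[m] (G ∩ T)
  measurableSet_empty := by rw [Set.empty_inter]; exact MeasurableSet.empty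
  measurableSet_compl G hG := by
    have h1 : Gᶜ ∩ T = T \ (G ∩ T) := by
      ext ω
      simp only [Set.mem_inter_iff, Set.mem_compl_iff, Set.mem_sdiff]
      tauto
    rw [h1]
    exact MeasurableSet.diff hT hG
  measurableSet_iUnion f hf := by
    rw [Set.iUnion_inter]
    exact MeasurableSet.iUnion hf

end GAMS

namespace AMS

namespace IsAMS

/-! ### The σ-fields of a run, compared with the history -/

section Fields

variable {S Ω : Type*} {p : Params S} {X : ℕ → ℕ → Ω → ℕ → S} {par : ℕ → ℕ → Ω → ℕ}
  [mΩ : MeasurableSpace Ω] [MeasurableSpace S] {P : Kernel S S}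
  [IsMarkovKernel P] {π : Measure (ℕ → S)} {μ : Measure Ω} [IsProbabilityMeasure μ]
  {H : Filtration ℕ mΩ} (h : IsAMS p X par P π μ H) (hA : MeasurableSet p.A)
  (hξ : Measurable p.ξ) (hk : 1 ≤ p.k) (hN : 0 < p.nrep)

include h hA hξ hk hN

lemma measurable_parentMap (q n : ℕ) :
    Measurable[H (q + 1)] ((toScheme p X par).parentMap q n) := by
  have hnew := (h.measurable_newAt hA hξ hk q).mono (H.mono (Nat.le_succ q)) le_rfl
  have hlab := (h.measurable_labelsAt hA hξ hk q).mono (H.mono (Nat.le_succ q)) le_rfl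
  have h1 : (toScheme p X par).parentMap q n = fun ω => if n ∈ newAt p X par q ω then par q n ω
      else if n ∈ (stateAt p X par q ω).on ∪ (stateAt p X par q ω).off then n else 0 := by
    ext ω
    rw [GAMS.Scheme.parentMap, h.newLabels_eq hN, killed_eq, Finset.sdiff_empty]
    rfl
  rw [h1]
  exact Measurable.ite (measurableSet_mem_finset hnew n) (h.par_adapted q n)
    (Measurable.ite (measurableSet_mem_finset hlab n) measurable_const measurable_const)

lemma parentField_le_history (q : ℕ) : (toScheme p X par).parentField q ≤ H (q + 1) :=
  iSup_le fun n => (h.measurable_parentMap hA hξ hk hN q n).comap_le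

lemma systemField_le_history (q : ℕ) (z : ℝ) :
    GAMS.systemField (levelFilt p.A p.ξ) ((toScheme p X par).labels q)
      ((toScheme p X par).X q) z ≤ H q :=
  GAMS.systemField_le (fun z => levelFilt_le hA hξ z) (h.measurable_labelsAt hA hξ hk q)
    (h.X_adapted q) z

lemma levelField_le (q : ℕ) (z : ℝ) :
    (toScheme p X par).levelField mΩ (levelFilt p.A p.ξ) q z ≤ mΩ := by
  have h1 := fun q => (h.systemField_le_history hA hξ hk hN q z).trans (H.le q)
  cases q with
  | zero => exact h1 0
  | succ q => exact sup_le (sup_le GAMS.stoppedField_le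
      ((h.parentField_le_history hA hξ hk hN q).trans (H.le _))) (h1 _)

omit h hk hN in
lemma measurableSet_lt_maxLevel_levelFilt (z : ℝ) :
    MeasurableSet[levelFilt p.A p.ξ z] {x | (z : EReal) < maxLevel p.A p.ξ x} := by
  simp only [lt_maxLevel_iff_levelTime_ne_top]
  exact (measurable_levelTime_levelFilt hA hξ le_rfl (measurableSet_singleton ⊤)).compl

/-- The part of a history before the algorithm stops with an infinite level. -/
lemma measurableSet_level_lt_top (q : ℕ) :
    MeasurableSet[H q] {ω | levelAt p X par q ω < ⊤} :=
  measurableSet_lt (h.measurable_levelAt hA hξ hk q) measurable_const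

/-- Where the level is infinite, the stopped field puts no restriction on an event. Where it is
finite, an event is the countable union of its parts with level at most an integer, and each part is
known from a level field. -/
lemma field_le_traceOn_of (q : ℕ)
    (hq : ∀ z, (toScheme p X par).levelField mΩ (levelFilt p.A p.ξ) q z ≤
      GAMS.traceOn (H q) (h.measurableSet_level_lt_top hA hξ hk hN q)) :
    (toScheme p X par).field mΩ (levelFilt p.A p.ξ) q ≤
      GAMS.traceOn (H q) (h.measurableSet_level_lt_top hA hξ hk hN q) := by
  refine MeasurableSpace.generateFrom_le fun G hG => ?_
  have h1 : G ∩ {ω | levelAt p X par q ω < ⊤} =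
      ⋃ k : ℕ, G ∩ {ω | levelAt p X par q ω ≤ ((k : ℝ) : EReal)} ∩
        {ω | levelAt p X par q ω < ⊤} := by
    ext ω
    simp only [Set.mem_inter_iff, Set.mem_iUnion, Set.mem_ofPred_eq]
    constructor
    · rintro ⟨h2, h3⟩
      obtain ⟨k, hk⟩ := exists_nat_ge (levelAt p X par q ω).toReal
      exact ⟨k, ⟨h2, (EReal.le_coe_toReal h3.ne).trans (EReal.coe_le_coe_iff.2 hk)⟩, h3⟩
    · rintro ⟨k, ⟨h2, -⟩, h3⟩
      exact ⟨h2, h3⟩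
  change MeasurableSet[H q] (G ∩ {ω | levelAt p X par q ω < ⊤})
  rw [h1]
  exact MeasurableSet.iUnion fun k => hq k _ (hG.2 k)

lemma levelField_le_traceOn (q : ℕ) (z : ℝ) :
    (toScheme p X par).levelField mΩ (levelFilt p.A p.ξ) q z ≤
      GAMS.traceOn (H q) (h.measurableSet_level_lt_top hA hξ hk hN q) := by
  have hsub : ∀ q, H q ≤ GAMS.traceOn (H q) (h.measurableSet_level_lt_top hA hξ hk hN q) :=
    fun q G hG => MeasurableSet.inter hG (h.measurableSet_level_lt_top hA hξ hk hN q)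
  have h1 := fun q => (h.systemField_le_history hA hξ hk hN q z).trans (hsub q)
  induction q generalizing z with
  | zero => exact h1 0
  | succ q ih =>
    refine sup_le (sup_le ?_ ((h.parentField_le_history hA hξ hk hN q).trans (hsub _))) (h1 _)
    intro G hG
    have h2 := h.field_le_traceOn_of hA hξ hk hN q (fun z => ih z fun q =>
      (h.systemField_le_history hA hξ hk hN q z).trans (hsub q)) G hG
    -- A finite level at iteration `q + 1` forces a finite one at `q`, since an infinite level
    -- freezes the algorithm.
    have h3 : G ∩ {ω | levelAt p X par (q + 1) ω < ⊤} =
        G ∩ {ω | levelAt p X par q ω < ⊤} ∩ {ω | levelAt p X par (q + 1) ω < ⊤} := by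
      ext ω
      simp only [Set.mem_inter_iff, Set.mem_ofPred_eq]
      refine ⟨fun h4 => ⟨⟨h4.1, ?_⟩, h4.2⟩, fun h4 => ⟨h4.1.1, h4.2⟩⟩
      by_contra h5
      have h6 : levelAt p X par q ω = ⊤ := not_lt_top_iff.1 h5
      have h7 : levelAt p X par (q + 1) ω = ⊤ := by
        rw [h.levelAt_succ_of_lt (by rw [h6]; exact EReal.coe_lt_top _), h6]
      exact h4.2.ne h7
    change MeasurableSet[H (q + 1)] (G ∩ {ω | levelAt p X par (q + 1) ω < ⊤})
    rw [h3]
    exact (H.mono (Nat.le_succ q) _ h2).inter (h.measurableSet_level_lt_top hA hξ hk hN (q + 1))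

lemma field_le_traceOn (q : ℕ) :
    (toScheme p X par).field mΩ (levelFilt p.A p.ξ) q ≤
      GAMS.traceOn (H q) (h.measurableSet_level_lt_top hA hξ hk hN q) :=
  h.field_le_traceOn_of hA hξ hk hN q fun z => h.levelField_le_traceOn hA hξ hk hN q z

/-! ### The levels are stopping levels -/

lemma measurable_lt_maxLevel_levelField {q : ℕ} {z : ℝ}
    (hon : Measurable[(toScheme p X par).levelField mΩ (levelFilt p.A p.ξ) q z]
      fun ω => (stateAt p X par q ω).on) :
    Measurable[(toScheme p X par).levelField mΩ (levelFilt p.A p.ξ) q z] fun ω =>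
      (stateAt p X par q ω).on.filter fun n => (z : EReal) < maxLevel p.A p.ξ (X q n ω) := by
  refine measurable_finset fun n => ?_
  have h1 := (toScheme p X par).measurableSet_levelField (m := mΩ) (filt := levelFilt p.A p.ξ) q n
    (measurableSet_lt_maxLevel_levelFilt hA hξ z)
  have h2 := (measurableSet_mem_finset hon n).inter h1
  convert h2 using 1
  ext ω
  simp only [Finset.mem_filter, Set.mem_ofPred_eq, Set.mem_inter_iff]
  exact ⟨fun h3 => ⟨h3.1, Finset.mem_union_left _ h3.1, h3.2⟩, fun h3 => ⟨h3.1, h3.2.2⟩⟩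

-- The level is at most `z` when, at some threshold `r ≤ z`, at least `k` replicas are at or below
-- `r` and one is above it. If the replica above the level is not above `z`, a rational threshold
-- below `z` separates them. Countably many events, each known at its own level, thus suffice.
omit hA hξ in
lemma level_le_iff (q : ℕ) (ω : Ω) (z : ℝ) : levelAt p X par q ω ≤ z ↔
    ∃ r : ℝ, (r = z ∨ r < z ∧ ∃ a : ℚ, (a : ℝ) = r) ∧
      p.k ≤ ((stateAt p X par q ω).on \ (stateAt p X par q ω).on.filter fun n =>
        (r : EReal) < maxLevel p.A p.ξ (X q n ω)).card ∧
      ((stateAt p X par q ω).on.filter fun n =>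
        (r : EReal) < maxLevel p.A p.ξ (X q n ω)).Nonempty := by
  have hcard := (h.valid hN q ω).card_on
  set on := (stateAt p X par q ω).on with hon
  have hlev : levelAt p X par q ω = p.level on fun n => X q n ω := rfl
  rw [hlev]
  have hdiff : ∀ r : EReal, (on \ on.filter fun n => r < maxLevel p.A p.ξ (X q n ω)) =
      on.filter fun n => maxLevel p.A p.ξ (X q n ω) ≤ r := fun r => by
    ext n
    simp only [Finset.mem_sdiff, Finset.mem_filter, not_and, not_lt]
    exact ⟨fun h1 => ⟨h1.1, h1.2 h1.1⟩, fun h1 => ⟨h1.1, fun _ => h1.2⟩⟩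
  have hord : ∀ r : ℝ, p.k ≤ (on \ on.filter fun n =>
      (r : EReal) < maxLevel p.A p.ξ (X q n ω)).card ↔
      orderStat p.k on (fun n => maxLevel p.A p.ξ (X q n ω)) ≤ (r : EReal) := fun r => by
    rw [orderStat_le_iff hk on _ (EReal.coe_ne_top r), hdiff]
  simp only [hord]
  constructor
  · intro hle
    have htop := ne_top_of_le_ne_top (EReal.coe_ne_top z) hle
    have hL := p.level_eq_orderStat htop
    obtain ⟨n, hn, hgt⟩ : ∃ n ∈ on, p.level on (fun n => X q n ω) <
        maxLevel p.A p.ξ (X q n ω) := by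
      by_contra! hall
      refine p.card_filter_ne htop ?_
      rw [Finset.filter_true_of_mem hall, hcard]
    by_cases hz : (z : EReal) < maxLevel p.A p.ξ (X q n ω)
    · exact ⟨z, Or.inl rfl, hL ▸ hle, n, Finset.mem_filter.2 ⟨hn, hz⟩⟩
    · obtain ⟨a, ha1, ha2⟩ := EReal.lt_iff_exists_rat_btwn.1 hgt
      refine ⟨a, Or.inr ⟨?_, a, rfl⟩, hL ▸ ha1.le, n, Finset.mem_filter.2 ⟨hn, ha2⟩⟩
      exact EReal.coe_lt_coe_iff.1 (ha2.trans_le (not_lt.1 hz))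
  · rintro ⟨r, hr, hLr, n, hn⟩
    obtain ⟨hn, hgt⟩ := Finset.mem_filter.1 hn
    have hrz : (r : EReal) ≤ z := EReal.coe_le_coe_iff.2 (hr.elim le_of_eq fun h1 => h1.1.le)
    refine le_trans ?_ (hLr.trans hrz)
    rw [Params.level]
    refine (if_neg fun h1 => ?_).le
    rw [← hcard] at h1
    have h2 := Finset.filter_eq_self.1 (Finset.eq_of_subset_of_card_le (Finset.filter_subset _ _)
      h1.ge) n hn
    exact absurd (hLr.trans_lt hgt) (not_lt.2 h2)

lemma isStoppingLevel_of {q : ℕ}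
    (hon : ∀ z, Measurable[(toScheme p X par).levelField mΩ (levelFilt p.A p.ξ) q z]
      fun ω => (stateAt p X par q ω).on) :
    GAMS.IsStoppingLevel ((toScheme p X par).levelField mΩ (levelFilt p.A p.ξ) q)
      (levelAt p X par q) := by
  intro z
  set T : ℝ → Set Ω := fun r => {ω | p.k ≤ ((stateAt p X par q ω).on \
      (stateAt p X par q ω).on.filter fun n => (r : EReal) < maxLevel p.A p.ξ (X q n ω)).card ∧
    ((stateAt p X par q ω).on.filter fun n =>
      (r : EReal) < maxLevel p.A p.ξ (X q n ω)).Nonempty} with hT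
  have hTm : ∀ r ≤ z, MeasurableSet[(toScheme p X par).levelField mΩ (levelFilt p.A p.ξ) q z]
      (T r) := by
    intro r hr
    have h1 := h.measurable_lt_maxLevel_levelField hA hξ hk hN (hon r)
    refine (GAMS.Scheme.levelField_mono (levelFilt_mono hA hξ) q hr) _ (MeasurableSet.inter ?_ ?_)
    · exact (measurable_finset_binop (hon r) h1 fun a b => (a \ b).card)
        (measurableSet_Ici (a := p.k))
    · exact h1 (MeasurableSet.of_discrete (s := {t : Finset ℕ | t.Nonempty}))
  have h1 : {ω | levelAt p X par q ω ≤ (z : EReal)} =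
      T z ∪ ⋃ a : ℚ, ⋃ _ : (a : ℝ) < z, T a := by
    ext ω
    simp only [Set.mem_ofPred_eq, h.level_le_iff hk hN, Set.mem_union, Set.mem_iUnion]
    constructor
    · rintro ⟨r, rfl | ⟨hr, a, rfl⟩, h2⟩
      · exact Or.inl h2
      · exact Or.inr ⟨a, hr, h2⟩
    · rintro (h2 | ⟨a, ha, h2⟩)
      · exact ⟨z, Or.inl rfl, h2⟩
      · exact ⟨a, Or.inr ⟨ha, a, rfl⟩, h2⟩
  rw [h1]
  exact (hTm z le_rfl).union (.iUnion fun a => .iUnion fun ha => hTm a ha.le)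

section Field

variable {q : ℕ}
    (hon : ∀ z, Measurable[(toScheme p X par).levelField mΩ (levelFilt p.A p.ξ) q z]
      fun ω => (stateAt p X par q ω).on)

include hon

lemma measurableSet_field_of_forall {G : Set Ω}
    (hG : ∀ z, MeasurableSet[(toScheme p X par).levelField mΩ (levelFilt p.A p.ξ) q z] G) :
    MeasurableSet[(toScheme p X par).field mΩ (levelFilt p.A p.ξ) q] G :=
  GAMS.measurableSet_stoppedField_of_forall (h.levelField_le hA hξ hk hN q)
    (h.isStoppingLevel_of hA hξ hk hN hon) hG

lemma measurable_on_field : Measurable[(toScheme p X par).field mΩ (levelFilt p.A p.ξ) q]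
    fun ω => (stateAt p X par q ω).on :=
  measurable_finset fun n => h.measurableSet_field_of_forall hA hξ hk hN hon fun z =>
    measurableSet_mem_finset (hon z) n

lemma measurable_labels_field : Measurable[(toScheme p X par).field mΩ (levelFilt p.A p.ξ) q]
    fun ω => (stateAt p X par q ω).on ∪ (stateAt p X par q ω).off :=
  measurable_finset fun n => h.measurableSet_field_of_forall hA hξ hk hN hon fun z =>
    measurableSet_mem_finset (GAMS.Scheme.measurable_labels_levelField q z) n

lemma measurableSet_run_field :
    MeasurableSet[(toScheme p X par).field mΩ (levelFilt p.A p.ξ) q]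
      {ω | levelAt p X par q ω ≤ (p.zmax : EReal)} := by
  have hZ := h.isStoppingLevel_of hA hξ hk hN hon
  refine GAMS.measurableSet_stoppedField (h.levelField_le hA hξ hk hN q _ _ (hZ p.zmax))
    fun z => ?_
  have h1 : {ω | levelAt p X par q ω ≤ (p.zmax : EReal)} ∩ {ω | levelAt p X par q ω ≤ (z : EReal)} =
      {ω | levelAt p X par q ω ≤ ((min p.zmax z : ℝ) : EReal)} := by
    ext ω
    simp only [Set.mem_inter_iff, Set.mem_ofPred_eq, ← le_min_iff]
    rw [EReal.coe_strictMono.monotone.map_min]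
  have h2 := GAMS.Scheme.levelField_mono (D := toScheme p X par) (m := mΩ)
    (levelFilt_mono hA hξ) q (min_le_right p.zmax z) _ (hZ (min p.zmax z))
  rw [← h1] at h2
  exact h2

/-- As for the stopping property, a replica that is above the current level but not above `z` is
separated from that level by a rational. -/
lemma measurable_onGt_field : Measurable[(toScheme p X par).field mΩ (levelFilt p.A p.ξ) q]
    (onGtAt p X par q) := by
  have hZ := h.isStoppingLevel_of hA hξ hk hN hon
  refine measurable_finset fun n => GAMS.measurableSet_stoppedField
    (measurableSet_mem_finset ((h.measurable_onGtAt hA hξ hk q).mono (H.le q) le_rfl) n)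
    fun z => ?_
  set T : ℝ → Set Ω := fun r => {ω | levelAt p X par q ω ≤ (r : EReal)} ∩
    {ω | n ∈ (stateAt p X par q ω).on.filter fun n =>
      (r : EReal) < maxLevel p.A p.ξ (X q n ω)} with hT
  have hTm : ∀ r ≤ z, MeasurableSet[(toScheme p X par).levelField mΩ (levelFilt p.A p.ξ) q z]
      (T r) := fun r hr => (GAMS.Scheme.levelField_mono (levelFilt_mono hA hξ) q hr) _
    (MeasurableSet.inter (hZ r)
      (measurableSet_mem_finset (h.measurable_lt_maxLevel_levelField hA hξ hk hN (hon r)) n))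
  have h1 : {ω | n ∈ onGtAt p X par q ω} ∩ {ω | levelAt p X par q ω ≤ (z : EReal)} =
      T z ∪ ⋃ a : ℚ, ⋃ _ : (a : ℝ) < z, T a := by
    ext ω
    simp only [hT, Set.mem_inter_iff, Set.mem_union, Set.mem_iUnion, Set.mem_ofPred_eq,
      Finset.mem_filter]
    have hmem : n ∈ onGtAt p X par q ω ↔ n ∈ (stateAt p X par q ω).on ∧
        levelAt p X par q ω < maxLevel p.A p.ξ (X q n ω) := Finset.mem_filter
    rw [hmem]
    constructor
    · rintro ⟨⟨h2, h3⟩, h4⟩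
      by_cases h5 : (z : EReal) < maxLevel p.A p.ξ (X q n ω)
      · exact Or.inl ⟨h4, h2, h5⟩
      · obtain ⟨a, ha1, ha2⟩ := EReal.lt_iff_exists_rat_btwn.1 h3
        exact Or.inr ⟨a, EReal.coe_lt_coe_iff.1 (ha2.trans_le (not_lt.1 h5)), ha1.le, h2, ha2⟩
    · rintro (⟨h2, h3, h4⟩ | ⟨a, ha, h2, h3, h4⟩)
      · exact ⟨⟨h3, h2.trans_lt h4⟩, h2⟩
      · exact ⟨⟨h3, h2.trans_lt h4⟩, h2.trans (EReal.coe_le_coe_iff.2 ha.le)⟩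
  have h2 := (hTm z le_rfl).union
    (.iUnion fun a : ℚ => .iUnion fun ha : (a : ℝ) < z => hTm a ha.le)
  rw [← h1] at h2
  exact h2

lemma measurable_new_field : Measurable[(toScheme p X par).field mΩ (levelFilt p.A p.ξ) q]
    (newAt p X par q) := by
  have h1 := h.measurable_on_field hA hξ hk hN hon
  have h2 := h.measurable_labels_field hA hξ hk hN hon
  have h3 := h.measurable_onGt_field hA hξ hk hN hon
  have h4 : newAt p X par q = fun ω => if levelAt p X par q ω ≤ (p.zmax : EReal) then
      Finset.Icc (((stateAt p X par q ω).on ∪ (stateAt p X par q ω).off).card + 1)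
        (((stateAt p X par q ω).on ∪ (stateAt p X par q ω).off).card +
          ((stateAt p X par q ω).on \ onGtAt p X par q ω).card) else ∅ := by
    ext1 ω
    -- The retired replicas are the complement of the survivors, so their number is known from sets
    -- already shown to be measurable.
    have h5 : (stateAt p X par q ω).on \ onGtAt p X par q ω =
        p.onLe (stateAt p X par q ω) fun n => X q n ω := by
      conv_lhs => rw [← p.onLe_union_onGt (s := stateAt p X par q ω) (x := fun n => X q n ω)]
      exact Finset.union_sdiff_cancel_right p.disjoint_onLe_onGt
    rw [h5]
    by_cases hlt : (p.zmax : EReal) < levelAt p X par q ω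
    · rw [newAt_of_lt hlt, if_neg (not_le.2 hlt)]
    · rw [if_pos (not_lt.1 hlt)]
      exact if_neg hlt
  rw [h4]
  exact Measurable.ite (h.measurableSet_run_field hA hξ hk hN hon)
    (measurable_finset_binop h2 (measurable_finset_binop h1 h3 fun a b => a \ b)
      fun a b => Finset.Icc (a.card + 1) (a.card + b.card)) measurable_const

end Field

/-- Removes the assumption `hon` of the preceding lemmas by induction: the next working labels are
functions of sets measurable for the stopped field. -/
lemma measurable_on_levelField (q : ℕ) (z : ℝ) :
    Measurable[(toScheme p X par).levelField mΩ (levelFilt p.A p.ξ) q z]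
      fun ω => (stateAt p X par q ω).on := by
  induction q generalizing z with
  | zero => exact measurable_const
  | succ q ih =>
    have h1 := h.measurable_on_field hA hξ hk hN ih
    have h3 := h.measurable_onGt_field hA hξ hk hN ih
    have h4 := h.measurable_new_field hA hξ hk hN ih
    have h5 : (fun ω => (stateAt p X par (q + 1) ω).on) = fun ω =>
        if levelAt p X par q ω ≤ (p.zmax : EReal) then onGtAt p X par q ω ∪ newAt p X par q ω
        else (stateAt p X par q ω).on := by
      ext1 ω
      by_cases hlt : (p.zmax : EReal) < levelAt p X par q ω
      · rw [if_neg (not_le.2 hlt), stateAt_succ_of_lt hlt]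
      · rw [if_pos (not_lt.1 hlt), stateAt_succ, p.step_on hlt]
        rfl
    rw [h5]
    exact (Measurable.ite (h.measurableSet_run_field hA hξ hk hN ih)
      (measurable_finset_binop h3 h4 fun a b => a ∪ b) h1).mono
        (le_sup_left.trans le_sup_left) le_rfl

end Fields

end IsAMS

end AMS

namespace AMS

/-- Transfers a conditional mean from `m₁` to `m₂` without inclusion of one in the other: on `T` the
events of `m₂` belong to `m₁`, and off `T` the function already equals its conditional mean. -/
lemma condExp_toReal_of_trace {Ω : Type*} {m₁ m₂ mΩ : MeasurableSpace Ω} {μ : Measure Ω}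
    [IsFiniteMeasure μ] (hm₁ : m₁ ≤ mΩ) (hm₂ : m₂ ≤ mΩ) {T : Set Ω} (hT : MeasurableSet[m₁] T)
    (htr : m₂ ≤ GAMS.traceOn m₁ hT) {f g : Ω → ℝ≥0∞} (hf : Measurable f)
    (hfi : ∫⁻ ω, f ω ∂μ ≠ ∞) (hg : Measurable[m₂] g)
    (hfg : ∀ A, MeasurableSet[m₁] A → ∫⁻ ω in A, f ω ∂μ = ∫⁻ ω in A, g ω ∂μ)
    (heq : ∀ ω ∉ T, f ω = g ω) :
    μ[fun ω => (f ω).toReal | m₂] =ᵐ[μ] fun ω => (g ω).toReal := by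
  have hg' : Measurable g := hg.mono hm₂ le_rfl
  have hgi : ∫⁻ ω, g ω ∂μ ≠ ∞ := by
    have h1 := hfg Set.univ MeasurableSet.univ
    rw [setLIntegral_univ, setLIntegral_univ] at h1
    rwa [← h1]
  have hG : ∀ G, MeasurableSet[m₂] G → ∫⁻ ω in G, f ω ∂μ = ∫⁻ ω in G, g ω ∂μ := by
    intro G hG
    have h1 : MeasurableSet[m₁] (G ∩ T) := htr G hG
    rw [← lintegral_inter_add_sdiff f G (hm₁ T hT), ← lintegral_inter_add_sdiff g G (hm₁ T hT),
      hfg _ h1]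
    congr 1
    exact setLIntegral_congr_fun ((hm₂ G hG).diff (hm₁ T hT)) fun ω hω => heq ω hω.2
  refine (ae_eq_condExp_of_forall_setIntegral_eq hm₂
    (integrable_toReal_of_lintegral_ne_top hf.aemeasurable hfi)
    (fun G _ _ => (integrable_toReal_of_lintegral_ne_top hg'.aemeasurable hgi).integrableOn)
    (fun G hGm _ => ?_) (hg.ennreal_toReal.stronglyMeasurable.aestronglyMeasurable)).symm
  rw [integral_toReal hg'.aemeasurable (ae_restrict_of_ae (ae_lt_top hg' hgi)),
    integral_toReal hf.aemeasurable (ae_restrict_of_ae (ae_lt_top hf hfi)), hG G hGm]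

namespace IsAMS

/-! ### Conditional laws of parents, branching numbers and new replicas -/

section Sampled

variable {S Ω : Type*} {p : Params S} {X : ℕ → ℕ → Ω → ℕ → S} {par : ℕ → ℕ → Ω → ℕ}
  {m : MeasurableSpace Ω} [mΩ : MeasurableSpace Ω] [MeasurableSpace S] {P : Kernel S S}
  [IsMarkovKernel P] {π : Measure (ℕ → S)} {μ : Measure Ω} [IsProbabilityMeasure μ]
  {H : Filtration ℕ mΩ} (h : IsAMS p X par P π μ H) (hA : MeasurableSet p.A)
  (hξ : Measurable p.ξ) (hk : 1 ≤ p.k) (hN : 0 < p.nrep)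

include h hA hξ hk hN

lemma newAt_of_level_top {q : ℕ} {ω : Ω} (hω : ω ∉ {ω | levelAt p X par q ω < ⊤}) :
    newAt p X par q ω = ∅ := by
  have h1 : levelAt p X par q ω = ⊤ := not_lt_top_iff.1 hω
  exact newAt_of_lt (by rw [h1]; exact EReal.coe_lt_top _)

section Conditional

variable (hm : m ≤ mΩ) {q : ℕ}
  (htr : m ≤ GAMS.traceOn (H q) (h.measurableSet_level_lt_top hA hξ hk hN q))
  (hnew : Measurable[m] (newAt p X par q)) (hgt : Measurable[m] (onGtAt p X par q))

include hm htr hnew hgt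

/-- The formula involves only label sets. Leaving `m` free gives it both for the history and for the
stopped field. -/
lemma condExp_parentMap (hlab : Measurable[m] fun ω =>
      (stateAt p X par q ω).on ∪ (stateAt p X par q ω).off) (a : ℕ → ℕ) :
    μ⟦{ω | ∀ n, (toScheme p X par).parentMap q n ω = a n} | m⟧ =ᵐ[μ] fun ω =>
      ({ω | ∀ n ∉ newAt p X par q ω, a n =
          if n ∈ (stateAt p X par q ω).on ∪ (stateAt p X par q ω).off then n else 0}.indicator
        (fun ω => ∏ n ∈ newAt p X par q ω,
          (if a n ∈ onGtAt p X par q ω then ((onGtAt p X par q ω).card : ℝ≥0∞)⁻¹ else 0)) ω).toReal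
      := by
  -- The part of the event that concerns labels other than the new ones; it is determined by the
  -- past.
  set C : Set Ω := {ω | ∀ n ∉ newAt p X par q ω, a n =
    if n ∈ (stateAt p X par q ω).on ∪ (stateAt p X par q ω).off then n else 0} with hC
  set E : Set Ω := {ω | ∀ n ∈ newAt p X par q ω, par q n ω = a n} with hE
  have hCm : ∀ {m : MeasurableSpace Ω}, Measurable[m] (newAt p X par q) →
      (Measurable[m] fun ω => (stateAt p X par q ω).on ∪ (stateAt p X par q ω).off) →
      MeasurableSet[m] C := fun h1 h2 =>
    (measurable_finset_binop h1 h2 fun s t => ∀ n ∉ s, a n = if n ∈ t then n else 0)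
      (MeasurableSet.of_discrete (s := {b : Prop | b}))
  have hEm : MeasurableSet E := h.measurableSet_par_eq hA hξ hk q a
  have hCH : MeasurableSet[H q] C :=
    hCm (h.measurable_newAt hA hξ hk q) (h.measurable_labelsAt hA hξ hk q)
  have hF : {ω | ∀ n, (toScheme p X par).parentMap q n ω = a n} = C ∩ E := by
    ext ω
    have hold : ∀ n ∉ newAt p X par q ω, (toScheme p X par).parentMap q n ω =
        if n ∈ (stateAt p X par q ω).on ∪ (stateAt p X par q ω).off then n else 0 := by
      intro n hn
      by_cases h1 : n ∈ (stateAt p X par q ω).on ∪ (stateAt p X par q ω).off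
      · rw [h.parentMap_of_old hN h1, if_pos h1]
      · rw [h.parentMap_of_notMem hN hn h1, if_neg h1]
    simp only [Set.mem_ofPred_eq, Set.mem_inter_iff, hC, hE]
    constructor
    · exact fun h1 => ⟨fun n hn => by rw [← h1 n, hold n hn],
        fun n hn => by rw [← h1 n, h.parentMap_of_new hN hn]⟩
    · rintro ⟨h1, h2⟩ n
      by_cases hn : n ∈ newAt p X par q ω
      · rw [h.parentMap_of_new hN hn, h2 n hn]
      · rw [hold n hn, h1 n hn]
  have hind : (fun ω => ((C ∩ E).indicator (fun _ => (1 : ℝ≥0∞)) ω).toReal) =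
      (C ∩ E).indicator fun _ => (1 : ℝ) := by
    ext ω
    by_cases hω : ω ∈ C ∩ E <;> simp [Set.indicator, hω]
  rw [hF, ← hind]
  refine condExp_toReal_of_trace (H.le q) hm (h.measurableSet_level_lt_top hA hξ hk hN q) htr
    (measurable_const.indicator ((H.le q _ hCH).inter hEm)) ?_ ?_ ?_ ?_
  · rw [lintegral_indicator ((H.le q _ hCH).inter hEm)]
    simp
  · exact (measurable_finset_binop hnew hgt fun s t =>
      ∏ n ∈ s, if a n ∈ t then (t.card : ℝ≥0∞)⁻¹ else 0).indicator (hCm hnew hlab)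
  · intro A hAm
    have h1 := h.lintegral_par_eq hA hξ hk q a
      (U := (A ∩ C).indicator fun _ => (1 : ℝ≥0∞))
      (measurable_const.indicator (MeasurableSet.inter hAm hCH))
    have hAC : MeasurableSet (A ∩ C) := (H.le q _ hAm).inter (H.le q _ hCH)
    calc _ = ∫⁻ ω in E, (A ∩ C).indicator (fun _ => (1 : ℝ≥0∞)) ω ∂μ := by
          rw [← lintegral_indicator (H.le q _ hAm), ← lintegral_indicator hEm]
          refine lintegral_congr fun ω => ?_
          by_cases h1 : ω ∈ A <;> by_cases h2 : ω ∈ C <;> by_cases h3 : ω ∈ E <;>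
            simp [Set.indicator, h1, h2, h3]
      _ = _ := by
          rw [h1, ← lintegral_indicator (H.le q _ hAm)]
          refine lintegral_congr fun ω => ?_
          by_cases h1 : ω ∈ A <;> by_cases h2 : ω ∈ C <;> simp [Set.indicator, h1, h2]
  · intro ω hω
    have h1 := h.newAt_of_level_top hA hξ hk hN hω
    have h2 : ω ∈ E := fun n hn => by rw [h1] at hn; simp at hn
    by_cases h3 : ω ∈ C <;> simp [Set.indicator, h2, h3, h1]

/-- Each new label chooses a given survivor with probability one over the number of survivors, and
never chooses another label. -/
lemma condExp_branch (n : ℕ) :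
    μ[fun ω => ((toScheme p X par).branch q n ω : ℝ) | m] =ᵐ[μ] fun ω =>
      1 + if n ∈ onGtAt p X par q ω then
        ((newAt p X par q ω).card : ℝ) / (onGtAt p X par q ω).card else 0 := by
  set r : ℕ → Ω → ℝ≥0∞ := fun n' ω => if par q n' ω = n then 1 else 0 with hr
  set w : Ω → ℝ≥0∞ := fun ω =>
    if n ∈ onGtAt p X par q ω then ((onGtAt p X par q ω).card : ℝ≥0∞)⁻¹ else 0 with hw
  have hwm : ∀ {m : MeasurableSpace Ω}, Measurable[m] (onGtAt p X par q) → Measurable[m] w :=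
    fun h1 => measurable_finset_op h1 fun t => if n ∈ t then (t.card : ℝ≥0∞)⁻¹ else 0
  have hnewm : Measurable (newAt p X par q) := hnew.mono hm le_rfl
  have hrm : ∀ n', Measurable (r n') := fun n' =>
    Measurable.ite (((h.par_adapted q n').mono (H.le _) le_rfl) (measurableSet_singleton n))
      measurable_const measurable_const
  have hwle : ∀ ω, w ω ≤ 1 := fun ω => by
    simp only [hw]
    split_ifs with h1
    · exact ENNReal.inv_le_one.2 (by exact_mod_cast Finset.card_pos.2 ⟨n, h1⟩)
    · exact zero_le
  have hone : ∀ A, MeasurableSet[H q] A → ∀ n', ∫⁻ ω in {ω | n' ∈ newAt p X par q ω},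
      A.indicator (r n') ω ∂μ = ∫⁻ ω in {ω | n' ∈ newAt p X par q ω}, A.indicator w ω ∂μ := by
    intro A hAm n'
    have hnH : MeasurableSet[H q] {ω | n' ∈ newAt p X par q ω} :=
      measurableSet_mem_finset (h.measurable_newAt hA hξ hk q) n'
    -- The factors select the event that `n` is the parent of `n'` and equal `1` for the other new
    -- labels, whose averages are `1` because survivors exist.
    have h1 := h.lintegral_prod_par hA hξ hk q
      (U := ({ω | n' ∈ newAt p X par q ω} ∩ A).indicator fun _ => (1 : ℝ≥0∞))
      (measurable_const.indicator (MeasurableSet.inter hnH hAm))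
      (r := fun l j _ => if l = n' then (if j = n then 1 else 0) else 1)
      (fun _ _ => measurable_const)
    rw [← lintegral_indicator (H.le q _ hnH), ← lintegral_indicator (H.le q _ hnH)]
    refine (lintegral_congr fun ω => ?_).trans (h1.trans (lintegral_congr fun ω => ?_))
    · by_cases h2 : n' ∈ newAt p X par q ω
      · rw [Finset.prod_eq_single n' (fun l _ hl => if_neg hl) fun h3 => absurd h2 h3, if_pos rfl]
        by_cases h3 : ω ∈ A <;> simp [Set.indicator, h2, h3, hr]
      · simp [Set.indicator, h2]
    · by_cases h2 : n' ∈ newAt p X par q ω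
      · have h3 : (onGtAt p X par q ω).Nonempty :=
          p.onGt_nonempty (h.valid hN q ω).card_on (not_lt_of_mem_newAt h2)
        have h4 : (onGtAt p X par q ω).card ≠ 0 := h3.card_pos.ne'
        rw [Finset.prod_eq_single n' (fun l _ hl => ?_) fun h3 => absurd h2 h3]
        · by_cases h5 : ω ∈ A <;> simp [Set.indicator, h2, h5, hw]
        · simp only [if_neg hl, mul_one, Finset.sum_const, nsmul_eq_mul]
          exact ENNReal.mul_inv_cancel (by exact_mod_cast h4) (ENNReal.natCast_ne_top _)
      · simp [Set.indicator, h2]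
  have hfg : ∀ A, MeasurableSet[H q] A →
      ∫⁻ ω in A, 1 + ∑ n' ∈ newAt p X par q ω, r n' ω ∂μ =
        ∫⁻ ω in A, 1 + ∑ _n' ∈ newAt p X par q ω, w ω ∂μ := by
    intro A hAm
    have hAm' := H.le q _ hAm
    have hsum : ∀ g : ℕ → Ω → ℝ≥0∞, (∀ l, Measurable (g l)) →
        ∫⁻ ω in A, ∑ n' ∈ newAt p X par q ω, g n' ω ∂μ = ∑' n',
          ∫⁻ ω in {ω | n' ∈ newAt p X par q ω}, A.indicator (g n') ω ∂μ := by
      intro g hg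
      rw [← lintegral_random_sum hnewm fun n => (hg n).indicator hAm', ← lintegral_indicator hAm']
      refine lintegral_congr fun ω => ?_
      by_cases h1 : ω ∈ A <;> simp [Set.indicator, h1]
    rw [lintegral_add_left measurable_const, lintegral_add_left measurable_const,
      hsum r hrm, hsum (fun _ => w) fun _ => (hwm hgt).mono hm le_rfl]
    congr 1
    exact tsum_congr fun n' => hone A hAm n'
  have hfm : Measurable fun ω => 1 + ∑ n' ∈ newAt p X par q ω, r n' ω :=
    measurable_const.add (measurable_random_sum hnewm hrm)
  have hbound : ∀ ω, 1 + ∑ _n' ∈ newAt p X par q ω, w ω ≤ 1 + p.nrep := by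
    intro ω
    gcongr
    by_cases hlt : (p.zmax : EReal) < levelAt p X par q ω
    · rw [newAt_of_lt hlt]
      simp
    · calc _ ≤ ∑ _n' ∈ newAt p X par q ω, (1 : ℝ≥0∞) := Finset.sum_le_sum fun _ _ => hwle ω
        _ = ((newAt p X par q ω).card : ℝ≥0∞) := by simp
        _ ≤ _ := by
            have h1 : (newAt p X par q ω).card = _ := p.card_newLabels hlt
            have h2 := p.card_onLe_add_card_onGt (x := fun n => X q n ω) (h.valid hN q ω).card_on
            rw [h1]
            exact_mod_cast (by omega)
  have hfi : ∫⁻ ω, 1 + ∑ n' ∈ newAt p X par q ω, r n' ω ∂μ ≠ ∞ := by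
    have h1 := hfg Set.univ MeasurableSet.univ
    rw [setLIntegral_univ, setLIntegral_univ] at h1
    rw [h1]
    refine ne_top_of_le_ne_top ?_ (lintegral_mono hbound)
    rw [lintegral_const, measure_univ, mul_one]
    exact ENNReal.add_ne_top.2 ⟨ENNReal.one_ne_top, ENNReal.natCast_ne_top _⟩
  have key := condExp_toReal_of_trace (H.le q) hm (h.measurableSet_level_lt_top hA hξ hk hN q) htr
    hfm hfi (g := fun ω => 1 + ∑ _n' ∈ newAt p X par q ω, w ω)
    (measurable_const.add (measurable_random_sum hnew fun _ => hwm hgt)) hfg fun ω hω => by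
      simp [h.newAt_of_level_top hA hξ hk hN hω]
  have hL : (fun ω => ((toScheme p X par).branch q n ω : ℝ)) = fun ω =>
      (1 + ∑ n' ∈ newAt p X par q ω, r n' ω).toReal := by
    ext ω
    have h1 : 1 + ∑ n' ∈ newAt p X par q ω, r n' ω =
        (((toScheme p X par).branch q n ω : ℕ) : ℝ≥0∞) := by
      simp [hr, toScheme]
    rw [h1, ENNReal.toReal_natCast]
  rw [hL]
  refine key.trans (ae_of_all _ fun ω => ?_)
  have hwt : (newAt p X par q ω).card * w ω ≠ ∞ :=
    ENNReal.mul_ne_top (ENNReal.natCast_ne_top _)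
      (ne_top_of_le_ne_top ENNReal.one_ne_top (hwle ω))
  simp only [Finset.sum_const, nsmul_eq_mul]
  rw [ENNReal.toReal_add ENNReal.one_ne_top hwt, ENNReal.toReal_mul, ENNReal.toReal_natCast,
    ENNReal.toReal_one]
  simp only [hw]
  split_ifs <;> simp [div_eq_mul_inv]

end Conditional

lemma condExp_branch_field (q n : ℕ) :
    μ[fun ω => ((toScheme p X par).branch q n ω : ℝ) |
      (toScheme p X par).field mΩ (levelFilt p.A p.ξ) q] =ᵐ[μ] fun ω =>
      1 + if n ∈ onGtAt p X par q ω then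
        ((newAt p X par q ω).card : ℝ) / (onGtAt p X par q ω).card else 0 :=
  have hon := h.measurable_on_levelField hA hξ hk hN q
  h.condExp_branch hA hξ hk hN GAMS.stoppedField_le (h.field_le_traceOn hA hξ hk hN q)
    (h.measurable_new_field hA hξ hk hN hon) (h.measurable_onGt_field hA hξ hk hN hon) n

/-- Both conditional probabilities are given by the one formula of `condExp_parentMap`. -/
lemma parent_sampled (q : ℕ) (a : ℕ → ℕ) :
    μ⟦{ω | ∀ n, (toScheme p X par).parentMap q n ω = a n} | H q⟧ =ᵐ[μ]
      μ⟦{ω | ∀ n, (toScheme p X par).parentMap q n ω = a n} |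
        (toScheme p X par).field mΩ (levelFilt p.A p.ξ) q⟧ := by
  have hon := h.measurable_on_levelField hA hξ hk hN q
  have h1 := h.condExp_parentMap hA hξ hk hN GAMS.stoppedField_le
    (h.field_le_traceOn hA hξ hk hN q) (h.measurable_new_field hA hξ hk hN hon)
    (h.measurable_onGt_field hA hξ hk hN hon) (h.measurable_labels_field hA hξ hk hN hon) a
  have h2 := h.condExp_parentMap hA hξ hk hN (H.le q) (fun G hG =>
    MeasurableSet.inter hG (h.measurableSet_level_lt_top hA hξ hk hN q))
    (h.measurable_newAt hA hξ hk q) (h.measurable_onGtAt hA hξ hk q)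
    (h.measurable_labelsAt hA hξ hk q) a
  exact h2.trans h1.symm

/-- With `K` retired out of `N`, the mean branching number of a survivor is `1 + K/(N - K) = N/(N -
K)`, the inverse of the weight factor; for a retired replica it is `1`. -/
lemma weight_succ (q : ℕ) : ∀ᵐ ω ∂μ, ∀ n ∈ (toScheme p X par).labels (q + 1) ω,
    (toScheme p X par).weight (q + 1) n ω =
      (toScheme p X par).weight q ((toScheme p X par).parentMap q n ω) ω /
        (μ[fun ω' => ((toScheme p X par).branch q ((toScheme p X par).parentMap q n ω) ω' : ℝ) |
          (toScheme p X par).field mΩ (levelFilt p.A p.ξ) q]) ω := by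
  filter_upwards [ae_all_iff.2 fun n => h.condExp_branch_field hA hξ hk hN q n] with ω hω n hn
  rw [hω]
  have hv := h.valid hN q ω
  change (stateAt p X par (q + 1) ω).weight n = (stateAt p X par q ω).weight _ / _
  by_cases hlt : (p.zmax : EReal) < levelAt p X par q ω
  · have hn' : n ∈ (stateAt p X par (q + 1) ω).on ∪ (stateAt p X par (q + 1) ω).off := hn
    rw [stateAt_succ_of_lt hlt] at hn' ⊢
    rw [h.parentMap_of_old hN hn', newAt_of_lt hlt]
    simp
  · have hn' : n ∈ (stateAt p X par (q + 1) ω).on ∪ (stateAt p X par (q + 1) ω).off := hn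
    have hpos : (0 : ℝ) < (onGtAt p X par q ω).card := by
      exact_mod_cast (p.onGt_nonempty (x := fun n => X q n ω) hv.card_on hlt).card_pos
    have hN' : (0 : ℝ) < p.nrep := by exact_mod_cast hN
    have hnew : (newAt p X par q ω).card = _ := p.card_newLabels hlt
    have hcard : ((newAt p X par q ω).card : ℝ) + (onGtAt p X par q ω).card = p.nrep := by
      rw [hnew]
      exact_mod_cast p.card_onLe_add_card_onGt (x := fun n => X q n ω) hv.card_on
    have hfac : p.factor (stateAt p X par q ω) (fun n => X q n ω) =
        (onGtAt p X par q ω).card / p.nrep := p.factor_eq hv.card_on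
    have hdiv : 1 + ((newAt p X par q ω).card : ℝ) / (onGtAt p X par q ω).card =
        p.nrep / (onGtAt p X par q ω).card := by
      rw [← hcard]
      field_simp
      ring
    rw [stateAt_succ, p.step_on hlt, p.step_off hlt] at hn'
    rw [stateAt_succ]
    rcases Finset.mem_union.1 hn' with h1 | h1
    · rcases Finset.mem_union.1 h1 with h2 | h2
      · rw [p.step_weight_onGt hlt h2, h.parentMap_of_old hN
          (Finset.mem_union_left _ (p.onGt_subset h2)), if_pos (show n ∈ onGtAt p X par q ω from h2),
          hdiv, hfac]
        field_simp
      · rw [p.step_weight_new hv hlt h2, h.parentMap_of_new hN h2,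
          if_pos (h.par_mem q ω n h2), hdiv, hfac]
        field_simp
    · have h2 : n ∈ (stateAt p X par q ω).on ∪ (stateAt p X par q ω).off := by
        rcases Finset.mem_union.1 h1 with h2 | h2
        · exact Finset.mem_union_right _ h2
        · exact Finset.mem_union_left _ (p.onLe_subset h2)
      have h3 : n ∉ onGtAt p X par q ω := by
        intro h3
        rcases Finset.mem_union.1 h1 with h4 | h4
        · exact Finset.disjoint_left.1 hv.disjoint (p.onGt_subset h3) h4
        · exact Finset.disjoint_left.1 p.disjoint_onLe_onGt h4 h3
      rw [p.step_weight_off hv hlt h1, h.parentMap_of_old hN h2, if_neg h3, add_zero, div_one]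

/-- The parent map generates less than all the variables `par q n`, whose values off the new labels
are arbitrary. The product is measurable for the smaller σ-field, so the tower property applies.
When there are new labels the level is real, and `extKernel` is then `resample`. -/
lemma resampled (q : ℕ) (s : ℕ → Set (ℕ → S)) (hs : ∀ n, MeasurableSet (s n)) :
    μ⟦{ω | ∀ n ∈ newAt p X par q ω, X (q + 1) n ω ∈ s n} |
        H q ⊔ (toScheme p X par).parentField q⟧ =ᵐ[μ]
      fun ω => ∏ n ∈ newAt p X par q ω,
        (GAMS.extKernel π (resample P p.A p.ξ) (levelAt p X par q ω)
          (X q (par q n ω) ω)).real (s n) := by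
  have hm'le : H q ⊔ ⨆ n, MeasurableSpace.comap (par q n) ⊤ ≤ mΩ :=
    sup_le (H.le q) (h.iSup_comap_par_le hA hξ hk q)
  have hHm' : H q ≤ H q ⊔ ⨆ n, MeasurableSpace.comap (par q n) ⊤ := le_sup_left
  have hpm : ∀ n, (toScheme p X par).parentMap q n = fun ω => if n ∈ newAt p X par q ω then
      par q n ω else if n ∈ (stateAt p X par q ω).on ∪ (stateAt p X par q ω).off then n else 0 := by
    intro n
    ext ω
    rw [GAMS.Scheme.parentMap, h.newLabels_eq hN, killed_eq, Finset.sdiff_empty]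
    rfl
  have hmm' : H q ⊔ (toScheme p X par).parentField q ≤
      H q ⊔ ⨆ n, MeasurableSpace.comap (par q n) ⊤ := by
    refine sup_le le_sup_left (iSup_le fun n => ?_)
    rw [hpm n]
    refine Measurable.comap_le (Measurable.ite
      (measurableSet_mem_finset ((h.measurable_newAt hA hξ hk q).mono hHm' le_rfl) n) ?_
      (Measurable.ite (measurableSet_mem_finset
        ((h.measurable_labelsAt hA hξ hk q).mono hHm' le_rfl) n) measurable_const measurable_const))
    exact (comap_measurable (par q n)).mono ((le_iSup (fun n => MeasurableSpace.comap (par q n) ⊤)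
      n).trans le_sup_right) le_rfl
  have hHm : H q ≤ H q ⊔ (toScheme p X par).parentField q := le_sup_left
  have hparm : ∀ n, Measurable[H q ⊔ (toScheme p X par).parentField q]
      ((toScheme p X par).parentMap q n) := fun n =>
    (comap_measurable _).mono ((le_iSup (fun n => MeasurableSpace.comap
      ((toScheme p X par).parentMap q n) ⊤) n).trans le_sup_right) le_rfl
  set g : Ω → ℝ := fun ω => ∏ n ∈ newAt p X par q ω,
    (resample P p.A p.ξ (levelAt p X par q ω).toReal
      (X q ((toScheme p X par).parentMap q n ω) ω)).real (s n) with hg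
  have hgm : Measurable[H q ⊔ (toScheme p X par).parentField q] g := by
    refine measurable_random_prod ((h.measurable_newAt hA hξ hk q).mono hHm le_rfl) fun n => ?_
    exact measurable_comp_countable (F := fun j ω =>
        (resample P p.A p.ξ (levelAt p X par q ω).toReal (X q j ω)).real (s n)) (hparm n)
      fun j => ((h.measurable_resample_X hA hξ hk q j (hs n)).mono hHm le_rfl).ennreal_toReal
  have h1 : μ⟦{ω | ∀ n ∈ newAt p X par q ω, X (q + 1) n ω ∈ s n} |
      H q ⊔ ⨆ n, MeasurableSpace.comap (par q n) ⊤⟧ =ᵐ[μ] g := by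
    refine (h.new_law q s hs).trans (ae_of_all _ fun ω => Finset.prod_congr rfl fun n hn => ?_)
    rw [h.parentMap_of_new hN hn]
  have hgi : Integrable g μ := (integrable_congr h1).1 integrable_condExp
  have h2 := condExp_condExp_of_le (μ := μ) (f := {ω | ∀ n ∈ newAt p X par q ω,
    X (q + 1) n ω ∈ s n}.indicator fun _ => (1 : ℝ)) hmm' hm'le
  refine h2.symm.trans ((condExp_congr_ae h1).trans ?_)
  rw [condExp_of_stronglyMeasurable (hmm'.trans hm'le) hgm.stronglyMeasurable hgi]
  refine ae_of_all _ fun ω => Finset.prod_congr rfl fun n hn => ?_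
  have h3 : levelAt p X par q ω ≠ ⊤ := p.level_ne_top (not_lt_of_mem_newAt hn)
  have h4 : levelAt p X par q ω ≠ ⊥ := p.level_ne_bot hk
  rw [h.parentMap_of_new hN hn, GAMS.extKernel, if_neg h4, if_neg h3]

lemma measurable_branch (q n : ℕ) :
    Measurable[H (q + 1)] ((toScheme p X par).branch q n) := by
  have hnew := (h.measurable_newAt hA hξ hk q).mono (H.mono (Nat.le_succ q)) le_rfl
  have h1 : (toScheme p X par).branch q n = fun ω =>
      1 + ∑ n' ∈ newAt p X par q ω, if par q n' ω = n then 1 else 0 := by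
    ext ω
    simp [toScheme]
  rw [h1]
  exact measurable_const.add (measurable_random_sum hnew fun n' => Measurable.ite
    (h.par_adapted q n' (measurableSet_singleton n)) measurable_const measurable_const)

lemma isGAMS [MeasurableSingletonClass S] :
    GAMS.IsGAMS μ H π (levelFilt p.A p.ξ) (resample P p.A p.ξ) p.nrep (toScheme p X par) where
  labels_adapted q := h.measurable_labelsAt hA hξ hk q
  X_adapted := h.X_adapted
  weight_adapted q := (h.isMeasurable_stateAt hA hξ hk q).weight
  level_adapted q := h.measurable_levelAt hA hξ hk q
  branch_adapted := h.measurable_branch hA hξ hk hN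
  par_adapted := h.par_adapted
  pos := hN
  labels_zero ω := Finset.union_empty _
  law_zero := h.law_zero
  indep_zero := h.indep_zero
  weight_zero ω n _ := rfl
  run_measurable q := h.measurableSet_run_field hA hξ hk hN
    (h.measurable_on_levelField hA hξ hk hN q)
  halted q ω hq := by
    have hlt : (p.zmax : EReal) < levelAt p X par q ω := not_le.1 hq
    have h1 := h.levelAt_succ_of_lt hlt
    refine ⟨fun h2 => hq ?_, h1, fun n _ => ?_⟩
    · exact h1.symm.le.trans h2
    · simp [toScheme, newAt_of_lt hlt]
  parent_sampled := h.parent_sampled hA hξ hk hN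
  branch_pos q n := by
    filter_upwards [h.condExp_branch_field hA hξ hk hN q n] with ω hω _
    rw [hω]
    positivity
  labels_succ q ω := by
    rw [killed_eq, Finset.sdiff_empty, h.newLabels_eq hN]
    exact p.step_labels
  par_mem q ω n hn := by
    rw [h.newLabels_eq hN] at hn
    rw [killed_eq, Finset.sdiff_empty]
    exact Finset.mem_union_left _ (p.onGt_subset (h.par_mem q ω n hn))
  card_children q ω n _ := by
    rw [h.newLabels_eq hN, add_comm]
    rfl
  weight_succ := h.weight_succ hA hξ hk hN
  keep q ω n hn := h.keep q ω n (Finset.mem_sdiff.1 hn).1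
  resampled q s hs := by
    simp only [h.newLabels_eq hN]
    exact h.resampled hA hξ hk hN q s hs
  level_le q := h.ae_levelAt_le_succ hA hξ hk q
  level_stopping q := h.isStoppingLevel_of hA hξ hk hN (h.measurable_on_levelField hA hξ hk hN q)

end Sampled

end IsAMS

end AMS

end

/-! ### The theorem -/

theorem mainTheorem2 {S Ω Ω' : Type*} [TopologicalSpace S] [PolishSpace S] [MeasurableSpace S]
    [BorelSpace S] [mΩ : MeasurableSpace Ω] [MeasurableSpace Ω']
    -- the Markov chain `Y`, started at `x₀`, with transition kernel `P`
    (P : Kernel S S) [IsMarkovKernel P] (x₀ : S)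
    (μ' : Measure Ω') [IsProbabilityMeasure μ'] (Y : ℕ → Ω' → S)
    (hY : AMS.IsMarkovChain P x₀ μ' Y)
    -- the sets `A = p.A` and `B`, the reaction coordinate and the other parameters
    (p : AMS.Params S) (B : Set S) (hA : MeasurableSet p.A) (hB : MeasurableSet B)
    (hAB : Disjoint p.A B) (hξ : Measurable p.ξ) (hBz : B ⊆ p.ξ ⁻¹' Set.Ioi p.zmax)
    (hk : 1 ≤ p.k) (hkn : p.k < p.nrep)
    -- the law of the chain stopped in `A`
    (π : Measure (ℕ → S)) (hπ : π = μ'.map (fun ω => AMS.stopIn p.A (fun t => Y t ω)))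
    -- a run of the algorithm
    (μ : Measure Ω) [IsProbabilityMeasure μ] (H : Filtration ℕ mΩ)
    (X : ℕ → ℕ → Ω → ℕ → S) (par : ℕ → ℕ → Ω → ℕ)
    (hrun : AMS.IsAMS p X par P π μ H) :
    -- the algorithm fits the general framework
    GAMS.Setting π {x | x 0 = x₀} (AMS.levelFilt p.A p.ξ) (AMS.resample P p.A p.ξ) ∧
    GAMS.IsGAMS μ H π (AMS.levelFilt p.A p.ξ) (AMS.resample P p.A p.ξ) p.nrep
      (AMS.toScheme p X par) ∧
    -- mass is conserved
    (∀ q, ∀ᵐ ω ∂μ, (AMS.toScheme p X par).estimate (fun _ => 1) q ω = 1) ∧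
    -- if the algorithm stops almost surely, its estimators are unbiased
    ((∀ᵐ ω ∂μ, (AMS.toScheme p X par).iterations ω ≠ ⊤) →
      (∀ φ : (ℕ → S) → ℝ, Measurable φ → (∃ C, ∀ x, |φ x| ≤ C) →
        Integrable ((AMS.toScheme p X par).finalEstimate φ) μ ∧
        ∫ ω, (AMS.toScheme p X par).finalEstimate φ ω ∂μ =
          ∫ ω, φ (AMS.stopIn p.A (fun t => Y t ω)) ∂μ') ∧
      Integrable (AMS.pHat p X par B) μ ∧
      ∫ ω, AMS.pHat p X par B ω ∂μ =
        μ'.real {ω | AMS.hit B (fun t => Y t ω) < AMS.hit p.A (fun t => Y t ω)}) := by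
  have hN : 0 < p.nrep := (Nat.zero_le _).trans_lt hkn
  have hπ' : π = AMS.cont P p.A 0 fun _ => x₀ := hπ.trans (hY.law_stopped hA)
  have hYm : Measurable fun ω => AMS.stopIn p.A fun t => Y t ω :=
    (AMS.measurable_stopIn hA).comp hY.measurable_path
  have hunb : (∀ᵐ ω ∂μ, (AMS.toScheme p X par).iterations ω ≠ ⊤) →
      ∀ φ : (ℕ → S) → ℝ, Measurable φ → (∃ C, ∀ x, |φ x| ≤ C) →
        Integrable ((AMS.toScheme p X par).finalEstimate φ) μ ∧
        ∫ ω, (AMS.toScheme p X par).finalEstimate φ ω ∂μ =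
          ∫ ω, φ (AMS.stopIn p.A (fun t => Y t ω)) ∂μ' := by
    rintro hfinite φ hφ ⟨C, hC⟩
    rw [← integral_map hYm.aemeasurable hφ.aestronglyMeasurable, ← hπ]
    exact hrun.integral_finalEstimate hN hA hξ hk x₀ hπ' hfinite hφ hC
  refine ⟨hπ' ▸ AMS.setting P x₀ hA hξ, hrun.isGAMS hA hξ hk hN,
    fun q => ae_of_all _ (hrun.estimate_one hN q), fun hfinite => ⟨hunb hfinite, ?_⟩⟩
  have hm := AMS.measurableSet_hit_lt_hit hA hB
  -- The probability is the case of the indicator of reaching `B` before `A`.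
  obtain ⟨h1, h2⟩ := hunb hfinite ({x | AMS.hit B x < AMS.hit p.A x}.indicator fun _ => 1)
    (measurable_const.indicator hm) ⟨1, fun x => by
      by_cases hx : AMS.hit B x < AMS.hit p.A x <;> simp [Set.indicator, hx]⟩
  have h3 : AMS.pHat p X par B = (AMS.toScheme p X par).finalEstimate
      ({x | AMS.hit B x < AMS.hit p.A x}.indicator fun _ => 1) :=
    funext (hrun.pHat_eq_finalEstimate hN hBz)
  rw [h3]
  refine ⟨h1, h2.trans ?_⟩
  have h4 : MeasurableSet {ω | AMS.hit B (fun t => Y t ω) < AMS.hit p.A (fun t => Y t ω)} :=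
    hY.measurable_path hm
  rw [← integral_indicator_one h4]
  refine integral_congr_ae (ae_of_all _ fun ω => ?_)
  simp only [Set.indicator, Set.mem_ofPred_eq, AMS.hit_lt_hit_stopIn, Pi.one_apply]
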